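/- **Theorem.** Let $\alpha\ge 0$ and $\gamma\in\mathbb R$. For $u\in(0,1)$ put $$\theta(\gamma,u)=\frac{\gamma}{1-u^\gamma}\ (\gamma\ne0),\qquad \theta(0,u)=-\frac1{\log u},$$ $$\widetilde J_\alpha(\gamma,u)=\frac{u^\gamma-1-\gamma u^\gamma\log u}{\gamma^2}\Big(\frac{1-u^\gamma}{\gamma}\Big)^{\alpha}\ (\gamma\ne0),\qquad \widetilde J_\alpha(0,u)=-\tfrac12(\log u)^2(-\log u)^\alpha .$$ Let $k=k_n$ be positive integers with $k_n\to\infty$ as $n\to\infty$, and for each $n$ let $Y_{n,1},\dots,Y_{n,k-1}$ be real random variables (in the application $Y_{n,j}=j\log\frac{X_{(n-j+1)}-X_{(n-k)}}{X_{(n-j)}-X_{(n-k)}}$ for the order statistics $X_{(1)}\le\dots\le X_{(n)}$ of a sample of size $n$). Assume that the exponential regression approximation with parameter $\gamma$ holds uniformly: if $W_{n,1},\dots,W_{n,k-1}$ are independent and $W_{n,j}$ is exponential with mean $\theta_j=\theta(\gamma,\frac j{k+1})$, then $$\sup_{A}\big|P\big((Y_{n,1},\dots,Y_{n,k-1})\in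 A\big)-P\big((W_{n,1},\dots,W_{n,k-1})\in A\big)\big|\longrightarrow 0\qquad(n\to\infty),$$ where $A$ runs over the Borel sets of $\mathbb R^{k-1}$. The minimum density power divergence estimating equation with tuning parameter $\alpha$ is the equation $$\sum_{j=1}^{k-1}\widetilde J_\alpha\big(g,\tfrac j{k+1}\big)\Big[\frac{\alpha\,\vartheta_j}{(1+\alpha)^2}+(Y_{n,j}-\vartheta_j)\,e^{-\alpha Y_{n,j}/\vartheta_j}\Big]=0,\qquad \vartheta_j=\theta\big(g,\tfrac j{k+1}\big),$$ in the unknown $g\in\mathbb R$. A consistent sequence of roots is a sequence of random variables $\gamma^{(\alpha)}_{k,n}$ on the same probability spaces as the $Y_{n,j}$ that solve this equation with probability tending to $1$ and converge to $\gamma$ in probability. Then: 1. A consistent sequence of roots $\gamma_{k,n}^{(\alpha)}$ exists. 2. For every consistent sequence of roots, $\sqrt{k-1}\,\big(\gamma_{k,n}^{(\alpha)}-\gamma\big)$ converges in distribution to the normal law with mean $0$ and variance $\sigma_\gamma^2/a_\gamma^2$, provided that this variance exists, that is, provided that the integrals below are finite. Here, for $\gamma\neq0$, $$a_\gamma=\frac{1+\alpha^2}{(1+\alpha)^3|\gamma|^{\alpha+2}}\int_0^1(1-u^\gamma+\gamma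 u^\gamma\log u)^2\,|1-u^\gamma|^{\alpha-2}\,du,$$ $$\sigma_\gamma^2=\Big[\frac{1+4\alpha^2}{(1+2\alpha)^3}-\frac{\alpha^2}{(1+\alpha)^4}\Big]\frac1{|\gamma|^{2\alpha+2}}\int_0^1(1-u^\gamma+\gamma u^\gamma\log u)^2\,|1-u^\gamma|^{2\alpha-2}\,du,$$ and, for $\gamma=0$, $$a_0=\frac{1+\alpha^2}{4(1+\alpha)^3}\int_0^1(-\log u)^{\alpha+2}\,du,\qquad \sigma_0^2=\Big[\frac{1+4\alpha^2}{(1+2\alpha)^3}-\frac{\alpha^2}{(1+\alpha)^4}\Big]\frac14\int_0^1(-\log u)^{2\alpha+2}\,du .$$ -/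

import Mathlib

open MeasureTheory ProbabilityTheory Filter Set

noncomputable section

namespace TailIndex

/-- The design points `u_j = j / (k + 1)`, `j = 1, …, k - 1` (here `j = i + 1`). -/
def designPoint (k : ℕ) (i : Fin (k - 1)) : ℝ := ((i : ℕ) + 1 : ℝ) / ((k : ℝ) + 1)

/-- The mean function of the exponential regression model, `θ(γ, u) = γ / (1 - u ^ γ)`, with its
continuous extension `-1 / log u` at `γ = 0`.  The `j`-th mean is `θ_j = θ(γ, j / (k + 1))`. -/
def theta (γ u : ℝ) : ℝ :=
  if γ = 0 then -1 / Real.log u else γ / (1 - u ^ γ)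

/-- The weight `(u ^ γ - 1 - γ u ^ γ log u) (1 - u ^ γ) ^ α γ ^ (-α - 2)`, in which the two real
powers are taken together as `((1 - u ^ γ) / γ) ^ α / γ ^ 2` (so that the base is positive also for
`γ < 0`), with its continuous extension at `γ = 0`. -/
def weight (α γ u : ℝ) : ℝ :=
  if γ = 0 then -(Real.log u) ^ 2 / 2 * (-Real.log u) ^ α
  else (u ^ γ - 1 - γ * u ^ γ * Real.log u) / γ ^ 2 * ((1 - u ^ γ) / γ) ^ α

/-- Left-hand side, at the candidate value `γ`, of the minimum density power divergence estimating
equation with tuning parameter `α`, for the data `y_1, …, y_{k-1}`. -/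
def estimatingFunction (α : ℝ) (k : ℕ) (y : Fin (k - 1) → ℝ) (γ : ℝ) : ℝ :=
  ∑ i : Fin (k - 1), weight α γ (designPoint k i) *
    (α * theta γ (designPoint k i) / (1 + α) ^ 2 +
      (y i - theta γ (designPoint k i)) * Real.exp (-(α * y i / theta γ (designPoint k i))))

/-- The exponential regression model: the law of `k - 1` independent exponential variables, the
`j`-th one with mean `θ_j` (that is, with rate `1 / θ_j`). -/
def ermLaw (γ : ℝ) (k : ℕ) : Measure (Fin (k - 1) → ℝ) :=
  Measure.pi fun i => expMeasure (theta γ (designPoint k i))⁻¹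

/-- The exponential regression approximation holds uniformly: the joint law of
`Y_n = (Y_{n,1}, …, Y_{n,k_n-1})` and that of the exponential regression model with parameter `γ`
differ, uniformly over all events, by a quantity that tends to `0`. -/
def ERMApproximation {Ω : ℕ → Type*} [∀ n, MeasurableSpace (Ω n)] (P : ∀ n, Measure (Ω n))
    (γ : ℝ) (k : ℕ → ℕ) (Y : ∀ n, Ω n → Fin (k n - 1) → ℝ) : Prop :=
  ∀ ε : ℝ, 0 < ε → ∀ᶠ n in atTop, ∀ A : Set (Fin (k n - 1) → ℝ), MeasurableSet A →
    |(P n).real (Y n ⁻¹' A) - (ermLaw γ (k n)).real A| ≤ ε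

/-- `g_n` is a consistent sequence of roots of the estimating equation: estimators (measurable) that
solve the equation with probability tending to `1` and converge to `γ` in probability. -/
structure IsConsistentRootSequence {Ω : ℕ → Type*} [∀ n, MeasurableSpace (Ω n)]
    (P : ∀ n, Measure (Ω n)) (α γ : ℝ) (k : ℕ → ℕ) (Y : ∀ n, Ω n → Fin (k n - 1) → ℝ)
    (g : ∀ n, Ω n → ℝ) : Prop where
  measurable : ∀ n, Measurable (g n)
  root : Tendsto (fun n => P n {ω | estimatingFunction α (k n) (Y n ω) (g n ω) = 0}) atTop (nhds 1)
  consistent : ∀ ε : ℝ, 0 < ε → Tendsto (fun n => P n {ω | ε ≤ |g n ω - γ|}) atTop (nhds 0)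

/-- The integrand of `a_γ`.  For `γ < 0` both `γ` and `1 - u ^ γ` are negative, and their real
powers are those of the absolute values. -/
def aIntegrand (α γ u : ℝ) : ℝ :=
  if γ = 0 then (-Real.log u) ^ (α + 2)
  else (1 - u ^ γ + γ * u ^ γ * Real.log u) ^ 2 * |1 - u ^ γ| ^ (α - 2)

/-- The integrand of `σ_γ²`. -/
def sigmaSqIntegrand (α γ u : ℝ) : ℝ :=
  if γ = 0 then (-Real.log u) ^ (2 * α + 2)
  else (1 - u ^ γ + γ * u ^ γ * Real.log u) ^ 2 * |1 - u ^ γ| ^ (2 * α - 2)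

/-- The constant `a_γ`. -/
def aConst (α γ : ℝ) : ℝ :=
  if γ = 0 then
    (1 + α ^ 2) / (4 * (1 + α) ^ 3) * ∫ u in Ioo (0 : ℝ) 1, aIntegrand α γ u
  else
    (1 + α ^ 2) / ((1 + α) ^ 3 * |γ| ^ (α + 2)) * ∫ u in Ioo (0 : ℝ) 1, aIntegrand α γ u

/-- The constant `σ_γ²`. -/
def sigmaSq (α γ : ℝ) : ℝ :=
  if γ = 0 then
    ((1 + 4 * α ^ 2) / (1 + 2 * α) ^ 3 - α ^ 2 / (1 + α) ^ 4) * (1 / 4) *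
      ∫ u in Ioo (0 : ℝ) 1, sigmaSqIntegrand α γ u
  else
    ((1 + 4 * α ^ 2) / (1 + 2 * α) ^ 3 - α ^ 2 / (1 + α) ^ 4) * (1 / |γ| ^ (2 * α + 2)) *
      ∫ u in Ioo (0 : ℝ) 1, sigmaSqIntegrand α γ u

/-- The asymptotic variance exists: the integrals that define `a_γ` and `σ_γ²` are finite. -/
def AsymptoticVarianceExists (α γ : ℝ) : Prop :=
  IntegrableOn (aIntegrand α γ) (Ioo 0 1) ∧ IntegrableOn (sigmaSqIntegrand α γ) (Ioo 0 1)

end TailIndex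

end

/-! Put `ℓ = -log u`. Both model functions come from the rate `D₀(g) = 1/θ(g,u) = ∫₀^ℓ e^{-gs} ds`:
the weight is `D₁ D₀^α`, where `D₁` is the derivative of `D₀` in `g`. The integral form treats `g =
0` and both signs of `g` alike. It shows that the rate is positive and strictly decreasing in `g`,
and bounds each derivative relative to the rate by a power of `ℓ`. In the model `Y_j = E_j / D₀(γ)`
with `E_j` standard exponential, so each summand at `g` is a negative coefficient times `stdScore α
(r E_j)` with `r = D₀(g)/D₀(γ)`. Statements about the model pass to the data because the
approximation is uniform over events.

Existence. The mean of the score has the sign of `r - 1`, hence the mean of the estimating function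
is negative for `g < γ` and positive for `g > γ`. By Chebyshev the random function has these signs
at `γ ± ε` once its variance is negligible against its squared mean. If `α max(-γ,0) = 0` and `ε` is
small, the variances have an integrable singularity at `u = 0`, so their sum is of order `k` while
the squared mean is at least of order `k²`. If `α > 0` and `γ < 0` they may fail to be integrable,
but there `r` tends to `0` or `∞`, the score becomes nearly deterministic, and its variance is small
relative to its squared mean (`eventually_scoreVar_rateQuot_le`,
`sum_designPoint_le_of_singularity`). Continuity gives a root between the two points, a countable
infimum selects it measurably, and a diagonal choice lets `ε` tend to `0`.

Normality. Finiteness of the variance integral forces `2 α max(-γ,0) < 1` (`two_mul_max_lt_one`),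
which makes all the Riemann sums below converge or stay of order `k`. Expand the estimating function
at `γ`: its value is a weighted sum of i.i.d. centred scores, asymptotically normal by
characteristic functions; its slope divided by `k + 1` tends to `a_γ` by Chebyshev; its second
derivative near `γ` is of order `k` in probability. Solving the expansion at a consistent root
compares the standardized root with `leadingTerm`, and Slutsky's theorem concludes. -/

noncomputable section

namespace TailIndex

/-! ### The reciprocal mean function and its derivatives in the parameter -/

/-- `∫₀^ℓ (-s)^i e^{-g s} ds`, the `i`-th derivative in `g` of the rate `(1 - e^{-g ℓ}) / g`. -/
def rateMoment (i : ℕ) (ℓ g : ℝ) : ℝ := ∫ s in (0 : ℝ)..ℓ, (-s) ^ i * Real.exp (-(g * s))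

lemma continuous_rateMoment_integrand (i : ℕ) (g : ℝ) :
    Continuous fun s : ℝ => (-s) ^ i * Real.exp (-(g * s)) := by fun_prop

lemma continuous_rateMoment_length (i : ℕ) (g : ℝ) : Continuous fun ℓ => rateMoment i ℓ g := by
  unfold rateMoment
  exact intervalIntegral.continuous_primitive
    (fun a b => (continuous_rateMoment_integrand i g).intervalIntegrable a b) 0

/-- Differentiation under the integral sign; on the unit ball around `g` the exponent is at most
`(|g| + 1) |s|`, which gives the dominating function. -/
lemma hasDerivAt_rateMoment (i : ℕ) (ℓ g : ℝ) :
    HasDerivAt (rateMoment i ℓ) (rateMoment (i + 1) ℓ g) g := by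
  unfold rateMoment
  refine (intervalIntegral.hasDerivAt_integral_of_dominated_loc_of_deriv_le
    (F := fun g s => (-s) ^ i * Real.exp (-(g * s)))
    (F' := fun g s => (-s) ^ (i + 1) * Real.exp (-(g * s)))
    (bound := fun s => |s| ^ (i + 1) * Real.exp ((|g| + 1) * |s|))
    (Metric.ball_mem_nhds g one_pos) ?_ ?_ ?_ ?_ ?_ ?_).2
  · exact Eventually.of_forall fun x =>
      (continuous_rateMoment_integrand i x).aestronglyMeasurable
  · exact (continuous_rateMoment_integrand i g).intervalIntegrable _ _
  · exact (continuous_rateMoment_integrand (i + 1) g).aestronglyMeasurable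
  · refine Eventually.of_forall fun s _ x hx => ?_
    rw [norm_mul, norm_pow, Real.norm_eq_abs, Real.norm_eq_abs, abs_neg, Real.abs_exp]
    gcongr
    have h1 : |x| ≤ |g| + 1 := by
      have := abs_sub_abs_le_abs_sub x g
      rw [Metric.mem_ball, Real.dist_eq] at hx
      linarith
    calc -(x * s) ≤ |x * s| := neg_le_abs _
      _ = |x| * |s| := abs_mul _ _
      _ ≤ _ := by gcongr
  · exact Continuous.intervalIntegrable (by fun_prop) _ _
  · refine Eventually.of_forall fun s _ x _ => ?_
    have := (((hasDerivAt_id x).mul_const s).neg.exp).const_mul ((-s) ^ i)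
    refine this.congr_deriv ?_
    simp only [id_eq, Pi.neg_apply]
    ring

variable {ℓ : ℝ}

lemma rateMoment_zero_pos (hℓ : 0 < ℓ) (g : ℝ) : 0 < rateMoment 0 ℓ g := by
  unfold rateMoment
  refine intervalIntegral.intervalIntegral_pos_of_pos
    ((continuous_rateMoment_integrand 0 g).intervalIntegrable _ _) (fun s => ?_) hℓ
  positivity

lemma rateMoment_one_neg (hℓ : 0 < ℓ) (g : ℝ) : rateMoment 1 ℓ g < 0 := by
  have h : 0 < -rateMoment 1 ℓ g := by
    unfold rateMoment
    rw [← intervalIntegral.integral_neg]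
    refine intervalIntegral.intervalIntegral_pos_of_pos_on
      ((continuous_rateMoment_integrand 1 g).neg.intervalIntegrable _ _) (fun s hs => ?_) hℓ
    have := hs.1
    have : 0 < s * Real.exp (-(g * s)) := by positivity
    linarith
  linarith

/-- Since `s ≤ ℓ` under the integral, each derivative in the parameter costs only a factor `ℓ`, that
is, a logarithm of `u`, uniformly in `g`. -/
lemma abs_rateMoment_le (i : ℕ) (hℓ : 0 < ℓ) (g : ℝ) :
    |rateMoment i ℓ g| ≤ ℓ ^ i * rateMoment 0 ℓ g := by
  unfold rateMoment
  rw [← intervalIntegral.integral_const_mul]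
  refine (intervalIntegral.abs_integral_le_integral_abs hℓ.le).trans ?_
  refine intervalIntegral.integral_mono_on hℓ.le
    ((continuous_rateMoment_integrand i g).abs.intervalIntegrable _ _)
    (((continuous_rateMoment_integrand 0 g).const_mul _).intervalIntegrable _ _) fun s hs => ?_
  rw [abs_mul, abs_pow, abs_neg, Real.abs_exp, abs_of_nonneg hs.1, pow_zero, one_mul]
  gcongr
  · exact hs.1
  · exact hs.2

lemma rateMoment_zero_strictAnti (hℓ : 0 < ℓ) : StrictAnti (rateMoment 0 ℓ) :=
  strictAnti_of_deriv_neg fun g => by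
    rw [(hasDerivAt_rateMoment 0 ℓ g).deriv]
    exact rateMoment_one_neg hℓ g

/-- For `ℓ = -log u` this is the singularity `u ^ (-max (-g) 0)` up to a logarithm; it is the source
of every integrability condition below. -/
lemma rateMoment_zero_le (hℓ : 0 < ℓ) (g : ℝ) :
    rateMoment 0 ℓ g ≤ ℓ * Real.exp (max (-g) 0 * ℓ) := by
  unfold rateMoment
  have : ∫ s in (0 : ℝ)..ℓ, Real.exp (max (-g) 0 * ℓ) = ℓ * Real.exp (max (-g) 0 * ℓ) := by simp
  rw [← this]
  refine intervalIntegral.integral_mono_on hℓ.le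
    ((continuous_rateMoment_integrand 0 g).intervalIntegrable _ _)
    (by simp) fun s hs => ?_
  rw [pow_zero, one_mul, Real.exp_le_exp]
  calc -(g * s) = -g * s := by ring
    _ ≤ max (-g) 0 * s := by gcongr; exacts [hs.1, le_max_left _ _]
    _ ≤ _ := by gcongr; exact hs.2

/-- The two integrands differ by the factor `e^{-(g-γ)s}`. With `ℓ = -log u`, moving the parameter
costs a factor `u ^ (-|g - γ|)`, harmless for `g` near `γ`. -/
lemma rateMoment_zero_le_mul (hℓ : 0 < ℓ) (g γ : ℝ) :
    rateMoment 0 ℓ g ≤ Real.exp (|g - γ| * ℓ) * rateMoment 0 ℓ γ := by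
  unfold rateMoment
  rw [← intervalIntegral.integral_const_mul]
  refine intervalIntegral.integral_mono_on hℓ.le
    ((continuous_rateMoment_integrand 0 g).intervalIntegrable _ _)
    (((continuous_rateMoment_integrand 0 γ).const_mul _).intervalIntegrable _ _) fun s hs => ?_
  rw [pow_zero, one_mul, one_mul, ← Real.exp_add, Real.exp_le_exp]
  have h1 : -(g - γ) * s ≤ |g - γ| * s := by
    gcongr; exacts [hs.1, neg_le_abs _]
  have h2 : |g - γ| * s ≤ |g - γ| * ℓ := by gcongr; exact hs.2
  linarith

lemma rateMoment_zero_zero (ℓ : ℝ) : rateMoment 0 ℓ 0 = ℓ := by simp [rateMoment]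

lemma rateMoment_one_zero (ℓ : ℝ) : rateMoment 1 ℓ 0 = -(ℓ ^ 2 / 2) := by
  have : ∫ s in (0 : ℝ)..ℓ, -s = -∫ s in (0 : ℝ)..ℓ, s := intervalIntegral.integral_neg
  simp [rateMoment, this]

lemma rateMoment_zero_eq {g : ℝ} (hg : g ≠ 0) (ℓ : ℝ) :
    rateMoment 0 ℓ g = (1 - Real.exp (-(g * ℓ))) / g := by
  unfold rateMoment
  have h : ∀ s ∈ uIcc 0 ℓ, HasDerivAt (fun s => -Real.exp (-(g * s)) / g)
      ((-s) ^ 0 * Real.exp (-(g * s))) s := fun s _ => by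
    have := (((hasDerivAt_id s).const_mul g).neg.exp).neg.div_const g
    refine this.congr_deriv ?_
    simp only [id_eq, Pi.neg_apply]
    field_simp
  rw [intervalIntegral.integral_eq_sub_of_hasDerivAt h
    ((continuous_rateMoment_integrand 0 g).intervalIntegrable _ _)]
  simp
  ring

lemma rateMoment_one_eq {g : ℝ} (hg : g ≠ 0) (ℓ : ℝ) :
    rateMoment 1 ℓ g =
      (Real.exp (-(g * ℓ)) - 1 + g * Real.exp (-(g * ℓ)) * ℓ) / g ^ 2 := by
  unfold rateMoment
  have h : ∀ s ∈ uIcc 0 ℓ, HasDerivAt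
      (fun s => Real.exp (-(g * s)) * (g * s + 1) / g ^ 2)
      ((-s) ^ 1 * Real.exp (-(g * s))) s := fun s _ => by
    have := ((((hasDerivAt_id s).const_mul g).neg.exp).mul
      (((hasDerivAt_id s).const_mul g).add_const 1)).div_const (g ^ 2)
    refine this.congr_deriv ?_
    simp only [id_eq, Pi.neg_apply]
    field_simp
    ring
  rw [intervalIntegral.integral_eq_sub_of_hasDerivAt h
    ((continuous_rateMoment_integrand 1 g).intervalIntegrable _ _)]
  simp
  ring

/-! ### The model functions in terms of the rate -/

variable {u : ℝ}

lemma rpow_eq_exp_neg (hu : u ∈ Ioo (0 : ℝ) 1) (g : ℝ) :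
    u ^ g = Real.exp (-(g * -Real.log u)) := by
  rw [Real.rpow_def_of_pos hu.1]
  congr 1
  ring

lemma neg_log_pos (hu : u ∈ Ioo (0 : ℝ) 1) : 0 < -Real.log u :=
  neg_pos.2 (Real.log_neg hu.1 hu.2)

lemma inv_theta (hu : u ∈ Ioo (0 : ℝ) 1) (g : ℝ) :
    (theta g u)⁻¹ = rateMoment 0 (-Real.log u) g := by
  unfold theta
  split_ifs with hg
  · subst hg
    rw [rateMoment_zero_zero, neg_div, one_div, inv_neg, inv_inv]
  · rw [rateMoment_zero_eq hg, rpow_eq_exp_neg hu, inv_div]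

/-- Together with `inv_theta` this removes the case distinction at `g = 0` from the estimating
equation. -/
lemma weight_eq (hu : u ∈ Ioo (0 : ℝ) 1) (α g : ℝ) :
    weight α g u = rateMoment 1 (-Real.log u) g * rateMoment 0 (-Real.log u) g ^ α := by
  unfold weight
  split_ifs with hg
  · subst hg
    rw [rateMoment_zero_zero, rateMoment_one_zero]
    ring
  · rw [rateMoment_zero_eq hg, rateMoment_one_eq hg, rpow_eq_exp_neg hu]
    ring

/-! ### The normalized score and its derivatives -/

/-- The score of the density power divergence for an exponential variable, normalized so that the
argument has mean one at the true parameter. -/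
def stdScore (α x : ℝ) : ℝ := α / (1 + α) ^ 2 + (x - 1) * Real.exp (-(α * x))

/-- `x` times the derivative of `stdScore α`. -/
def stdScoreDeriv (α x : ℝ) : ℝ := x * (1 + α - α * x) * Real.exp (-(α * x))

/-- `x` times the derivative of `stdScoreDeriv α`. -/
def stdScoreDerivTwo (α x : ℝ) : ℝ :=
  x * (1 + α - α * (3 + α) * x + α ^ 2 * x ^ 2) * Real.exp (-(α * x))

lemma hasDerivAt_stdScore_mul {α y h h' g : ℝ} {f : ℝ → ℝ} (hf : HasDerivAt f h' g)
    (hh : f g = h) (h0 : h ≠ 0) :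
    HasDerivAt (fun g => stdScore α (y * f g)) (h' / h * stdScoreDeriv α (y * h)) g := by
  unfold stdScore stdScoreDeriv
  subst hh
  have := (((hf.const_mul y).sub_const 1).mul (((hf.const_mul y).const_mul α).neg.exp)).const_add
    (α / (1 + α) ^ 2)
  refine this.congr_deriv ?_
  simp only [Pi.neg_apply]
  field_simp
  ring

lemma hasDerivAt_stdScoreDeriv_mul {α y h h' g : ℝ} {f : ℝ → ℝ} (hf : HasDerivAt f h' g)
    (hh : f g = h) (h0 : h ≠ 0) :
    HasDerivAt (fun g => stdScoreDeriv α (y * f g)) (h' / h * stdScoreDerivTwo α (y * h)) g := by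
  unfold stdScoreDeriv stdScoreDerivTwo
  subst hh
  have := ((hf.const_mul y).mul ((((hf.const_mul y).const_mul α)).const_sub (1 + α))).mul
    (((hf.const_mul y).const_mul α).neg.exp)
  refine this.congr_deriv ?_
  simp only [Pi.neg_apply, Pi.mul_apply]
  field_simp
  ring

/-- `D_i / D_0`, with `D_i` the derivatives of the rate. -/
def rateRatio (i : ℕ) (ℓ g : ℝ) : ℝ := rateMoment i ℓ g / rateMoment 0 ℓ g

/-- The contribution of one observation `y` to the estimating function. -/
def term (α ℓ y g : ℝ) : ℝ :=
  rateMoment 0 ℓ g ^ α * (rateRatio 1 ℓ g * stdScore α (y * rateMoment 0 ℓ g))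

/-- The derivative of `term` in the parameter. -/
def termDeriv (α ℓ y g : ℝ) : ℝ :=
  rateMoment 0 ℓ g ^ α * (rateRatio 2 ℓ g * stdScore α (y * rateMoment 0 ℓ g) +
    rateRatio 1 ℓ g ^ 2 * ((α - 1) * stdScore α (y * rateMoment 0 ℓ g) +
      stdScoreDeriv α (y * rateMoment 0 ℓ g)))

/-- The second derivative of `term` in the parameter. -/
def termDerivTwo (α ℓ y g : ℝ) : ℝ :=
  rateMoment 0 ℓ g ^ α *
    (rateRatio 3 ℓ g * stdScore α (y * rateMoment 0 ℓ g) +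
      3 * (rateRatio 1 ℓ g * rateRatio 2 ℓ g) * ((α - 1) * stdScore α (y * rateMoment 0 ℓ g) +
        stdScoreDeriv α (y * rateMoment 0 ℓ g)) +
      rateRatio 1 ℓ g ^ 3 * ((α - 2) * ((α - 1) * stdScore α (y * rateMoment 0 ℓ g) +
        stdScoreDeriv α (y * rateMoment 0 ℓ g)) + (α - 1) * stdScoreDeriv α (y * rateMoment 0 ℓ g) +
        stdScoreDerivTwo α (y * rateMoment 0 ℓ g)))

variable {ℓ : ℝ}

lemma hasDerivAt_rateRatio (i : ℕ) (hℓ : 0 < ℓ) (g : ℝ) :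
    HasDerivAt (rateRatio i ℓ)
      (rateRatio (i + 1) ℓ g - rateRatio i ℓ g * rateRatio 1 ℓ g) g := by
  have h0 := (rateMoment_zero_pos hℓ g).ne'
  refine ((hasDerivAt_rateMoment i ℓ g).div (hasDerivAt_rateMoment 0 ℓ g) h0).congr_deriv ?_
  simp only [rateRatio]
  field_simp

lemma hasDerivAt_rateMoment_rpow (α : ℝ) (hℓ : 0 < ℓ) (g : ℝ) :
    HasDerivAt (fun g => rateMoment 0 ℓ g ^ α)
      (rateMoment 0 ℓ g ^ α * (α * rateRatio 1 ℓ g)) g := by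
  have h0 := rateMoment_zero_pos hℓ g
  refine ((hasDerivAt_rateMoment 0 ℓ g).rpow_const (p := α) (Or.inl h0.ne')).congr_deriv ?_
  rw [rateRatio, Real.rpow_sub_one h0.ne']
  ring

lemma hasDerivAt_term (α : ℝ) (hℓ : 0 < ℓ) (y g : ℝ) :
    HasDerivAt (term α ℓ y) (termDeriv α ℓ y g) g := by
  have h0 := (rateMoment_zero_pos hℓ g).ne'
  have := (hasDerivAt_rateMoment_rpow α hℓ g).mul ((hasDerivAt_rateRatio 1 hℓ g).mul
    (hasDerivAt_stdScore_mul (α := α) (y := y) (hasDerivAt_rateMoment 0 ℓ g) rfl h0))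
  refine this.congr_deriv ?_
  simp only [termDeriv, Pi.mul_apply]
  change _ + _ * (_ + _ * (rateRatio 1 ℓ g * _)) = _
  ring

lemma hasDerivAt_termDeriv (α : ℝ) (hℓ : 0 < ℓ) (y g : ℝ) :
    HasDerivAt (termDeriv α ℓ y) (termDerivTwo α ℓ y g) g := by
  have h0 := (rateMoment_zero_pos hℓ g).ne'
  have hs := hasDerivAt_stdScore_mul (α := α) (y := y) (hasDerivAt_rateMoment 0 ℓ g) rfl h0
  have hs' := hasDerivAt_stdScoreDeriv_mul (α := α) (y := y) (hasDerivAt_rateMoment 0 ℓ g) rfl h0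
  change HasDerivAt _ (rateRatio 1 ℓ g * _) _ at hs
  change HasDerivAt _ (rateRatio 1 ℓ g * _) _ at hs'
  have := (hasDerivAt_rateMoment_rpow α hℓ g).mul
    (((hasDerivAt_rateRatio 2 hℓ g).mul hs).add
      (((hasDerivAt_rateRatio 1 hℓ g).pow 2).mul ((hs.const_mul (α - 1)).add hs')))
  refine this.congr_deriv ?_
  simp only [termDerivTwo, Pi.mul_apply, Pi.add_apply, Pi.pow_apply]
  push_cast
  ring

/-! ### Bounds -/

lemma rateRatio_one_neg (hℓ : 0 < ℓ) (g : ℝ) : rateRatio 1 ℓ g < 0 :=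
  div_neg_of_neg_of_pos (rateMoment_one_neg hℓ g) (rateMoment_zero_pos hℓ g)

lemma abs_rateRatio_le (i : ℕ) (hℓ : 0 < ℓ) (g : ℝ) : |rateRatio i ℓ g| ≤ ℓ ^ i := by
  have h0 := rateMoment_zero_pos hℓ g
  rw [rateRatio, abs_div, abs_of_pos h0, div_le_iff₀ h0]
  exact abs_rateMoment_le i hℓ g

section

variable {α x : ℝ}

lemma exp_neg_mul_le_one (hα : 0 ≤ α) (hx : 0 ≤ x) : Real.exp (-(α * x)) ≤ 1 :=
  Real.exp_le_one_iff.2 (by have := mul_nonneg hα hx; linarith)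

lemma div_one_add_sq_le_one (hα : 0 ≤ α) : α / (1 + α) ^ 2 ≤ 1 := by
  rw [div_le_one (by positivity)]
  nlinarith

lemma abs_stdScore_le (hα : 0 ≤ α) (hx : 0 ≤ x) : |stdScore α x| ≤ 2 * (1 + x) := by
  have h1 := exp_neg_mul_le_one hα hx
  have h2 := div_one_add_sq_le_one hα
  have h3 : 0 ≤ α / (1 + α) ^ 2 := by positivity
  have h4 := Real.exp_pos (-(α * x))
  unfold stdScore
  refine (abs_add_le _ _).trans ?_
  rw [abs_of_nonneg h3, abs_mul, abs_of_pos h4]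
  have h5 : |x - 1| ≤ 1 + x := abs_le.2 ⟨by linarith, by linarith⟩
  nlinarith [abs_nonneg (x - 1)]

lemma abs_stdScoreDeriv_le (hα : 0 ≤ α) (hx : 0 ≤ x) :
    |stdScoreDeriv α x| ≤ (1 + α) * (1 + x) ^ 2 := by
  have h1 := exp_neg_mul_le_one hα hx
  have h4 := Real.exp_pos (-(α * x))
  unfold stdScoreDeriv
  rw [abs_mul, abs_mul, abs_of_pos h4, abs_of_nonneg hx]
  have h5 : |1 + α - α * x| ≤ (1 + α) * (1 + x) :=
    abs_le.2 ⟨by nlinarith [mul_nonneg hα hx], by nlinarith [mul_nonneg hα hx]⟩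
  calc x * |1 + α - α * x| * Real.exp (-(α * x)) ≤ x * |1 + α - α * x| * 1 := by gcongr
    _ ≤ (1 + x) * ((1 + α) * (1 + x)) * 1 := by gcongr; linarith
    _ = _ := by ring

lemma abs_stdScoreDerivTwo_le (hα : 0 ≤ α) (hx : 0 ≤ x) :
    |stdScoreDerivTwo α x| ≤ 3 * (1 + α) ^ 2 * (1 + x) ^ 3 := by
  have h1 := exp_neg_mul_le_one hα hx
  have h4 := Real.exp_pos (-(α * x))
  unfold stdScoreDerivTwo
  rw [abs_mul, abs_mul, abs_of_pos h4, abs_of_nonneg hx]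
  have h5 : |1 + α - α * (3 + α) * x + α ^ 2 * x ^ 2| ≤ 3 * (1 + α) ^ 2 * (1 + x) ^ 2 := by
    have := mul_nonneg hα hx
    refine abs_le.2 ⟨?_, ?_⟩ <;>
      nlinarith [mul_nonneg hα hx, mul_nonneg (mul_nonneg hα hx) hx, mul_nonneg this this,
        mul_nonneg this hα, sq_nonneg α, sq_nonneg x]
  calc x * |1 + α - α * (3 + α) * x + α ^ 2 * x ^ 2| * Real.exp (-(α * x))
      ≤ x * |1 + α - α * (3 + α) * x + α ^ 2 * x ^ 2| * 1 := by gcongr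
    _ ≤ (1 + x) * (3 * (1 + α) ^ 2 * (1 + x) ^ 2) * 1 := by gcongr; linarith
    _ = _ := by ring

/-- The linear combination of the score and its derivative in `termDeriv`. -/
lemma abs_stdScore_comb_le (hα : 0 ≤ α) (hx : 0 ≤ x) :
    |(α - 1) * stdScore α x + stdScoreDeriv α x| ≤ 3 * (1 + α) * (1 + x) ^ 2 := by
  refine (abs_add_le _ _).trans ?_
  rw [abs_mul]
  have h1 : |α - 1| ≤ 1 + α := abs_le.2 ⟨by linarith, by linarith⟩
  have h2 := abs_stdScore_le hα hx
  have h3 := abs_stdScoreDeriv_le hα hx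
  calc _ ≤ (1 + α) * (2 * (1 + x)) + (1 + α) * (1 + x) ^ 2 := by gcongr
    _ ≤ _ := by nlinarith [mul_nonneg hα hx, mul_nonneg (mul_nonneg hα hx) hx, sq_nonneg x]

lemma abs_termDeriv_le {y : ℝ} (hα : 0 ≤ α) (hℓ : 0 < ℓ) (hy : 0 ≤ y) (g : ℝ) :
    |termDeriv α ℓ y g| ≤
      rateMoment 0 ℓ g ^ α * ℓ ^ 2 * (5 * (1 + α)) * (1 + y * rateMoment 0 ℓ g) ^ 2 := by
  have h0 := rateMoment_zero_pos hℓ g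
  have hx : 0 ≤ y * rateMoment 0 ℓ g := by positivity
  have hp : 0 ≤ rateMoment 0 ℓ g ^ α := by positivity
  have h1 := abs_rateRatio_le 1 hℓ g
  have h2 := abs_rateRatio_le 2 hℓ g
  have a1 := abs_stdScore_le hα hx
  have a2 := abs_stdScore_comb_le hα hx
  rw [pow_one] at h1
  unfold termDeriv
  generalize y * rateMoment 0 ℓ g = x at *
  rw [abs_mul, abs_of_nonneg hp]
  have : |rateRatio 2 ℓ g * stdScore α x + rateRatio 1 ℓ g ^ 2 *
      ((α - 1) * stdScore α x + stdScoreDeriv α x)| ≤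
      ℓ ^ 2 * (2 * (1 + x)) + ℓ ^ 2 * (3 * (1 + α) * (1 + x) ^ 2) := by
    refine (abs_add_le _ _).trans ?_
    rw [abs_mul, abs_mul, abs_pow]
    gcongr
  have h3 : 2 * (1 + x) ≤ 2 * (1 + α) * (1 + x) ^ 2 := by
    nlinarith [mul_nonneg hα hx, mul_nonneg (mul_nonneg hα hx) hx, sq_nonneg x]
  calc _ ≤ rateMoment 0 ℓ g ^ α * (ℓ ^ 2 * (2 * (1 + x)) +
        ℓ ^ 2 * (3 * (1 + α) * (1 + x) ^ 2)) := by gcongr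
    _ ≤ rateMoment 0 ℓ g ^ α * (ℓ ^ 2 * (2 * (1 + α) * (1 + x) ^ 2) +
        ℓ ^ 2 * (3 * (1 + α) * (1 + x) ^ 2)) := by gcongr
    _ = _ := by ring

lemma abs_termDerivTwo_le {y : ℝ} (hα : 0 ≤ α) (hℓ : 0 < ℓ) (hy : 0 ≤ y) (g : ℝ) :
    |termDerivTwo α ℓ y g| ≤
      rateMoment 0 ℓ g ^ α * ℓ ^ 3 * (21 * (1 + α) ^ 2) * (1 + y * rateMoment 0 ℓ g) ^ 3 := by
  have h0 := rateMoment_zero_pos hℓ g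
  have hx : 0 ≤ y * rateMoment 0 ℓ g := by positivity
  have hp : 0 ≤ rateMoment 0 ℓ g ^ α := by positivity
  have h1 := abs_rateRatio_le 1 hℓ g
  have h2 := abs_rateRatio_le 2 hℓ g
  have h3 := abs_rateRatio_le 3 hℓ g
  have a1 := abs_stdScore_le hα hx
  have a2 := abs_stdScore_comb_le hα hx
  have a3 := abs_stdScoreDeriv_le hα hx
  have a4 := abs_stdScoreDerivTwo_le hα hx
  rw [pow_one] at h1
  unfold termDerivTwo
  generalize y * rateMoment 0 ℓ g = x at *
  generalize (α - 1) * stdScore α x + stdScoreDeriv α x = c at *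
  have hα2 : |α - 2| ≤ 2 * (1 + α) := abs_le.2 ⟨by linarith, by linarith⟩
  have hα1 : |α - 1| ≤ 1 + α := abs_le.2 ⟨by linarith, by linarith⟩
  rw [abs_mul, abs_of_nonneg hp]
  have e1 : 1 ≤ 1 + x := by linarith
  have e2 : (1 + x) ^ 2 ≤ (1 + x) ^ 3 := pow_le_pow_right₀ e1 (by norm_num)
  have e3 : 1 + x ≤ (1 + x) ^ 3 := by simpa using pow_le_pow_right₀ e1 (show 1 ≤ 3 by norm_num)
  have e4 : 1 + α ≤ (1 + α) ^ 2 := by nlinarith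
  have e5 : 1 ≤ (1 + α) ^ 2 := by nlinarith
  have b1 : |stdScore α x| ≤ 2 * ((1 + α) ^ 2 * (1 + x) ^ 3) := by
    refine a1.trans ?_
    have : 1 * (1 + x) ≤ (1 + α) ^ 2 * (1 + x) ^ 3 := by gcongr
    linarith
  have b2 : |c| ≤ 3 * ((1 + α) ^ 2 * (1 + x) ^ 3) := by
    refine a2.trans ?_
    have : (1 + α) * (1 + x) ^ 2 ≤ (1 + α) ^ 2 * (1 + x) ^ 3 := by gcongr
    linarith
  -- The constant is `10 = 2·3 + 1 + 3`, from the three summands; below, `21 = 2 + 3·3 + 10`.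
  have b3 : |(α - 2) * c + (α - 1) * stdScoreDeriv α x + stdScoreDerivTwo α x| ≤
      10 * ((1 + α) ^ 2 * (1 + x) ^ 3) := by
    refine (abs_add_three _ _ _).trans ?_
    rw [abs_mul, abs_mul]
    calc _ ≤ 2 * (1 + α) * (3 * (1 + α) * (1 + x) ^ 2) + (1 + α) * ((1 + α) * (1 + x) ^ 2) +
          3 * (1 + α) ^ 2 * (1 + x) ^ 3 := by gcongr
      _ = 7 * ((1 + α) ^ 2 * (1 + x) ^ 2) + 3 * ((1 + α) ^ 2 * (1 + x) ^ 3) := by ring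
      _ ≤ 7 * ((1 + α) ^ 2 * (1 + x) ^ 3) + 3 * ((1 + α) ^ 2 * (1 + x) ^ 3) := by gcongr
      _ = _ := by ring
  set B := (1 + α) ^ 2 * (1 + x) ^ 3 with hB
  calc _ ≤ rateMoment 0 ℓ g ^ α * (ℓ ^ 3 * (2 * B) + 3 * (ℓ * ℓ ^ 2) * (3 * B) +
        ℓ ^ 3 * (10 * B)) := by
        gcongr
        refine (abs_add_three _ _ _).trans ?_
        simp only [abs_mul, abs_pow, Nat.abs_ofNat]
        gcongr
    _ = _ := by rw [hB]; ring

end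

/-! ### Moments of the standard exponential law -/

/-- The standard exponential law. -/
abbrev stdExp : Measure ℝ := expMeasure 1

instance : IsProbabilityMeasure stdExp := isProbabilityMeasure_expMeasure one_pos

lemma stdExp_eq : stdExp = (volume.restrict (Ioi 0)).withDensity
    fun x => ENNReal.ofReal (Real.exp (-x)) := by
  rw [stdExp, expMeasure, gammaMeasure, ← withDensity_indicator measurableSet_Ioi]
  refine withDensity_congr_ae ?_
  -- The gamma density lives on `[0, ∞)`; the single point `0` is discarded to pass to `Ioi 0`.
  filter_upwards [compl_mem_ae_iff.2 (measure_singleton (0 : ℝ))] with x hx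
  have hx0 : x ≠ 0 := hx
  by_cases h : 0 < x
  · rw [indicator_of_mem (mem_Ioi.2 h), gammaPDF_of_nonneg h.le]
    simp
  · rw [indicator_of_notMem (by simpa using h),
      gammaPDF_of_neg (lt_of_le_of_ne (not_lt.1 h) hx0)]

lemma integral_stdExp (f : ℝ → ℝ) :
    ∫ x, f x ∂stdExp = ∫ x in Ioi (0 : ℝ), Real.exp (-x) * f x := by
  rw [stdExp_eq, integral_withDensity_eq_integral_toReal_smul (by fun_prop) (by simp)]
  simp [ENNReal.toReal_ofReal (Real.exp_pos _).le]

lemma integrable_stdExp_iff (f : ℝ → ℝ) :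
    Integrable f stdExp ↔ IntegrableOn (fun x => Real.exp (-x) * f x) (Ioi 0) := by
  rw [stdExp_eq, integrable_withDensity_iff_integrable_smul' (by fun_prop) (by simp)]
  simp [ENNReal.toReal_ofReal (Real.exp_pos _).le, IntegrableOn]

lemma ae_stdExp_pos : ∀ᵐ x ∂stdExp, 0 < x := by
  rw [stdExp_eq]
  exact (withDensity_absolutelyContinuous _ _) (ae_restrict_mem measurableSet_Ioi)

lemma integrable_pow_mul_exp_stdExp (n : ℕ) {b : ℝ} (hb : 0 ≤ b) :
    Integrable (fun x => x ^ n * Real.exp (-(b * x))) stdExp := by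
  rw [integrable_stdExp_iff]
  have := integrableOn_rpow_mul_exp_neg_mul_rpow (p := 1) (s := n) (b := 1 + b)
    (by have : (0 : ℝ) ≤ n := n.cast_nonneg
        linarith) one_pos (by positivity)
  refine this.congr_fun (fun x hx => ?_) measurableSet_Ioi
  simp only [Real.rpow_natCast, Real.rpow_one]
  rw [mul_left_comm, ← Real.exp_add]
  ring_nf

lemma integral_pow_mul_exp_stdExp (n : ℕ) {b : ℝ} (hb : 0 ≤ b) :
    ∫ x, x ^ n * Real.exp (-(b * x)) ∂stdExp = n.factorial / (1 + b) ^ (n + 1) := by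
  rw [integral_stdExp]
  have h := Real.integral_rpow_mul_exp_neg_mul_Ioi (a := n + 1) (r := 1 + b) (by positivity)
    (by positivity)
  rw [Real.Gamma_nat_eq_factorial] at h
  have h2 : (1 / (1 + b)) ^ ((n : ℝ) + 1) * (n.factorial : ℝ) =
      n.factorial / (1 + b) ^ (n + 1) := by
    rw [← Nat.cast_add_one, Real.rpow_natCast, one_div, inv_pow]
    ring
  rw [← h2, ← h]
  refine setIntegral_congr_fun measurableSet_Ioi fun x _ => ?_
  simp only [add_sub_cancel_right, Real.rpow_natCast]
  rw [mul_left_comm, ← Real.exp_add]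
  ring_nf

lemma integrable_pow_stdExp (n : ℕ) : Integrable (fun x => x ^ n) stdExp := by
  simpa using integrable_pow_mul_exp_stdExp n le_rfl

lemma integrable_one_add_pow_stdExp (n : ℕ) : Integrable (fun x => (1 + x) ^ n) stdExp := by
  simp_rw [add_pow]
  exact integrable_finsetSum _ fun i _ => by
    simpa using (integrable_pow_stdExp (n - i)).mul_const _

/-- A function of polynomial growth is integrable. -/
lemma integrable_stdExp_of_le {f : ℝ → ℝ} (hf : Measurable f) {C : ℝ} (n : ℕ)
    (h : ∀ x, 0 < x → |f x| ≤ C * (1 + x) ^ n) : Integrable f stdExp := by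
  refine Integrable.mono' ((integrable_one_add_pow_stdExp n).const_mul C)
    hf.aestronglyMeasurable ?_
  filter_upwards [ae_stdExp_pos] with x hx
  exact h x hx

lemma memLp_two_stdExp_of_le {f : ℝ → ℝ} (hf : Measurable f) {C : ℝ} (n : ℕ)
    (h : ∀ x, 0 < x → |f x| ≤ C * (1 + x) ^ n) : MemLp f 2 stdExp := by
  rw [memLp_two_iff_integrable_sq hf.aestronglyMeasurable]
  refine integrable_stdExp_of_le (C := C ^ 2) (hf.pow_const 2) (2 * n) fun x hx => ?_
  rw [abs_pow, mul_comm 2 n, pow_mul, ← mul_pow]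
  exact pow_le_pow_left₀ (abs_nonneg _) (h x hx) 2

/-- Comparison of distribution functions. This scaling reduces the whole model to i.i.d. standard
exponential variables. -/
lemma map_div_stdExp {c : ℝ} (hc : 0 < c) : stdExp.map (fun x => x / c) = expMeasure c := by
  have := isProbabilityMeasure_expMeasure hc
  have : IsProbabilityMeasure (stdExp.map fun x => x / c) :=
    Measure.isProbabilityMeasure_map (by fun_prop)
  refine Measure.eq_of_cdf _ _ (StieltjesFunction.ext fun x => ?_)
  rw [cdf_expMeasure_eq hc, cdf_eq_real, map_measureReal_apply (by fun_prop) measurableSet_Iic]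
  have : (fun x => x / c) ⁻¹' Iic x = Iic (c * x) := by
    ext y
    simp [div_le_iff₀ hc, mul_comm]
  rw [this, ← cdf_eq_real, cdf_expMeasure_eq one_pos]
  simp [mul_nonneg_iff_of_pos_left hc]

/-! ### Mean and variance of the score -/

@[fun_prop]
lemma continuous_stdScore (α : ℝ) : Continuous (stdScore α) := by
  unfold stdScore
  fun_prop

/-- The mean of `stdScore α (r E)`, for `E` standard exponential. -/
def scoreMean (α r : ℝ) : ℝ := ∫ x, stdScore α (r * x) ∂stdExp

variable {α r : ℝ}

/-- The means and second moments of the score that are needed in closed form all reduce to integrals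
of this shape. -/
lemma integral_quadratic_mul_exp (c₀ c₁ c₂ : ℝ) {b : ℝ} (hb : 0 ≤ b) :
    Integrable (fun x => (c₀ + c₁ * x + c₂ * x ^ 2) * Real.exp (-(b * x))) stdExp ∧
    ∫ x, (c₀ + c₁ * x + c₂ * x ^ 2) * Real.exp (-(b * x)) ∂stdExp =
      c₀ / (1 + b) + c₁ / (1 + b) ^ 2 + 2 * c₂ / (1 + b) ^ 3 := by
  have i0 := (integrable_pow_mul_exp_stdExp 0 hb).const_mul c₀
  have i1 := (integrable_pow_mul_exp_stdExp 1 hb).const_mul c₁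
  have i2 := (integrable_pow_mul_exp_stdExp 2 hb).const_mul c₂
  have e : (fun x => (c₀ + c₁ * x + c₂ * x ^ 2) * Real.exp (-(b * x))) = fun x =>
      c₀ * (x ^ 0 * Real.exp (-(b * x))) + c₁ * (x ^ 1 * Real.exp (-(b * x))) +
        c₂ * (x ^ 2 * Real.exp (-(b * x))) := by
    ext x
    ring
  rw [e]
  have i01 : Integrable (fun x => c₀ * (x ^ 0 * Real.exp (-(b * x))) +
      c₁ * (x ^ 1 * Real.exp (-(b * x)))) stdExp := i0.add i1
  refine ⟨i01.add i2, ?_⟩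
  rw [integral_add i01 i2, integral_add i0 i1, integral_const_mul, integral_const_mul,
    integral_const_mul, integral_pow_mul_exp_stdExp _ hb, integral_pow_mul_exp_stdExp _ hb,
    integral_pow_mul_exp_stdExp _ hb]
  simp [Nat.factorial]
  ring

lemma integrable_stdScore_mul (hα : 0 ≤ α) (hr : 0 ≤ r) :
    Integrable (fun x => stdScore α (r * x)) stdExp := by
  have := (integral_quadratic_mul_exp (-1) r 0 (b := α * r) (by positivity)).1
  convert! (integrable_const (α / (1 + α) ^ 2)).add this using 2 with x
  simp [stdScore]
  ring_nf

/-- The mean score has the sign of `r - 1`. -/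
lemma scoreMean_eq (hα : 0 ≤ α) (hr : 0 ≤ r) :
    scoreMean α r = (r - 1) * (α ^ 3 / (1 + α) ^ 2 * r + (1 + α + α ^ 2) / (1 + α) ^ 2) /
      (1 + α * r) ^ 2 := by
  have h := integral_quadratic_mul_exp (-1) r 0 (b := α * r) (by positivity)
  have : scoreMean α r = ∫ x, (α / (1 + α) ^ 2 +
      (-1 + r * x + 0 * x ^ 2) * Real.exp (-(α * r * x))) ∂stdExp := by
    unfold scoreMean stdScore
    congr with x
    ring_nf
  rw [this, integral_add (integrable_const _) h.1, h.2]
  have : 1 + α * r ≠ 0 := by positivity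
  have : 1 + α ≠ 0 := by positivity
  simp
  field_simp
  ring

lemma scoreMean_one (hα : 0 ≤ α) : scoreMean α 1 = 0 := by
  simp [scoreMean_eq hα zero_le_one]

lemma scoreMean_pos (hα : 0 ≤ α) (hr : 1 < r) : 0 < scoreMean α r := by
  rw [scoreMean_eq hα (by linarith)]
  have : 0 < r - 1 := by linarith
  have : 0 < r := by linarith
  positivity

lemma scoreMean_neg (hα : 0 ≤ α) (hr : 0 ≤ r) (hr1 : r < 1) : scoreMean α r < 0 := by
  rw [scoreMean_eq hα hr, mul_div_assoc]
  refine mul_neg_of_neg_of_pos (by linarith) ?_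
  positivity

lemma integral_stdScore (hα : 0 ≤ α) : ∫ x, stdScore α x ∂stdExp = 0 := by
  simpa [scoreMean] using scoreMean_one hα

lemma integral_stdScoreDeriv (hα : 0 ≤ α) :
    Integrable (stdScoreDeriv α) stdExp ∧
    ∫ x, stdScoreDeriv α x ∂stdExp = (1 + α ^ 2) / (1 + α) ^ 3 := by
  have h := integral_quadratic_mul_exp 0 (1 + α) (-α) hα
  have e : stdScoreDeriv α =
      fun x => (0 + (1 + α) * x + (-α) * x ^ 2) * Real.exp (-(α * x)) := by
    ext x
    unfold stdScoreDeriv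
    ring
  rw [e]
  refine ⟨h.1, h.2.trans ?_⟩
  have : 1 + α ≠ 0 := by positivity
  field_simp
  ring

lemma integral_stdScore_sq (hα : 0 ≤ α) :
    ∫ x, stdScore α x ^ 2 ∂stdExp =
      (1 + 4 * α ^ 2) / (1 + 2 * α) ^ 3 - α ^ 2 / (1 + α) ^ 4 := by
  set c := α / (1 + α) ^ 2 with hc
  have h1 := integral_quadratic_mul_exp (-2 * c) (2 * c) 0 hα
  have h2 := integral_quadratic_mul_exp 1 (-2) 1 (b := 2 * α) (by positivity)
  have e : ∀ x, stdScore α x ^ 2 = c ^ 2 + (-2 * c + 2 * c * x + 0 * x ^ 2) * Real.exp (-(α * x)) +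
      (1 + -2 * x + 1 * x ^ 2) * Real.exp (-(2 * α * x)) := fun x => by
    have : Real.exp (-(2 * α * x)) = Real.exp (-(α * x)) ^ 2 := by
      rw [← Real.exp_nat_mul]
      push_cast
      ring_nf
    rw [this]
    unfold stdScore
    ring
  simp_rw [e]
  have i01 : Integrable (fun x => c ^ 2 +
      (-2 * c + 2 * c * x + 0 * x ^ 2) * Real.exp (-(α * x))) stdExp :=
    (integrable_const _).add h1.1
  rw [integral_add i01 h2.1, integral_add (integrable_const _) h1.1,
    h1.2, h2.2]
  have : 1 + α ≠ 0 := by positivity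
  have : 1 + 2 * α ≠ 0 := by positivity
  simp only [integral_const, probReal_univ, one_smul, hc]
  field_simp
  ring

/-- The variance of `stdScore α (r E)`, for `E` standard exponential. -/
def scoreVar (α r : ℝ) : ℝ := Var[fun x => stdScore α (r * x); stdExp]

lemma scoreVar_nonneg (α r : ℝ) : 0 ≤ scoreVar α r := variance_nonneg _ _

lemma memLp_stdScore_mul (hα : 0 ≤ α) (hr : 0 ≤ r) :
    MemLp (fun x => stdScore α (r * x)) 2 stdExp := by
  refine memLp_two_stdExp_of_le (C := 2 * (1 + r))
    (by fun_prop) 1 fun x hx => ?_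
  refine (abs_stdScore_le hα (by positivity)).trans ?_
  nlinarith [mul_nonneg hr hx.le]

/-- A second moment about any constant dominates the variance. Below, `c` is the limit of the score
in the regime considered. -/
lemma scoreVar_le_integral_sub_sq (hα : 0 ≤ α) (hr : 0 ≤ r) (c : ℝ) :
    scoreVar α r ≤ ∫ x, (stdScore α (r * x) - c) ^ 2 ∂stdExp := by
  have h := memLp_stdScore_mul hα hr
  rw [scoreVar, ← variance_sub_const h.1 c]
  exact variance_le_expectation_sq (h.1.sub aestronglyMeasurable_const)

lemma scoreVar_le (hα : 0 ≤ α) (hr : 0 ≤ r) : scoreVar α r ≤ 20 * (1 + r) ^ 2 := by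
  refine (scoreVar_le_integral_sub_sq hα hr 0).trans ?_
  have hi : ∫ x, (4 * (1 + r) ^ 2) * (1 + x) ^ 2 ∂stdExp = 20 * (1 + r) ^ 2 := by
    have := (integral_quadratic_mul_exp 1 2 1 le_rfl).2
    simp only [zero_mul, neg_zero, Real.exp_zero] at this
    rw [integral_const_mul, show (fun x : ℝ => (1 + x) ^ 2) =
      fun x => (1 + 2 * x + 1 * x ^ 2) * 1 by ext; ring, this]
    ring
  rw [← hi]
  refine integral_mono_of_nonneg (Eventually.of_forall fun x => sq_nonneg _)
    ((integrable_one_add_pow_stdExp 2).const_mul _) ?_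
  filter_upwards [ae_stdExp_pos] with x hx
  rw [sub_zero, ← sq_abs]
  have h1 : |stdScore α (r * x)| ≤ 2 * (1 + r) * (1 + x) := by
    refine (abs_stdScore_le hα (by positivity)).trans ?_
    nlinarith [mul_nonneg hr hx.le]
  calc _ ≤ (2 * (1 + r) * (1 + x)) ^ 2 := by gcongr
    _ = _ := by ring

/-- For small `r` the score is nearly constant. -/
lemma scoreVar_le_sq (hα : 0 ≤ α) (hr : 0 ≤ r) : scoreVar α r ≤ 2 * (1 + α) ^ 2 * r ^ 2 := by
  -- The centring constant is `stdScore α 0`, the limit of the score as `r → 0`.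
  refine (scoreVar_le_integral_sub_sq hα hr (α / (1 + α) ^ 2 - 1)).trans ?_
  have hi : ∫ x, ((1 + α) ^ 2 * r ^ 2) * x ^ 2 ∂stdExp = 2 * (1 + α) ^ 2 * r ^ 2 := by
    have := integral_pow_mul_exp_stdExp 2 le_rfl
    simp [Nat.factorial] at this
    rw [integral_const_mul, this]
    ring
  rw [← hi]
  refine integral_mono_of_nonneg (Eventually.of_forall fun x => sq_nonneg _)
    ((integrable_pow_stdExp 2).const_mul _) ?_
  filter_upwards [ae_stdExp_pos] with x hx
  have hrx : 0 ≤ r * x := by positivity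
  have e : stdScore α (r * x) - (α / (1 + α) ^ 2 - 1) =
      r * x * Real.exp (-(α * (r * x))) + (1 - Real.exp (-(α * (r * x)))) := by
    unfold stdScore
    ring
  have h1 := exp_neg_mul_le_one hα hrx
  have h2 := Real.exp_pos (-(α * (r * x)))
  have h3 := Real.add_one_le_exp (-(α * (r * x)))
  have h4 : 0 ≤ stdScore α (r * x) - (α / (1 + α) ^ 2 - 1) := by
    rw [e]
    have := mul_nonneg hrx h2.le
    linarith
  have h5 : stdScore α (r * x) - (α / (1 + α) ^ 2 - 1) ≤ (1 + α) * r * x := by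
    rw [e]
    have := mul_le_mul_of_nonneg_left h1 hrx
    linarith
  calc _ ≤ ((1 + α) * r * x) ^ 2 := by gcongr
    _ = _ := by ring

/-- For large `r` the score is nearly constant when `α` is positive. -/
lemma scoreVar_le_inv (hα : 0 < α) (hr : 0 < r) :
    scoreVar α r ≤ (1 / (2 * α) + 1 / (4 * α ^ 3)) / r := by
  -- For `α > 0` the exponential factor kills the random part as `r → ∞`, and this constant is what
  -- remains.
  refine (scoreVar_le_integral_sub_sq hα.le hr.le (α / (1 + α) ^ 2)).trans ?_
  have h := (integral_quadratic_mul_exp 1 (-2 * r) (r ^ 2) (b := 2 * α * r) (by positivity)).2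
  have e : ∀ x, (stdScore α (r * x) - α / (1 + α) ^ 2) ^ 2 =
      (1 + -2 * r * x + r ^ 2 * x ^ 2) * Real.exp (-(2 * α * r * x)) := fun x => by
    have : Real.exp (-(2 * α * r * x)) = Real.exp (-(α * (r * x))) ^ 2 := by
      rw [← Real.exp_nat_mul]
      push_cast
      ring_nf
    rw [this]
    unfold stdScore
    ring
  simp_rw [e, h]
  have h1 : 1 / (1 + 2 * α * r) ≤ 1 / (2 * α * r) := by gcongr; linarith
  have h2 : -2 * r / (1 + 2 * α * r) ^ 2 ≤ 0 := by
    apply div_nonpos_of_nonpos_of_nonneg <;> nlinarith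
  have h3 : 2 * r ^ 2 / (1 + 2 * α * r) ^ 3 ≤ 2 * r ^ 2 / (2 * α * r) ^ 3 := by gcongr; linarith
  have h4 : (1 / (2 * α) + 1 / (4 * α ^ 3)) / r = 1 / (2 * α * r) +
      2 * r ^ 2 / (2 * α * r) ^ 3 := by
    field_simp
    ring
  rw [h4]
  linarith

/-! ### Riemann sums over the design points -/

lemma designPoint_mem (k : ℕ) (i : Fin (k - 1)) : designPoint k i ∈ Ioo (0 : ℝ) 1 := by
  have h := i.2
  have h' : (i : ℕ) + 1 < k + 1 := by omega
  have h'' : ((i : ℕ) : ℝ) + 1 < (k : ℝ) + 1 := by exact_mod_cast h'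
  unfold designPoint
  exact ⟨by positivity, (div_lt_one (by positivity)).2 h''⟩

lemma one_div_le_designPoint (k : ℕ) (i : Fin (k - 1)) : 1 / ((k : ℝ) + 1) ≤ designPoint k i := by
  unfold designPoint
  gcongr
  simp

/-- The step function whose integral is the Riemann sum over the design points. -/
def designStep (f : ℝ → ℝ) (k : ℕ) (u : ℝ) : ℝ :=
  if ⌈((k : ℝ) + 1) * u⌉₊ ≤ k - 1 then f ((⌈((k : ℝ) + 1) * u⌉₊ : ℝ) / ((k : ℝ) + 1)) else 0

lemma measurable_designStep (f : ℝ → ℝ) (k : ℕ) : Measurable (designStep f k) := by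
  have h : Measurable fun u : ℝ => ⌈((k : ℝ) + 1) * u⌉₊ :=
    Nat.measurable_ceil.comp (measurable_id.const_mul _)
  exact (measurable_from_nat (f := fun j : ℕ =>
    if j ≤ k - 1 then f ((j : ℝ) / ((k : ℝ) + 1)) else 0)).comp h

/-- The unit interval splits into `k + 1` cells of equal length, and the step function takes on each
the value at its right endpoint. There are only `k - 1` design points, so the last two cells carry
the value `0`. -/
lemma integral_designStep (f : ℝ → ℝ) (k : ℕ) :
    ∫ u in Ioo (0 : ℝ) 1, designStep f k u =
      (∑ i : Fin (k - 1), f (designPoint k i)) / ((k : ℝ) + 1) := by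
  have hk : (0 : ℝ) < (k : ℝ) + 1 := by positivity
  set a : ℕ → ℝ := fun i => (i : ℝ) / ((k : ℝ) + 1) with ha
  set c : ℕ → ℝ := fun i => if i + 1 ≤ k - 1 then f (((i + 1 : ℕ) : ℝ) / ((k : ℝ) + 1)) else 0
    with hc
  have hmono : ∀ i, a i ≤ a (i + 1) := fun i => by
    simp only [ha]
    gcongr
    simp
  have hstep : ∀ i, EqOn (fun _ => c i) (designStep f k) (uIoc (a i) (a (i + 1))) := by
    intro i u hu
    rw [uIoc_of_le (hmono i)] at hu
    have h1 : ⌈((k : ℝ) + 1) * u⌉₊ = i + 1 := by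
      rw [Nat.ceil_eq_iff (by simp)]
      obtain ⟨h1, h2⟩ := hu
      simp only [ha] at h1 h2
      rw [div_lt_iff₀ hk] at h1
      rw [le_div_iff₀ hk] at h2
      simp only [add_tsub_cancel_right]
      constructor <;> linarith
    simp only [designStep, h1, hc]
  have hint : ∀ i, IntervalIntegrable (designStep f k) volume (a i) (a (i + 1)) := fun i =>
    (intervalIntegrable_const (c := c i)).congr (hstep i)
  have hval : ∀ i, ∫ u in a i..a (i + 1), designStep f k u = c i / ((k : ℝ) + 1) := fun i => by
    have : ∫ u in a i..a (i + 1), designStep f k u = ∫ u in a i..a (i + 1), c i :=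
      intervalIntegral.integral_congr_ae (ae_of_all _ fun u hu => (hstep i hu).symm)
    rw [this, intervalIntegral.integral_const, smul_eq_mul]
    simp only [ha]
    push_cast
    ring
  have h := intervalIntegral.sum_integral_adjacent_intervals (n := k + 1) fun i _ => hint i
  simp only [hval] at h
  have ha0 : a 0 = 0 := by simp [ha]
  have ha1 : a (k + 1) = 1 := by simp [ha, hk.ne']
  rw [ha0, ha1, intervalIntegral.integral_of_le zero_le_one, integral_Ioc_eq_integral_Ioo] at h
  rw [← h, ← Finset.sum_div]
  congr 1
  have hsub : Finset.range (k - 1) ⊆ Finset.range (k + 1) :=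
    Finset.range_subset_range.2 (by omega)
  rw [← Finset.sum_subset hsub fun i _ hi => ?_, Finset.sum_range]
  · refine Finset.sum_congr rfl fun i _ => ?_
    have := i.2
    simp only [hc]
    rw [if_pos (by omega)]
    simp [designPoint]
  · simp only [hc, Finset.mem_range] at hi ⊢
    rw [if_neg (by omega)]

variable {f : ℝ → ℝ}

lemma integrableOn_Ioo_of_le (hf : ContinuousOn f (Ioo 0 1)) {C s : ℝ} (hs : s < 1)
    (hb : ∀ u ∈ Ioo (0 : ℝ) 1, |f u| ≤ C * u ^ (-s)) : IntegrableOn f (Ioo 0 1) := by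
  refine Integrable.mono' (((intervalIntegral.integrableOn_Ioo_rpow_iff one_pos).2
    (by linarith : -1 < -s)).const_mul C) (hf.aestronglyMeasurable measurableSet_Ioo) ?_
  filter_upwards [ae_restrict_mem measurableSet_Ioo] with u hu
  exact hb u hu

/-- Dominated convergence for the step functions. They sample at the right end of each cell, and `u
^ (-s)` is decreasing, so the bound at the sample point is at most the bound at `u`: the singularity
at `0` does no harm. -/
lemma tendsto_riemannSum (hf : ContinuousOn f (Ioo 0 1)) {C s : ℝ} (hs0 : 0 ≤ s) (hs : s < 1)
    (hb : ∀ u ∈ Ioo (0 : ℝ) 1, |f u| ≤ C * u ^ (-s)) :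
    Tendsto (fun k : ℕ => (∑ i : Fin (k - 1), f (designPoint k i)) / ((k : ℝ) + 1)) atTop
      (nhds (∫ u in Ioo (0 : ℝ) 1, f u)) := by
  simp_rw [← integral_designStep]
  refine tendsto_integral_of_dominated_convergence (fun u => C * u ^ (-s))
    (fun k => (measurable_designStep f k).aestronglyMeasurable)
    (((intervalIntegral.integrableOn_Ioo_rpow_iff one_pos).2
      (by linarith : -1 < -s)).const_mul C) (fun k => ?_) ?_
  · filter_upwards [ae_restrict_mem measurableSet_Ioo] with u hu
    have hC : 0 ≤ C := by
      have := (abs_nonneg _).trans (hb u hu)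
      exact nonneg_of_mul_nonneg_left this (Real.rpow_pos_of_pos hu.1 _)
    have hk : (0 : ℝ) < (k : ℝ) + 1 := by positivity
    unfold designStep
    split_ifs with h
    · have h1 : u ≤ (⌈((k : ℝ) + 1) * u⌉₊ : ℝ) / ((k : ℝ) + 1) := by
        rw [le_div_iff₀ hk, mul_comm]
        exact Nat.le_ceil _
      have h2 : (⌈((k : ℝ) + 1) * u⌉₊ : ℝ) / ((k : ℝ) + 1) < 1 := by
        rw [div_lt_one hk]
        have : ⌈((k : ℝ) + 1) * u⌉₊ < k + 1 := by omega
        exact_mod_cast this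
      refine (hb _ ⟨hu.1.trans_le h1, h2⟩).trans ?_
      gcongr C * ?_
      exact Real.rpow_le_rpow_of_nonpos hu.1 h1 (by linarith)
    · rw [norm_zero]
      exact mul_nonneg hC (Real.rpow_nonneg hu.1.le _)
  · filter_upwards [ae_restrict_mem measurableSet_Ioo] with u hu
    have hk : Tendsto (fun k : ℕ => (k : ℝ) + 1) atTop atTop :=
      tendsto_atTop_add_const_right _ _ tendsto_natCast_atTop_atTop
    have h1 : Tendsto (fun k : ℕ => (⌈((k : ℝ) + 1) * u⌉₊ : ℝ) / ((k : ℝ) + 1)) atTop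
        (nhds u) := by
      simp_rw [mul_comm _ u]
      exact (tendsto_nat_ceil_mul_div_atTop hu.1.le).comp hk
    -- `1 - 2 / (k + 1)` is the last design point `(k - 1) / (k + 1)`; a fixed `u < 1` eventually
    -- lies outside the two empty cells.
    have h2 : Tendsto (fun k : ℕ => 1 - 2 / ((k : ℝ) + 1)) atTop (nhds 1) := by
      simpa using (hk.const_div_atTop 2).const_sub 1
    have h3 : ∀ᶠ k : ℕ in atTop, ⌈((k : ℝ) + 1) * u⌉₊ ≤ k - 1 := by
      filter_upwards [h1.eventually_lt h2 hu.2] with k hk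
      have hk' : (0 : ℝ) < (k : ℝ) + 1 := by positivity
      rw [div_lt_iff₀ hk', sub_mul, div_mul_cancel₀ _ hk'.ne'] at hk
      have : ((⌈((k : ℝ) + 1) * u⌉₊ + 1 : ℕ) : ℝ) < k := by
        push_cast
        linarith
      have : ⌈((k : ℝ) + 1) * u⌉₊ + 1 < k := by exact_mod_cast this
      omega
    have h4 := (hf.continuousAt (Ioo_mem_nhds hu.1 hu.2)).tendsto.comp h1
    refine h4.congr' ?_
    filter_upwards [h3] with k hk
    simp only [designStep, if_pos hk, Function.comp]

/-- Riemann sums of a function with an integrable power singularity are of order `k`. -/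
lemma exists_sum_rpow_designPoint_le {s : ℝ} (hs0 : 0 ≤ s) (hs : s < 1) :
    ∃ C : ℝ, 0 < C ∧ ∀ k : ℕ, ∑ i : Fin (k - 1), designPoint k i ^ (-s) ≤ C * ((k : ℝ) + 1) := by
  have h := tendsto_riemannSum (f := fun u => u ^ (-s)) (C := 1) (s := s)
    (fun u hu => (Real.continuousAt_rpow_const _ _ (Or.inl hu.1.ne')).continuousWithinAt) hs0 hs
    fun u hu => by rw [one_mul, abs_of_nonneg (Real.rpow_nonneg hu.1.le _)]
  obtain ⟨C, hC⟩ := h.bddAbove_range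
  refine ⟨max C 1, by positivity, fun k => ?_⟩
  have := hC ⟨k, rfl⟩
  rw [← div_le_iff₀ (by positivity)]
  exact this.trans (le_max_left _ _)

/-- Riemann sums of a positive continuous function are at least of order `k`. -/
lemma exists_le_sum_designPoint (hf : ContinuousOn f (Ioo 0 1))
    (hpos : ∀ u ∈ Ioo (0 : ℝ) 1, 0 < f u) :
    ∃ c : ℝ, 0 < c ∧ ∀ᶠ k : ℕ in atTop, c * ((k : ℝ) + 1) ≤ ∑ i : Fin (k - 1), f (designPoint k i) := by
  -- Truncation at `1` yields a lower bound without any integrability of `f`.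
  have hb : ∀ u ∈ Ioo (0 : ℝ) 1, |min (f u) 1| ≤ 1 * u ^ (-(0 : ℝ)) := fun u hu => by
    rw [abs_of_nonneg (le_min (hpos u hu).le zero_le_one)]
    simp
  have hc : ContinuousOn (fun u => min (f u) 1) (Ioo 0 1) := by fun_prop
  have h := tendsto_riemannSum hc le_rfl one_pos hb
  have hI : 0 < ∫ u in Ioo (0 : ℝ) 1, min (f u) 1 := by
    rw [setIntegral_pos_iff_support_of_nonneg_ae]
    · refine lt_of_lt_of_le (b := volume (Ioo (0 : ℝ) 1)) (by simp) (measure_mono ?_)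
      exact fun u hu => ⟨(lt_min (hpos u hu) one_pos).ne', hu⟩
    · filter_upwards [ae_restrict_mem measurableSet_Ioo] with u hu
      exact le_min (hpos u hu).le zero_le_one
    · exact integrableOn_Ioo_of_le hc one_pos hb
  refine ⟨(∫ u in Ioo (0 : ℝ) 1, min (f u) 1) / 2, by positivity, ?_⟩
  filter_upwards [h.eventually_const_lt (half_lt_self hI)] with k hk
  rw [lt_div_iff₀ (by positivity)] at hk
  exact hk.le.trans (Finset.sum_le_sum fun i _ => min_le_left _ _)

/-! ### A central limit theorem for weighted sums -/

/-- The factors are exchanged one at a time, and the remaining ones have modulus at most `1`. -/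
lemma norm_prod_sub_prod_le {ι : Type*} (s : Finset ι) {a b : ι → ℂ} (ha : ∀ i ∈ s, ‖a i‖ ≤ 1)
    (hb : ∀ i ∈ s, ‖b i‖ ≤ 1) :
    ‖∏ i ∈ s, a i - ∏ i ∈ s, b i‖ ≤ ∑ i ∈ s, ‖a i - b i‖ := by
  classical
  induction s using Finset.induction_on with
  | empty => simp
  | insert j s hj ih =>
    rw [Finset.prod_insert hj, Finset.prod_insert hj, Finset.sum_insert hj]
    have h1 : ‖∏ i ∈ s, b i‖ ≤ 1 := by
      rw [norm_prod]
      exact Finset.prod_le_one (fun _ _ => norm_nonneg _)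
        fun i hi => hb i (Finset.mem_insert_of_mem hi)
    have h2 := ih (fun i hi => ha i (Finset.mem_insert_of_mem hi))
      fun i hi => hb i (Finset.mem_insert_of_mem hi)
    have h3 := ha j (Finset.mem_insert_self j s)
    calc ‖a j * ∏ i ∈ s, a i - b j * ∏ i ∈ s, b i‖
        = ‖a j * (∏ i ∈ s, a i - ∏ i ∈ s, b i) + (a j - b j) * ∏ i ∈ s, b i‖ := by ring_nf
      _ ≤ ‖a j‖ * ‖∏ i ∈ s, a i - ∏ i ∈ s, b i‖ + ‖a j - b j‖ * ‖∏ i ∈ s, b i‖ := by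
        refine (norm_add_le _ _).trans ?_
        rw [norm_mul, norm_mul]
      _ ≤ 1 * ‖∏ i ∈ s, a i - ∏ i ∈ s, b i‖ + ‖a j - b j‖ * 1 := by gcongr
      _ ≤ _ := by linarith

variable {ν : Measure ℝ} [IsProbabilityMeasure ν] {ξ : ℝ → ℝ}

/-- Second-order comparison of the characteristic function of a centred variable with that of the
normal law of the same variance. -/
lemma charFun_sub_exp_isLittleO (hξ : Measurable ξ) (h2 : MemLp ξ 2 ν) (h0 : ∫ x, ξ x ∂ν = 0) :
    (fun t : ℝ => charFun (ν.map ξ) t -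
      ((Real.exp (-((∫ x, ξ x ^ 2 ∂ν) * t ^ 2 / 2)) : ℝ) : ℂ)) =o[nhds 0] fun t : ℝ => t ^ 2 := by
  set v := ∫ x, ξ x ^ 2 ∂ν with hv
  have := Measure.isProbabilityMeasure_map (μ := ν) hξ.aemeasurable
  have hid : MemLp id 2 (ν.map ξ) := by
    rw [memLp_map_measure_iff aestronglyMeasurable_id hξ.aemeasurable]
    exact h2
  have hT := taylor_isLittleO_univ (x₀ := 0) (contDiff_charFun (n := 2) hid)
  simp only [taylorWithinEval_charFun_two_zero hξ.aemeasurable hid, h0, sub_zero] at hT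
  -- The Gaussian factor has the same second-order Taylor polynomial, with an error of order `t ^
  -- 4`.
  have hE : (fun t : ℝ => ((Real.exp (-(v * t ^ 2 / 2)) - (1 - v * t ^ 2 / 2) : ℝ) : ℂ))
      =o[nhds 0] fun t : ℝ => t ^ 2 := by
    have h1 : Tendsto (fun t : ℝ => -(v * t ^ 2 / 2)) (nhds 0) (nhds 0) := by
      have : Continuous fun t : ℝ => -(v * t ^ 2 / 2) := by fun_prop
      simpa using this.tendsto 0
    have h3 : (fun t : ℝ => ((Real.exp (-(v * t ^ 2 / 2)) - (1 - v * t ^ 2 / 2) : ℝ) : ℂ))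
        =O[nhds 0] fun t : ℝ => t ^ 4 := by
      refine Asymptotics.IsBigO.of_bound (v ^ 2 / 4) ?_
      have h2 : ∀ᶠ t : ℝ in nhds 0, |-(v * t ^ 2 / 2)| ≤ 1 := by
        filter_upwards [h1 (Icc_mem_nhds (show (-1 : ℝ) < 0 by norm_num) one_pos)] with t ht
        exact abs_le.2 ht
      filter_upwards [h2] with t ht
      have := Real.abs_exp_sub_one_sub_id_le ht
      rw [Complex.norm_real, Real.norm_eq_abs, Real.norm_eq_abs, abs_pow,
        show |t| ^ 4 = t ^ 4 by rw [← abs_pow]; exact abs_of_nonneg (by positivity)]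
      calc _ = |Real.exp (-(v * t ^ 2 / 2)) - 1 - -(v * t ^ 2 / 2)| := by ring_nf
        _ ≤ _ := this
        _ = _ := by ring
    refine h3.trans_isLittleO ?_
    exact Asymptotics.isLittleO_pow_pow (by norm_num)
  refine (hT.sub hE).congr_left fun t => ?_
  push_cast
  simp only [Pi.pow_apply, ← hv]
  ring

/-- Each characteristic function is replaced by the Gaussian one of equal variance. The error per
factor is `o((c t)²)`, uniformly because the largest weight tends to `0`, and the squares of the
weights have a bounded sum. The Gaussian product depends on that sum only. -/
lemma tendstoInDistribution_weightedSum (hξ : Measurable ξ) (h2 : MemLp ξ 2 ν)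
    (h0 : ∫ x, ξ x ∂ν = 0) {ι : ℕ → Type*} [∀ n, Fintype (ι n)] (c : ∀ n, ι n → ℝ) {V : ℝ}
    (hV : Tendsto (fun n => ∑ i, c n i ^ 2) atTop (nhds V))
    (hmax : ∀ ε : ℝ, 0 < ε → ∀ᶠ n in atTop, ∀ i, |c n i| ≤ ε) :
    TendstoInDistribution (fun n (e : ι n → ℝ) => ∑ i, c n i * ξ (e i)) atTop (id : ℝ → ℝ)
      (fun n => Measure.pi fun _ : ι n => ν)
      (gaussianReal 0 ((∫ x, ξ x ^ 2 ∂ν) * V).toNNReal) where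
  forall_aemeasurable n :=
    (show Measurable fun e : ι n → ℝ => ∑ i, c n i * ξ (e i) by fun_prop).aemeasurable
  tendsto := by
    set v := ∫ x, ξ x ^ 2 ∂ν with hv
    have hv0 : 0 ≤ v := integral_nonneg fun x => sq_nonneg _
    have hV0 : 0 ≤ V := ge_of_tendsto' hV fun n => Finset.sum_nonneg fun i _ => sq_nonneg _
    refine ProbabilityMeasure.tendsto_iff_tendsto_charFun.2 fun t => ?_
    have hlim : charFun ((gaussianReal 0 (v * V).toNNReal).map id) t =
        ((Real.exp (-(v * V * t ^ 2 / 2)) : ℝ) : ℂ) := by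
      rw [Measure.map_id, charFun_gaussianReal]
      simp [Real.coe_toNNReal _ (mul_nonneg hv0 hV0)]
    have hprod : ∀ n, charFun ((Measure.pi fun _ : ι n => ν).map
        (fun e => ∑ i, c n i * ξ (e i))) t = ∏ i, charFun (ν.map ξ) (c n i * t) := fun n => by
      have hP : ∀ i : ι n, IsProbabilityMeasure (ν.map fun x => c n i * ξ x) := fun i =>
        Measure.isProbabilityMeasure_map (by fun_prop)
      have e1 : (Measure.pi fun _ : ι n => ν).map (fun e => ∑ i, c n i * ξ (e i)) =
          (Measure.pi fun i : ι n => ν.map fun x => c n i * ξ x).map (fun p => ∑ i, p i) := by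
        rw [← Measure.pi_map_pi (fun i => by fun_prop), Measure.map_map (by fun_prop) (by fun_prop)]
        rfl
      rw [e1, charFun_map_sum_pi_eq_prod, Finset.prod_apply]
      exact Finset.prod_congr rfl fun i _ => charFun_map_mul_comp hξ.aemeasurable _ _
    change Tendsto (fun n => charFun ((Measure.pi fun _ : ι n => ν).map
        (fun e => ∑ i, c n i * ξ (e i))) t) atTop
        (nhds (charFun ((gaussianReal 0 (v * V).toNNReal).map id) t))
    rw [hlim]
    simp_rw [hprod]
    have hprob := Measure.isProbabilityMeasure_map (μ := ν) hξ.aemeasurable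
    have hgauss : ∀ n, ∏ i, ((Real.exp (-(v * (c n i * t) ^ 2 / 2)) : ℝ) : ℂ) =
        ((Real.exp (-(v * (∑ i, c n i ^ 2) * t ^ 2 / 2)) : ℝ) : ℂ) := fun n => by
      rw [← Complex.ofReal_prod, ← Real.exp_sum]
      congr 2
      rw [Finset.mul_sum, Finset.sum_mul, Finset.sum_div, ← Finset.sum_neg_distrib]
      exact Finset.sum_congr rfl fun i _ => by ring
    have hg : Tendsto (fun n => ∏ i, ((Real.exp (-(v * (c n i * t) ^ 2 / 2)) : ℝ) : ℂ)) atTop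
        (nhds ((Real.exp (-(v * V * t ^ 2 / 2)) : ℝ) : ℂ)) := by
      simp_rw [hgauss]
      have : Continuous fun x : ℝ => ((Real.exp (-(v * x * t ^ 2 / 2)) : ℝ) : ℂ) := by fun_prop
      exact (this.tendsto V).comp hV
    have hd : Tendsto (fun n => ∏ i, charFun (ν.map ξ) (c n i * t) -
        ∏ i, ((Real.exp (-(v * (c n i * t) ^ 2 / 2)) : ℝ) : ℂ)) atTop (nhds 0) := by
      rw [Metric.tendsto_nhds]
      intro ε hε
      -- `K` bounds `∑ (c t)²` for large `n`; the added `1` keeps it positive when `t = 0`.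
      set K := (V + 1) * t ^ 2 + 1 with hK
      have hK0 : 0 < K := by positivity
      have ho := (charFun_sub_exp_isLittleO hξ h2 h0).def (show 0 < ε / (2 * K) by positivity)
      rw [Metric.eventually_nhds_iff] at ho
      obtain ⟨δ, hδ, ho⟩ := ho
      have hbig : ∀ᶠ n in atTop, ∑ i, c n i ^ 2 < V + 1 := hV.eventually_lt_const (by linarith)
      filter_upwards [hmax (δ / (2 * (|t| + 1))) (by positivity), hbig] with n hn hs
      rw [dist_zero_right]
      have hterm : ∀ i, ‖charFun (ν.map ξ) (c n i * t) -
          ((Real.exp (-(v * (c n i * t) ^ 2 / 2)) : ℝ) : ℂ)‖ ≤ ε / (2 * K) * (c n i * t) ^ 2 := by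
        intro i
        have h1 : dist (c n i * t) 0 < δ := by
          rw [dist_zero_right, Real.norm_eq_abs, abs_mul]
          calc |c n i| * |t| ≤ δ / (2 * (|t| + 1)) * (|t| + 1) := by
                gcongr
                · exact hn i
                · linarith
            _ = δ / 2 := by field_simp
            _ < δ := half_lt_self hδ
        have := ho h1
        rwa [Real.norm_eq_abs, abs_of_nonneg (sq_nonneg (c n i * t))] at this
      calc _ ≤ ∑ i, ‖charFun (ν.map ξ) (c n i * t) -
          ((Real.exp (-(v * (c n i * t) ^ 2 / 2)) : ℝ) : ℂ)‖ := by
            refine norm_prod_sub_prod_le _ (fun i _ => norm_charFun_le_one _) fun i _ => ?_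
            rw [Complex.norm_real, Real.norm_eq_abs, Real.abs_exp, Real.exp_le_one_iff]
            have : 0 ≤ v * (c n i * t) ^ 2 / 2 := by positivity
            linarith
        _ ≤ ∑ i, ε / (2 * K) * (c n i * t) ^ 2 := Finset.sum_le_sum fun i _ => hterm i
        _ = ε / (2 * K) * ((∑ i, c n i ^ 2) * t ^ 2) := by
            rw [Finset.sum_mul, Finset.mul_sum]
            exact Finset.sum_congr rfl fun i _ => by ring
        _ ≤ ε / (2 * K) * K := by
            have : (∑ i, c n i ^ 2) * t ^ 2 ≤ (V + 1) * t ^ 2 := by gcongr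
            gcongr
            linarith
        _ = ε / 2 := by field_simp
        _ < ε := half_lt_self hε
    simpa using hd.add hg

/-! ### Chebyshev's inequality for sums of independent variables -/

lemma measureReal_pi_abs_sum_sub_ge_le {ι : Type*} [Fintype ι] {f : ι → ℝ → ℝ}
    (hf : ∀ i, MemLp (f i) 2 ν) {c : ℝ} (hc : 0 < c) :
    (Measure.pi fun _ : ι => ν).real
      {e | c ≤ |∑ i, f i (e i) - ∑ i, ∫ x, f i x ∂ν|} ≤ (∑ i, Var[f i; ν]) / c ^ 2 := by
  have hL : ∀ i, MemLp (fun e : ι → ℝ => f i (e i)) 2 (Measure.pi fun _ : ι => ν) := fun i =>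
    (hf i).comp_measurePreserving (measurePreserving_eval _ i)
  have hS : MemLp (∑ i, fun e : ι → ℝ => f i (e i)) 2 (Measure.pi fun _ : ι => ν) :=
    memLp_finsetSum' _ fun i _ => hL i
  have h := meas_ge_le_variance_div_sq hS hc
  rw [variance_sum_pi (μ := fun _ : ι => ν) (X := f) hf] at h
  have hm : ∫ e, (∑ i, fun e : ι → ℝ => f i (e i)) e ∂(Measure.pi fun _ : ι => ν) =
      ∑ i, ∫ x, f i x ∂ν := by
    simp only [Finset.sum_apply]
    rw [integral_finsetSum _ fun i _ => (hL i).integrable one_le_two]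
    exact Finset.sum_congr rfl fun i _ =>
      integral_comp_eval (μ := fun _ : ι => ν) (hf i).aestronglyMeasurable
  rw [hm] at h
  simp only [Finset.sum_apply] at h
  exact ENNReal.toReal_le_of_le_ofReal
    (div_nonneg (Finset.sum_nonneg fun i _ => variance_nonneg _ _) (sq_nonneg _)) h

/-! ### The exponential regression model in standardized form -/

/-- The rate of the `i`-th observation at the parameter `γ`. -/
def rate (γ : ℝ) (k : ℕ) (i : Fin (k - 1)) : ℝ := rateMoment 0 (-Real.log (designPoint k i)) γ

lemma rate_pos (γ : ℝ) (k : ℕ) (i : Fin (k - 1)) : 0 < rate γ k i :=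
  rateMoment_zero_pos (neg_log_pos (designPoint_mem k i)) γ

/-- The law of `k - 1` independent standard exponential variables. -/
abbrev stdLaw (k : ℕ) : Measure (Fin (k - 1) → ℝ) := Measure.pi fun _ => stdExp

lemma ermLaw_eq (γ : ℝ) (k : ℕ) :
    ermLaw γ k = (stdLaw k).map fun e i => e i / rate γ k i := by
  have h : ∀ i, stdExp.map (fun x => x / rate γ k i) = expMeasure (theta γ (designPoint k i))⁻¹ :=
    fun i => by
      rw [map_div_stdExp (rate_pos γ k i), inv_theta (designPoint_mem k i), rate]
  have hP : ∀ i, IsProbabilityMeasure (stdExp.map fun x => x / rate γ k i) := fun i =>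
    Measure.isProbabilityMeasure_map (by fun_prop)
  refine Eq.trans ?_ (Measure.pi_map_pi (μ := fun _ : Fin (k - 1) => stdExp)
    (f := fun i x => x / rate γ k i) fun i => by fun_prop).symm
  simp only [h]
  rfl

lemma measurable_div_rate (γ : ℝ) (k : ℕ) :
    Measurable fun (e : Fin (k - 1) → ℝ) i => e i / rate γ k i := by fun_prop

instance (γ : ℝ) (k : ℕ) : IsProbabilityMeasure (ermLaw γ k) := by
  rw [ermLaw_eq]
  exact Measure.isProbabilityMeasure_map (measurable_div_rate γ k).aemeasurable

lemma ermLaw_real_apply (γ : ℝ) (k : ℕ) {A : Set (Fin (k - 1) → ℝ)} (hA : MeasurableSet A) :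
    (ermLaw γ k).real A = (stdLaw k).real {e | (fun i => e i / rate γ k i) ∈ A} := by
  rw [ermLaw_eq, map_measureReal_apply (measurable_div_rate γ k) hA]
  rfl

lemma estimatingFunction_eq (α : ℝ) (k : ℕ) (y : Fin (k - 1) → ℝ) (g : ℝ) :
    estimatingFunction α k y g =
      ∑ i : Fin (k - 1), term α (-Real.log (designPoint k i)) (y i) g := by
  unfold estimatingFunction
  refine Finset.sum_congr rfl fun i _ => ?_
  have hu := designPoint_mem k i
  have h0 := rateMoment_zero_pos (neg_log_pos hu) g
  have ht : theta g (designPoint k i) = (rateMoment 0 (-Real.log (designPoint k i)) g)⁻¹ := by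
    rw [← inv_theta hu, inv_inv]
  rw [weight_eq hu, ht, term, rateRatio, stdScore, div_inv_eq_mul]
  field_simp

lemma measurable_term (α ℓ g : ℝ) : Measurable fun y => term α ℓ y g := by
  unfold term stdScore
  fun_prop

lemma measurable_termDeriv (α ℓ g : ℝ) : Measurable fun y => termDeriv α ℓ y g := by
  unfold termDeriv stdScore stdScoreDeriv
  fun_prop

lemma measurable_estimatingFunction (α : ℝ) (k : ℕ) (g : ℝ) :
    Measurable fun y => estimatingFunction α k y g := by
  simp_rw [estimatingFunction_eq]
  exact Finset.measurable_sum _ fun i _ => (measurable_term α _ g).comp (measurable_pi_apply i)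

lemma continuous_estimatingFunction (α : ℝ) (k : ℕ) (y : Fin (k - 1) → ℝ) :
    Continuous (estimatingFunction α k y) := by
  rw [show estimatingFunction α k y = fun g =>
    ∑ i : Fin (k - 1), term α (-Real.log (designPoint k i)) (y i) g from
    funext (estimatingFunction_eq α k y)]
  refine continuous_finsetSum _ fun i _ => continuous_iff_continuousAt.2 fun g => ?_
  exact (hasDerivAt_term α (neg_log_pos (designPoint_mem k i)) (y i) g).continuousAt

/-! ### Transfer from the model to the data -/

section Transfer

variable {Ω : ℕ → Type*} [∀ n, MeasurableSpace (Ω n)] {P : ∀ n, Measure (Ω n)}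
  {γ : ℝ} {k : ℕ → ℕ} {Y : ∀ n, Ω n → Fin (k n - 1) → ℝ}

/-- Uniformity over events is what permits sets, and even spaces, that change with `n`. -/
lemma ERMApproximation.tendsto_sub (hERM : ERMApproximation P γ k Y)
    {A : ∀ n, Set (Fin (k n - 1) → ℝ)} (hA : ∀ n, MeasurableSet (A n)) :
    Tendsto (fun n => (P n).real (Y n ⁻¹' A n) - (ermLaw γ (k n)).real (A n)) atTop (nhds 0) := by
  rw [Metric.tendsto_nhds]
  intro ε hε
  filter_upwards [hERM (ε / 2) (half_pos hε)] with n hn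
  rw [Real.dist_0_eq_abs]
  exact (hn _ (hA n)).trans_lt (half_lt_self hε)

lemma ERMApproximation.tendsto_real (hERM : ERMApproximation P γ k Y)
    {A : ∀ n, Set (Fin (k n - 1) → ℝ)} (hA : ∀ n, MeasurableSet (A n)) {c : ℝ}
    (h : Tendsto (fun n => (ermLaw γ (k n)).real (A n)) atTop (nhds c)) :
    Tendsto (fun n => (P n).real (Y n ⁻¹' A n)) atTop (nhds c) := by
  simpa using (hERM.tendsto_sub hA).add h

lemma ERMApproximation.eventually_le (hERM : ERMApproximation P γ k Y)
    {A : ∀ n, Set (Fin (k n - 1) → ℝ)} (hA : ∀ n, MeasurableSet (A n)) {c τ : ℝ}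
    (h : ∀ᶠ n in atTop, (ermLaw γ (k n)).real (A n) ≤ c) (hτ : 0 < τ) :
    ∀ᶠ n in atTop, (P n).real (Y n ⁻¹' A n) ≤ c + τ := by
  filter_upwards [h, (hERM.tendsto_sub hA).eventually_lt_const hτ] with n h1 h2
  linarith

variable [∀ n, IsProbabilityMeasure (P n)]

/-- By the portmanteau theorem it suffices to bound the lower limits of the probabilities of open
sets, and these differ from the model probabilities by a null sequence. -/
lemma ERMApproximation.tendstoInDistribution (hERM : ERMApproximation P γ k Y)
    (hY : ∀ n, Measurable (Y n)) {Z : ∀ n, (Fin (k n - 1) → ℝ) → ℝ} (hZ : ∀ n, Measurable (Z n))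
    {μ : Measure ℝ} [IsProbabilityMeasure μ]
    (h : TendstoInDistribution Z atTop (id : ℝ → ℝ) (fun n => ermLaw γ (k n)) μ) :
    TendstoInDistribution (fun n ω => Z n (Y n ω)) atTop (id : ℝ → ℝ) P μ where
  forall_aemeasurable n := ((hZ n).comp (hY n)).aemeasurable
  tendsto := by
    refine tendsto_of_forall_isOpen_le_liminf' fun G hG => ?_
    refine (ProbabilityMeasure.le_liminf_measure_open_of_tendsto h.tendsto hG).trans ?_
    refine le_of_forall_lt fun b hb => ?_
    obtain ⟨b', hbb', hb'⟩ := exists_between hb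
    have hev := eventually_lt_of_lt_liminf hb'
    have hsub := hERM.tendsto_sub fun n => (hZ n) hG.measurableSet
    have hb'top : b' ≠ ⊤ := ne_top_of_lt hb'
    have hbtop : b ≠ ⊤ := ne_top_of_lt hbb'
    -- The gap between `b''` and `b'` absorbs the distance between the two laws.
    obtain ⟨b'', hbb'', hb''⟩ := exists_between hbb'
    have hb''top : b'' ≠ ⊤ := ne_top_of_lt hb''
    refine hbb''.trans_le (le_liminf_of_le (by isBoundedDefault) ?_)
    have hd : 0 < b'.toReal - b''.toReal := sub_pos.2 ((ENNReal.toReal_lt_toReal hb''top hb'top).2 hb'')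
    filter_upwards [hev, hsub.eventually_const_lt (show -(b'.toReal - b''.toReal) < 0 by linarith)]
      with n h1 h2
    change b' < (ermLaw γ (k n)).map (Z n) G at h1
    change b'' ≤ (P n).map (fun ω => Z n (Y n ω)) G
    rw [Measure.map_apply (hZ n) hG.measurableSet] at h1
    rw [Measure.map_apply (f := fun ω => Z n (Y n ω)) ((hZ n).comp (hY n)) hG.measurableSet]
    have h3 : b'.toReal < (ermLaw γ (k n)).real (Z n ⁻¹' G) :=
      (ENNReal.toReal_lt_toReal hb'top (measure_ne_top _ _)).2 h1
    have h4 : b''.toReal ≤ (P n).real ((fun ω => Z n (Y n ω)) ⁻¹' G) := by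
      have : (fun ω => Z n (Y n ω)) ⁻¹' G = Y n ⁻¹' (Z n ⁻¹' G) := rfl
      rw [this]
      linarith
    exact (ENNReal.toReal_le_toReal hb''top (measure_ne_top _ _)).1 h4

/-- Slutsky's theorem for variables on varying probability spaces. -/
lemma tendstoInDistribution_of_sub_tendsto_zero {X Z : ∀ n, Ω n → ℝ} {μ : Measure ℝ}
    [IsProbabilityMeasure μ] (hX : ∀ n, Measurable (X n)) (hZm : ∀ n, Measurable (Z n))
    (hZ : TendstoInDistribution Z atTop (id : ℝ → ℝ) P μ)
    (h : ∀ ε : ℝ, 0 < ε → Tendsto (fun n => (P n).real {ω | ε ≤ |X n ω - Z n ω|}) atTop (nhds 0)) :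
    TendstoInDistribution X atTop (id : ℝ → ℝ) P μ := by
  -- All the spaces are embedded in their infinite product, where the one-space form of Slutsky's
  -- theorem applies. Only the law for each single `n` matters, so the coupling is irrelevant.
  have hmap : ∀ {W : ∀ n, Ω n → ℝ} (_ : ∀ n, Measurable (W n)) (n : ℕ),
      (Measure.infinitePi P).map (fun ω => W n (ω n)) = (P n).map (W n) := fun {W} hW n => by
    have : (fun ω : ∀ n, Ω n => W n (ω n)) = W n ∘ fun ω => ω n := rfl
    rw [this, ← Measure.map_map (hW n) (measurable_pi_apply n), Measure.infinitePi_map_eval]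
  have hZ' : TendstoInDistribution (fun n (ω : ∀ n, Ω n) => Z n (ω n)) atTop (id : ℝ → ℝ)
      (fun _ => Measure.infinitePi P) μ := by
    refine ⟨fun n => ((hZm n).comp (measurable_pi_apply n)).aemeasurable, by fun_prop, ?_⟩
    exact (tendsto_congr fun n => Subtype.ext (hmap hZm n)).2 hZ.tendsto
  have hX' := tendstoInDistribution_of_tendstoInMeasure_sub
    (fun n (ω : ∀ n, Ω n) => X n (ω n)) (id : ℝ → ℝ) hZ' ?_
    fun n => ((hX n).comp (measurable_pi_apply n)).aemeasurable
  · refine ⟨fun n => (hX n).aemeasurable, by fun_prop, ?_⟩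
    exact (tendsto_congr fun n => Subtype.ext (hmap hX n)).1 hX'.tendsto
  · refine tendstoInMeasure_of_ne_top fun ε hε hε' => ?_
    have hr : 0 < ε.toReal := ENNReal.toReal_pos hε.ne' hε'
    have h1 := (ENNReal.tendsto_ofReal (h ε.toReal hr))
    rw [ENNReal.ofReal_zero] at h1
    refine h1.congr fun n => ?_
    rw [ofReal_measureReal]
    have hm : MeasurableSet {ω | ε.toReal ≤ |X n ω - Z n ω|} :=
      measurableSet_le measurable_const ((hX n).sub (hZm n)).abs
    rw [← Measure.infinitePi_map_eval P n, Measure.map_apply (measurable_pi_apply n) hm]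
    congr 1
    ext ω
    simp only [mem_preimage, mem_ofPred_eq, Pi.sub_apply, Pi.zero_apply, edist_dist,
      Real.dist_0_eq_abs]
    rw [ENNReal.le_ofReal_iff_toReal_le hε' (abs_nonneg _)]

end Transfer

/-! ### Power bounds near the left endpoint -/

section PowerBounds

variable {u : ℝ}

lemma exp_mul_neg_log (hu : u ∈ Ioo (0 : ℝ) 1) (c : ℝ) :
    Real.exp (c * -Real.log u) = u ^ (-c) := by
  rw [rpow_eq_exp_neg hu]
  congr 1
  ring

lemma one_le_rpow_neg (hu : u ∈ Ioo (0 : ℝ) 1) {s : ℝ} (hs : 0 ≤ s) : 1 ≤ u ^ (-s) :=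
  Real.one_le_rpow_of_pos_of_le_one_of_nonpos hu.1 hu.2.le (by linarith)

lemma exists_neg_log_rpow_le {p δ : ℝ} (hp : 0 ≤ p) (hδ : 0 < δ) :
    ∃ C : ℝ, 0 < C ∧ ∀ u ∈ Ioo (0 : ℝ) 1, (-Real.log u) ^ p ≤ C * u ^ (-δ) := by
  -- With this choice `t * p ≤ δ`, also for `p = 0`.
  set t := δ / (p + 1) with ht
  have ht0 : 0 < t := by positivity
  refine ⟨(1 / t) ^ p, by positivity, fun u hu => ?_⟩
  have hl := neg_log_pos hu
  have h1 : -Real.log u ≤ 1 / t * u ^ (-t) := by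
    have h := Real.abs_log_mul_self_rpow_lt u t hu.1 hu.2.le ht0
    rw [abs_mul, abs_of_neg (Real.log_neg hu.1 hu.2), abs_of_pos (Real.rpow_pos_of_pos hu.1 _)] at h
    rw [Real.rpow_neg hu.1.le, ← div_eq_mul_inv, le_div_iff₀ (Real.rpow_pos_of_pos hu.1 _)]
    exact h.le
  calc (-Real.log u) ^ p ≤ (1 / t * u ^ (-t)) ^ p := Real.rpow_le_rpow hl.le h1 hp
    _ = (1 / t) ^ p * u ^ (-t * p) := by
      rw [Real.mul_rpow (by positivity) (Real.rpow_nonneg hu.1.le _), ← Real.rpow_mul hu.1.le]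
    _ ≤ _ := by
      gcongr (1 / t) ^ p * ?_
      refine Real.rpow_le_rpow_of_exponent_ge hu.1 hu.2.le ?_
      have : t * p ≤ δ := by
        rw [ht, div_mul_eq_mul_div, div_le_iff₀ (by positivity)]
        nlinarith
      linarith

/-- The powers of `log u` are absorbed in an arbitrarily small extra exponent `δ`, so only the
exponent `α max(-γ,0)` counts. -/
lemma exists_rateMoment_rpow_mul_le {α δ : ℝ} (hα : 0 ≤ α) (γ : ℝ) (p : ℕ) (hδ : 0 < δ) :
    ∃ C : ℝ, 0 < C ∧ ∀ u ∈ Ioo (0 : ℝ) 1,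
      rateMoment 0 (-Real.log u) γ ^ α * (-Real.log u) ^ p ≤
        C * u ^ (-(α * max (-γ) 0 + δ)) := by
  obtain ⟨C, hC, h⟩ := exists_neg_log_rpow_le (p := α + p) (by positivity) hδ
  refine ⟨C, hC, fun u hu => ?_⟩
  have hl := neg_log_pos hu
  have h0 := rateMoment_zero_pos hl γ
  calc rateMoment 0 (-Real.log u) γ ^ α * (-Real.log u) ^ p
      ≤ (-Real.log u * u ^ (-(max (-γ) 0))) ^ α * (-Real.log u) ^ p := by
        gcongr
        rw [← exp_mul_neg_log hu]
        exact rateMoment_zero_le hl γ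
    _ = (-Real.log u) ^ (α + p) * u ^ (-(α * max (-γ) 0)) := by
        rw [Real.mul_rpow hl.le (Real.rpow_nonneg hu.1.le _), ← Real.rpow_mul hu.1.le,
          Real.rpow_add hl, Real.rpow_natCast]
        ring_nf
    _ ≤ C * u ^ (-δ) * u ^ (-(α * max (-γ) 0)) := by
        exact mul_le_mul_of_nonneg_right (h u hu) (Real.rpow_nonneg hu.1.le _)
    _ = _ := by
        rw [mul_assoc, ← Real.rpow_add hu.1]
        ring_nf

lemma rateMoment_zero_le_rpow_mul (hu : u ∈ Ioo (0 : ℝ) 1) (g γ : ℝ) :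
    rateMoment 0 (-Real.log u) g ≤ u ^ (-|g - γ|) * rateMoment 0 (-Real.log u) γ := by
  rw [← exp_mul_neg_log hu]
  exact rateMoment_zero_le_mul (neg_log_pos hu) g γ

lemma rateMoment_zero_rpow_le {α : ℝ} (hα : 0 ≤ α) (hu : u ∈ Ioo (0 : ℝ) 1) (g γ : ℝ) :
    rateMoment 0 (-Real.log u) g ^ α ≤
      u ^ (-(α * |g - γ|)) * rateMoment 0 (-Real.log u) γ ^ α := by
  have h0 := rateMoment_zero_pos (neg_log_pos hu) g
  have h1 := rateMoment_zero_pos (neg_log_pos hu) γ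
  refine (Real.rpow_le_rpow h0.le (rateMoment_zero_le_rpow_mul hu g γ) hα).trans_eq ?_
  rw [Real.mul_rpow (Real.rpow_nonneg hu.1.le _) h1.le, ← Real.rpow_mul hu.1.le]
  ring_nf

end PowerBounds

/-! ### The sign of the estimating function away from the true parameter -/

/-- The coefficient of the score in `term`. -/
def coeff (α g u : ℝ) : ℝ :=
  rateMoment 0 (-Real.log u) g ^ α * rateRatio 1 (-Real.log u) g

/-- The ratio of the rates at two parameters. -/
def rateQuot (γ g u : ℝ) : ℝ := rateMoment 0 (-Real.log u) g / rateMoment 0 (-Real.log u) γ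

/-- In standardized observations a change of parameter only rescales the argument of the score. -/
lemma term_div_eq (α γ g : ℝ) (u e : ℝ) :
    term α (-Real.log u) (e / rateMoment 0 (-Real.log u) γ) g =
      coeff α g u * stdScore α (rateQuot γ g u * e) := by
  unfold term coeff rateQuot
  rw [mul_assoc]
  congr 3
  ring

section

variable {u : ℝ}

lemma coeff_neg (hu : u ∈ Ioo (0 : ℝ) 1) (α g : ℝ) : coeff α g u < 0 :=
  mul_neg_of_pos_of_neg (Real.rpow_pos_of_pos (rateMoment_zero_pos (neg_log_pos hu) g) _)
    (rateRatio_one_neg (neg_log_pos hu) g)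

lemma rateQuot_pos (hu : u ∈ Ioo (0 : ℝ) 1) (γ g : ℝ) : 0 < rateQuot γ g u :=
  div_pos (rateMoment_zero_pos (neg_log_pos hu) g) (rateMoment_zero_pos (neg_log_pos hu) γ)

lemma rateQuot_le (hu : u ∈ Ioo (0 : ℝ) 1) (γ g : ℝ) : rateQuot γ g u ≤ u ^ (-|g - γ|) := by
  rw [rateQuot, div_le_iff₀ (rateMoment_zero_pos (neg_log_pos hu) γ)]
  exact rateMoment_zero_le_rpow_mul hu g γ

lemma rateQuot_lt_one (hu : u ∈ Ioo (0 : ℝ) 1) {γ g : ℝ} (h : γ < g) : rateQuot γ g u < 1 := by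
  rw [rateQuot, div_lt_one (rateMoment_zero_pos (neg_log_pos hu) γ)]
  exact rateMoment_zero_strictAnti (neg_log_pos hu) h

lemma one_lt_rateQuot (hu : u ∈ Ioo (0 : ℝ) 1) {γ g : ℝ} (h : g < γ) : 1 < rateQuot γ g u := by
  rw [rateQuot, one_lt_div (rateMoment_zero_pos (neg_log_pos hu) γ)]
  exact rateMoment_zero_strictAnti (neg_log_pos hu) h

end

lemma continuousOn_rateMoment (i : ℕ) (g : ℝ) :
    ContinuousOn (fun u => rateMoment i (-Real.log u) g) (Ioo 0 1) := by
  refine (continuous_rateMoment_length i g).comp_continuousOn ?_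
  exact (Real.continuousOn_log.mono fun u hu => hu.1.ne').neg

lemma continuousOn_rateRatio (i : ℕ) (g : ℝ) :
    ContinuousOn (fun u => rateRatio i (-Real.log u) g) (Ioo 0 1) :=
  (continuousOn_rateMoment i g).div (continuousOn_rateMoment 0 g) fun _ hu =>
    (rateMoment_zero_pos (neg_log_pos hu) g).ne'

lemma continuousOn_rateMoment_rpow (α g : ℝ) :
    ContinuousOn (fun u => rateMoment 0 (-Real.log u) g ^ α) (Ioo 0 1) :=
  (continuousOn_rateMoment 0 g).rpow_const fun _ hu =>
    Or.inl (rateMoment_zero_pos (neg_log_pos hu) g).ne'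

lemma continuousOn_coeff (α g : ℝ) : ContinuousOn (coeff α g) (Ioo 0 1) :=
  (continuousOn_rateMoment_rpow α g).mul (continuousOn_rateRatio 1 g)

lemma continuousOn_rateQuot (γ g : ℝ) : ContinuousOn (rateQuot γ g) (Ioo 0 1) :=
  (continuousOn_rateMoment 0 g).div (continuousOn_rateMoment 0 γ) fun _ hu =>
    (rateMoment_zero_pos (neg_log_pos hu) γ).ne'

lemma continuousOn_scoreMean {α : ℝ} (hα : 0 ≤ α) : ContinuousOn (scoreMean α) (Ici 0) := by
  have : ContinuousOn (fun r => (r - 1) * (α ^ 3 / (1 + α) ^ 2 * r + (1 + α + α ^ 2) / (1 + α) ^ 2) /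
      (1 + α * r) ^ 2) (Ici 0) := by
    refine ContinuousOn.div (by fun_prop) (by fun_prop) fun r hr => ?_
    have : 0 ≤ r := hr
    positivity
  exact this.congr fun r hr => scoreMean_eq hα hr

/-- The variance of one contribution has at most a power singularity. -/
lemma exists_coeff_sq_mul_scoreVar_le {α : ℝ} (hα : 0 ≤ α) (γ g : ℝ) {δ : ℝ} (hδ : 0 < δ) :
    ∃ C : ℝ, 0 < C ∧ ∀ u ∈ Ioo (0 : ℝ) 1, coeff α g u ^ 2 * scoreVar α (rateQuot γ g u) ≤
      C * u ^ (-(2 * (α * max (-γ) 0) + 2 * δ + (2 * α + 2) * |g - γ|)) := by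
  obtain ⟨C, hC, h⟩ := exists_rateMoment_rpow_mul_le hα γ 1 hδ
  refine ⟨80 * C ^ 2, by positivity, fun u hu => ?_⟩
  have hl := neg_log_pos hu
  have hx : ∀ s : ℝ, 0 ≤ u ^ s := fun s => Real.rpow_nonneg hu.1.le _
  have h1 : |coeff α g u| ≤ C * u ^ (-(α * max (-γ) 0 + δ + α * |g - γ|)) := by
    have h0 := Real.rpow_nonneg (rateMoment_zero_pos hl g).le α
    calc |coeff α g u| ≤ rateMoment 0 (-Real.log u) g ^ α * (-Real.log u) ^ 1 := by
          rw [coeff, abs_mul, abs_of_nonneg h0]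
          gcongr
          exact abs_rateRatio_le 1 hl g
      _ ≤ u ^ (-(α * |g - γ|)) * rateMoment 0 (-Real.log u) γ ^ α * (-Real.log u) ^ 1 := by
          gcongr
          exact rateMoment_zero_rpow_le hα hu g γ
      _ ≤ u ^ (-(α * |g - γ|)) * (C * u ^ (-(α * max (-γ) 0 + δ))) := by
          rw [mul_assoc]
          exact mul_le_mul_of_nonneg_left (h u hu) (hx _)
      _ = C * (u ^ (-(α * |g - γ|)) * u ^ (-(α * max (-γ) 0 + δ))) := by ring
      _ = _ := by
          rw [← Real.rpow_add hu.1]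
          ring_nf
  have hr := rateQuot_pos hu γ g
  have h2 : scoreVar α (rateQuot γ g u) ≤ 80 * u ^ (-(2 * |g - γ|)) := by
    refine (scoreVar_le hα hr.le).trans ?_
    have h3 : 1 + rateQuot γ g u ≤ 2 * u ^ (-|g - γ|) := by
      have := rateQuot_le hu γ g
      have := one_le_rpow_neg hu (abs_nonneg (g - γ))
      linarith
    calc 20 * (1 + rateQuot γ g u) ^ 2 ≤ 20 * (2 * u ^ (-|g - γ|)) ^ 2 := by gcongr
      _ = 80 * (u ^ (-|g - γ|) * u ^ (-|g - γ|)) := by ring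
      _ = _ := by
          rw [← Real.rpow_add hu.1]
          ring_nf
  have h4 : coeff α g u ^ 2 ≤ (C * u ^ (-(α * max (-γ) 0 + δ + α * |g - γ|))) ^ 2 := by
    rw [← sq_abs (coeff α g u)]
    gcongr
  calc _ ≤ (C * u ^ (-(α * max (-γ) 0 + δ + α * |g - γ|))) ^ 2 * (80 * u ^ (-(2 * |g - γ|))) :=
        mul_le_mul h4 h2 (scoreVar_nonneg _ _) (sq_nonneg _)
    _ = 80 * C ^ 2 * (u ^ (-(α * max (-γ) 0 + δ + α * |g - γ|)) *
        u ^ (-(α * max (-γ) 0 + δ + α * |g - γ|)) * u ^ (-(2 * |g - γ|))) := by ring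
    _ = _ := by
        rw [← Real.rpow_add hu.1, ← Real.rpow_add hu.1]
        ring_nf

/-- The variance is `O(r²)`, while the mean tends to the nonzero value `scoreMean α 0`. -/
lemma eventually_scoreVar_le_nhdsGT_zero {α : ℝ} (hα : 0 ≤ α) {η : ℝ} (hη : 0 < η) :
    ∀ᶠ r in nhdsWithin 0 (Ioi 0), scoreVar α r ≤ η * scoreMean α r ^ 2 := by
  have h1 : Tendsto (fun r => scoreMean α r ^ 2) (nhdsWithin 0 (Ioi 0))
      (nhds (scoreMean α 0 ^ 2)) :=
    (((continuousOn_scoreMean hα).continuousWithinAt self_mem_Ici).mono Ioi_subset_Ici_self).pow 2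
  have h2 : Tendsto (fun r : ℝ => 2 * (1 + α) ^ 2 * r ^ 2) (nhdsWithin 0 (Ioi 0)) (nhds 0) := by
    have : Continuous fun r : ℝ => 2 * (1 + α) ^ 2 * r ^ 2 := by fun_prop
    simpa using (this.tendsto 0).mono_left nhdsWithin_le_nhds
  have h0 : 0 < η * scoreMean α 0 ^ 2 := by
    have := scoreMean_neg hα le_rfl one_pos
    exact mul_pos hη (sq_pos_of_neg this)
  filter_upwards [h2.eventually_lt (h1.const_mul η) h0, self_mem_nhdsWithin] with r hr hr0
  exact (scoreVar_le_sq hα (le_of_lt hr0)).trans hr.le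

/-- The variance is `O(1/r)`, while the mean stays above a positive constant. -/
lemma eventually_scoreVar_le_atTop {α : ℝ} (hα : 0 < α) {η : ℝ} (hη : 0 < η) :
    ∀ᶠ r in atTop, scoreVar α r ≤ η * scoreMean α r ^ 2 := by
  -- A lower bound of the mean for `r ≥ 2`, from `r - 1 ≥ r / 2` and `1 + α r ≤ (1 + α) r`.
  set c := α ^ 3 / (1 + α) ^ 2 / (2 * (1 + α) ^ 2) with hc
  have hc0 : 0 < c := by positivity
  have h1 : Tendsto (fun r : ℝ => (1 / (2 * α) + 1 / (4 * α ^ 3)) / r) atTop (nhds 0) :=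
    tendsto_id.const_div_atTop _
  filter_upwards [h1.eventually_lt_const (show 0 < η * c ^ 2 by positivity), eventually_ge_atTop 2]
    with r hr hr2
  have hr0 : 0 < r := by linarith
  refine (scoreVar_le_inv hα hr0).trans (hr.le.trans ?_)
  gcongr
  rw [scoreMean_eq hα.le hr0.le, le_div_iff₀ (by positivity)]
  calc c * (1 + α * r) ^ 2 ≤ c * ((1 + α) * r) ^ 2 := by
        gcongr
        linarith
    _ = r / 2 * (α ^ 3 / (1 + α) ^ 2 * r) := by
        rw [hc]
        field_simp
    _ ≤ _ := by
        gcongr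
        · linarith
        · linarith
        · exact le_add_of_nonneg_right (show 0 ≤ (1 + α + α ^ 2) / (1 + α) ^ 2 by positivity)

lemma tendsto_neg_log_nhdsGT_zero :
    Tendsto (fun u => -Real.log u) (nhdsWithin 0 (Ioi 0)) atTop :=
  tendsto_neg_atBot_atTop.comp Real.tendsto_log_nhdsGT_zero

/-- For a negative parameter, the rate at a larger parameter is of smaller order at `0`. -/
lemma tendsto_rateQuot_of_lt {γ g : ℝ} (hγ : γ < 0) (h : γ < g) :
    Tendsto (rateQuot γ g) (nhdsWithin 0 (Ioi 0)) (nhds 0) := by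
  have key : Tendsto (fun ℓ => rateMoment 0 ℓ g / rateMoment 0 ℓ γ) atTop (nhds 0) := by
    -- The gap between the exponential growth rates in `ℓ`: the numerator is at most `ℓ e^{max(-g,0)
    -- ℓ}` and the denominator is eventually at least `e^{-γ ℓ} / (-2γ)`.
    set c := -γ - max (-g) 0 with hc
    have hc0 : 0 < c := by
      have : max (-g) 0 < -γ := max_lt (by linarith) (by linarith)
      linarith
    have hlim : Tendsto (fun ℓ : ℝ => -2 * γ * (ℓ ^ 1 * Real.exp (-c * ℓ))) atTop (nhds 0) := by
      have := (Real.tendsto_pow_mul_exp_neg_atTop_nhds_zero 1).comp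
        (tendsto_id.const_mul_atTop hc0)
      have h2 := this.const_mul (-2 * γ / c)
      rw [mul_zero] at h2
      refine h2.congr fun ℓ => ?_
      simp only [Function.comp, id]
      field_simp
    have hlarge : ∀ᶠ ℓ : ℝ in atTop, 2 ≤ Real.exp (-γ * ℓ) :=
      (Real.tendsto_exp_atTop.comp (tendsto_id.const_mul_atTop (neg_pos.2 hγ))).eventually_ge_atTop 2
    refine tendsto_of_tendsto_of_tendsto_of_le_of_le' tendsto_const_nhds hlim ?_ ?_
    · filter_upwards [eventually_gt_atTop 0] with ℓ hℓ
      exact (div_pos (rateMoment_zero_pos hℓ g) (rateMoment_zero_pos hℓ γ)).le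
    · filter_upwards [eventually_gt_atTop 0, hlarge] with ℓ hℓ h2
      rw [div_le_iff₀ (rateMoment_zero_pos hℓ γ)]
      refine (rateMoment_zero_le hℓ g).trans ?_
      rw [rateMoment_zero_eq hγ.ne, ← neg_mul]
      have e1 : Real.exp (max (-g) 0 * ℓ) = Real.exp (-c * ℓ) * Real.exp (-γ * ℓ) := by
        rw [← Real.exp_add, hc]
        ring_nf
      rw [e1, pow_one]
      have e2 : -2 * γ * (ℓ * Real.exp (-c * ℓ)) * ((1 - Real.exp (-γ * ℓ)) / γ) =
          ℓ * (Real.exp (-c * ℓ) * (2 * (Real.exp (-γ * ℓ) - 1))) := by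
        field_simp [hγ.ne]
        ring
      rw [e2]
      gcongr
      linarith
  exact key.comp tendsto_neg_log_nhdsGT_zero

/-- As `u → 0` the quotient of the rates tends to `∞` for `g < γ` and to `0` for `g > γ`; in both
regimes the score is almost deterministic. This replaces integrability of the variances. -/
lemma eventually_scoreVar_rateQuot_le {α γ g : ℝ} (hα : 0 < α) (hγ : γ < 0) (hg : g ≠ γ) {η : ℝ}
    (hη : 0 < η) : ∀ᶠ u in nhdsWithin 0 (Ioi 0),
      scoreVar α (rateQuot γ g u) ≤ η * scoreMean α (rateQuot γ g u) ^ 2 := by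
  have hIoo : ∀ᶠ u : ℝ in nhdsWithin 0 (Ioi 0), u ∈ Ioo (0 : ℝ) 1 :=
    Ioo_mem_nhdsGT one_pos
  rcases lt_or_gt_of_ne hg with h | h
  · have h1 : Tendsto (rateQuot γ g) (nhdsWithin 0 (Ioi 0)) atTop := by
      have h2 : Tendsto (rateQuot g γ) (nhdsWithin 0 (Ioi 0)) (nhdsWithin 0 (Ioi 0)) :=
        tendsto_nhdsWithin_iff.2 ⟨tendsto_rateQuot_of_lt (h.trans hγ) h,
          hIoo.mono fun u hu => rateQuot_pos hu g γ⟩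
      refine h2.inv_tendsto_nhdsGT_zero.congr fun u => ?_
      simp [rateQuot]
    exact h1.eventually (eventually_scoreVar_le_atTop hα hη)
  · have h2 : Tendsto (rateQuot γ g) (nhdsWithin 0 (Ioi 0)) (nhdsWithin 0 (Ioi 0)) :=
      tendsto_nhdsWithin_iff.2 ⟨tendsto_rateQuot_of_lt hγ h,
        hIoo.mono fun u hu => rateQuot_pos hu γ g⟩
    exact h2.eventually (eventually_scoreVar_le_nhdsGT_zero hα.le hη)

/-! ### Existence of a consistent sequence of roots -/

lemma tendsto_natCast_add_one_atTop : Tendsto (fun k : ℕ => (k : ℝ) + 1) atTop atTop :=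
  tendsto_atTop_add_const_right _ _ tendsto_natCast_atTop_atTop

/-- In the application `F` is the mean and `G` the variance of the estimating function, up to sign,
and the quotient is Chebyshev's bound. -/
lemma tendsto_div_sq_zero {F G : ℕ → ℝ} (hG0 : ∀ k, 0 ≤ G k)
    (hF : ∃ c : ℝ, 0 < c ∧ ∀ᶠ k : ℕ in atTop, c * ((k : ℝ) + 1) ≤ F k)
    (hG : ∀ η : ℝ, 0 < η → ∃ K : ℝ, ∀ k : ℕ, G k ≤ η * F k ^ 2 + K * ((k : ℝ) + 1)) :
    Tendsto (fun k => G k / F k ^ 2) atTop (nhds 0) := by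
  obtain ⟨c, hc, hF⟩ := hF
  rw [Metric.tendsto_nhds]
  intro ε hε
  obtain ⟨K, hK⟩ := hG (ε / 2) (half_pos hε)
  have h1 : Tendsto (fun k : ℕ => |K| / c ^ 2 / ((k : ℝ) + 1)) atTop (nhds 0) :=
    tendsto_natCast_add_one_atTop.const_div_atTop _
  filter_upwards [hF, h1.eventually_lt_const (half_pos hε)] with k hk h2
  have hk0 : (0 : ℝ) < (k : ℝ) + 1 := by positivity
  have hFpos : 0 < F k := (mul_pos hc hk0).trans_le hk
  rw [Real.dist_0_eq_abs, abs_of_nonneg (div_nonneg (hG0 k) (sq_nonneg _)),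
    div_lt_iff₀ (by positivity)]
  have h3 : K * ((k : ℝ) + 1) < ε / 2 * F k ^ 2 := by
    calc K * ((k : ℝ) + 1) ≤ |K| * ((k : ℝ) + 1) := by
          gcongr
          exact le_abs_self K
      _ = |K| / c ^ 2 / ((k : ℝ) + 1) * (c * ((k : ℝ) + 1)) ^ 2 := by field_simp
      _ < ε / 2 * (c * ((k : ℝ) + 1)) ^ 2 := by gcongr
      _ ≤ _ := by gcongr
  linarith [hK k]

/-- For `s < 1` the sum of `G` is of order `k`. Otherwise the terms with `u` near `0` are at most `η
F²`, where the sum of squares is at most the square of the sum by positivity, and the remaining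
terms are bounded. -/
lemma sum_designPoint_le_of_singularity {F G : ℝ → ℝ} {C s : ℝ} (hs0 : 0 ≤ s)
    (hF : ∀ u ∈ Ioo (0 : ℝ) 1, 0 < F u) (hC : 0 < C)
    (hG : ∀ u ∈ Ioo (0 : ℝ) 1, G u ≤ C * u ^ (-s))
    (h : s < 1 ∨ ∀ η : ℝ, 0 < η → ∀ᶠ u in nhdsWithin 0 (Ioi 0), G u ≤ η * F u ^ 2)
    {η : ℝ} (hη : 0 < η) :
    ∃ K : ℝ, ∀ k : ℕ, ∑ i : Fin (k - 1), G (designPoint k i) ≤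
      η * (∑ i : Fin (k - 1), F (designPoint k i)) ^ 2 + K * ((k : ℝ) + 1) := by
  rcases h with hs | h
  · obtain ⟨C', -, hC'⟩ := exists_sum_rpow_designPoint_le hs0 hs
    refine ⟨C * C', fun k => ?_⟩
    calc ∑ i : Fin (k - 1), G (designPoint k i)
        ≤ ∑ i : Fin (k - 1), C * designPoint k i ^ (-s) :=
          Finset.sum_le_sum fun i _ => hG _ (designPoint_mem k i)
      _ = C * ∑ i : Fin (k - 1), designPoint k i ^ (-s) := by rw [Finset.mul_sum]
      _ ≤ C * (C' * ((k : ℝ) + 1)) := by gcongr; exact hC' k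
      _ ≤ _ := by
          have : 0 ≤ η * (∑ i : Fin (k - 1), F (designPoint k i)) ^ 2 := by positivity
          linarith
  · obtain ⟨u₀, hu₀, h⟩ := mem_nhdsGT_iff_exists_Ioo_subset.1 (h η hη)
    have hu₀' : (0 : ℝ) < u₀ := hu₀
    refine ⟨C * u₀ ^ (-s), fun k => ?_⟩
    have hterm : ∀ i : Fin (k - 1), G (designPoint k i) ≤
        η * F (designPoint k i) ^ 2 + C * u₀ ^ (-s) := fun i => by
      have hu := designPoint_mem k i
      rcases lt_or_ge (designPoint k i) u₀ with h1 | h1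
      · have : G (designPoint k i) ≤ η * F (designPoint k i) ^ 2 := h ⟨hu.1, h1⟩
        have : 0 ≤ C * u₀ ^ (-s) := by positivity
        linarith
      · refine (hG _ hu).trans (le_add_of_nonneg_of_le (by positivity) ?_)
        gcongr C * ?_
        exact Real.rpow_le_rpow_of_nonpos hu₀' h1 (by linarith)
    have hsq : ∑ i : Fin (k - 1), F (designPoint k i) ^ 2 ≤
        (∑ i : Fin (k - 1), F (designPoint k i)) ^ 2 :=
      Finset.sum_sq_le_sq_sum_of_nonneg fun i _ => (hF _ (designPoint_mem k i)).le
    calc ∑ i : Fin (k - 1), G (designPoint k i)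
        ≤ ∑ i : Fin (k - 1), (η * F (designPoint k i) ^ 2 + C * u₀ ^ (-s)) :=
          Finset.sum_le_sum fun i _ => hterm i
      _ = η * ∑ i : Fin (k - 1), F (designPoint k i) ^ 2 +
          ((k - 1 : ℕ) : ℝ) * (C * u₀ ^ (-s)) := by
          rw [Finset.sum_add_distrib, Finset.mul_sum]
          simp
      _ ≤ η * (∑ i : Fin (k - 1), F (designPoint k i)) ^ 2 +
          ((k : ℝ) + 1) * (C * u₀ ^ (-s)) := by
          have : ((k - 1 : ℕ) : ℝ) ≤ (k : ℝ) + 1 := by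
            have : k - 1 ≤ k + 1 := by omega
            exact_mod_cast this
          gcongr
      _ = _ := by ring

/-- With probability tending to one the estimating function has, at a fixed parameter, the sign
`σ` of the deviation from the true parameter. -/
lemma tendsto_ermLaw_mul_estimatingFunction_nonpos {α γ g σ : ℝ} (hα : 0 ≤ α)
    (hσ : |σ| = 1) (hg : 0 < σ * (g - γ))
    (h : 2 * (α * max (-γ) 0) + (2 * α + 3) * |g - γ| < 1 ∨ 0 < α ∧ γ < 0) :
    Tendsto (fun k => (ermLaw γ k).real {y | σ * estimatingFunction α k y g ≤ 0}) atTop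
      (nhds 0) := by
  have hne : g ≠ γ := by
    rintro rfl
    simp at hg
  have hd : 0 < |g - γ| := abs_pos.2 (sub_ne_zero.2 hne)
  have hσ2 : σ ^ 2 = 1 := by rw [← sq_abs, hσ, one_pow]
  set F : ℝ → ℝ := fun u => σ * (coeff α g u * scoreMean α (rateQuot γ g u)) with hF
  set G : ℝ → ℝ := fun u => coeff α g u ^ 2 * scoreVar α (rateQuot γ g u) with hG
  have hFpos : ∀ u ∈ Ioo (0 : ℝ) 1, 0 < F u := fun u hu => by
    have hc := coeff_neg hu α g
    have hr := rateQuot_pos hu γ g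
    rcases lt_or_gt_of_ne hne with h | h
    · have hs : σ < 0 := by nlinarith
      have hm := scoreMean_pos hα (one_lt_rateQuot hu h)
      exact mul_pos_of_neg_of_neg hs (mul_neg_of_neg_of_pos hc hm)
    · have hs : 0 < σ := by nlinarith
      have hm := scoreMean_neg hα hr.le (rateQuot_lt_one hu h)
      exact mul_pos hs (mul_pos_of_neg_of_neg hc hm)
  have hFcont : ContinuousOn F (Ioo 0 1) :=
    continuousOn_const.mul ((continuousOn_coeff α g).mul
      ((continuousOn_scoreMean hα).comp (continuousOn_rateQuot γ g)
        fun u hu => (rateQuot_pos hu γ g).le))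
  have hG0 : ∀ u, 0 ≤ G u := fun u => mul_nonneg (sq_nonneg _) (scoreVar_nonneg _ _)
  obtain ⟨C, hC, hGC⟩ := exists_coeff_sq_mul_scoreVar_le hα γ g (half_pos hd)
  -- The auxiliary exponent `δ = |g - γ| / 2` turns the factor `2 α + 2` into the `2 α + 3` of the
  -- hypothesis.
  have hsing : 2 * (α * max (-γ) 0) + 2 * (|g - γ| / 2) + (2 * α + 2) * |g - γ| < 1 ∨
      ∀ η : ℝ, 0 < η → ∀ᶠ u in nhdsWithin 0 (Ioi 0), G u ≤ η * F u ^ 2 := by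
    refine h.imp (fun h => by linarith) fun h η hη => ?_
    filter_upwards [eventually_scoreVar_rateQuot_le h.1 h.2 hne hη] with u hu
    simp only [hF, hG, mul_pow, hσ2, one_mul]
    calc _ ≤ coeff α g u ^ 2 * (η * scoreMean α (rateQuot γ g u) ^ 2) := by gcongr
      _ = _ := by ring
  have hlim := tendsto_div_sq_zero
    (fun k => Finset.sum_nonneg fun i (_ : i ∈ Finset.univ) => hG0 (designPoint k i))
    (exists_le_sum_designPoint hFcont hFpos)
    fun η hη => sum_designPoint_le_of_singularity (by positivity) hFpos hC hGC hsing hη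
  obtain ⟨c, hc, hSF⟩ := exists_le_sum_designPoint hFcont hFpos
  refine squeeze_zero' (Eventually.of_forall fun k => measureReal_nonneg) ?_ hlim
  filter_upwards [hSF] with k hk
  have hSpos : 0 < ∑ i : Fin (k - 1), F (designPoint k i) :=
    lt_of_lt_of_le (by positivity) hk
  have hmeas : MeasurableSet {y | σ * estimatingFunction α k y g ≤ 0} :=
    measurableSet_le ((measurable_estimatingFunction α k g).const_mul σ) measurable_const
  rw [ermLaw_real_apply γ k hmeas]
  set f : Fin (k - 1) → ℝ → ℝ := fun i x =>
    σ * coeff α g (designPoint k i) * stdScore α (rateQuot γ g (designPoint k i) * x) with hf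
  have hfL : ∀ i, MemLp (f i) 2 stdExp := fun i =>
    (memLp_stdScore_mul hα (rateQuot_pos (designPoint_mem k i) γ g).le).const_mul _
  have hfm : ∀ i, ∫ x, f i x ∂stdExp = F (designPoint k i) := fun i => by
    simp only [hf, hF, integral_const_mul, scoreMean]
    ring
  have hfv : ∀ i, Var[f i; stdExp] = G (designPoint k i) := fun i => by
    simp only [hf, hG]
    rw [variance_const_mul, mul_pow, hσ2, one_mul, scoreVar]
  have hcheb := measureReal_pi_abs_sum_sub_ge_le hfL hSpos
  simp only [hfm, hfv] at hcheb
  -- If the sum has the wrong sign, it deviates from its positive mean by at least that mean.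
  refine le_trans (measureReal_mono fun e he => ?_) hcheb
  have he' : σ * estimatingFunction α k (fun i => e i / rate γ k i) g ≤ 0 := he
  have hsum : σ * estimatingFunction α k (fun i => e i / rate γ k i) g = ∑ i, f i (e i) := by
    rw [estimatingFunction_eq, Finset.mul_sum]
    refine Finset.sum_congr rfl fun i _ => ?_
    simp only [rate, term_div_eq, hf]
    ring
  rw [hsum] at he'
  change _ ≤ |∑ i, f i (e i) - ∑ i : Fin (k - 1), F (designPoint k i)|
  rw [abs_of_nonpos (by linarith)]
  linarith

/-- The first sign change of `f` from negative to positive values on `[a, b]`, located by rational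
points. -/
def firstPositive (a b : ℝ) (f : ℝ → ℝ) : ℝ :=
  ⨅ q : {q : ℚ // (q : ℝ) ∈ Icc a b}, if 0 < f (q : ℚ) then ((q : ℚ) : ℝ) else b

lemma firstPositive_mem {a b : ℝ} (hab : a < b) (f : ℝ → ℝ) : firstPositive a b f ∈ Icc a b := by
  obtain ⟨q, hq1, hq2⟩ := exists_rat_btwn hab
  have hne : Nonempty {q : ℚ // (q : ℝ) ∈ Icc a b} := ⟨q, hq1.le, hq2.le⟩
  have hmem : ∀ q : {q : ℚ // (q : ℝ) ∈ Icc a b},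
      (if 0 < f (q : ℚ) then ((q : ℚ) : ℝ) else b) ∈ Icc a b := fun q => by
    split_ifs
    · exact q.2
    · exact right_mem_Icc.2 hab.le
  refine ⟨le_ciInf fun q => (hmem q).1, ?_⟩
  exact (ciInf_le ⟨a, by rintro _ ⟨q, rfl⟩; exact (hmem q).1⟩ hne.some).trans (hmem _).2

/-- If `f` were negative at the infimum, it would be negative on a right neighbourhood, and the
infimum would be larger. If `f` were positive there, a rational slightly to the left would already
count. -/
lemma firstPositive_root {a b : ℝ} (hab : a < b) {f : ℝ → ℝ} (hf : Continuous f) (ha : f a < 0)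
    (hb : 0 < f b) : f (firstPositive a b f) = 0 := by
  set T := firstPositive a b f with hT
  have hTmem := firstPositive_mem hab f
  rw [← hT] at hTmem
  have hbdd : BddBelow (range fun q : {q : ℚ // (q : ℝ) ∈ Icc a b} =>
      if 0 < f (q : ℚ) then ((q : ℚ) : ℝ) else b) := by
    refine ⟨a, ?_⟩
    rintro _ ⟨q, rfl⟩
    simp only
    split_ifs
    · exact q.2.1
    · exact hab.le
  rcases lt_trichotomy (f T) 0 with h | h | h
  · exfalso
    have hTb : T < b := lt_of_le_of_ne hTmem.2 fun e => by
      rw [e] at h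
      linarith
    obtain ⟨δ, hδ, hball⟩ := Metric.eventually_nhds_iff.1 (hf.continuousAt.eventually_lt_const h)
    obtain ⟨q₀, h1, h2⟩ := exists_rat_btwn hab
    have hne : Nonempty {q : ℚ // (q : ℝ) ∈ Icc a b} := ⟨q₀, h1.le, h2.le⟩
    have : min (T + δ) b ≤ T := by
      refine le_ciInf fun q => ?_
      split_ifs with hq
      · by_contra hlt
        rw [not_le, lt_min_iff] at hlt
        have hTq : T ≤ q := by
          have h3 := ciInf_le hbdd q
          simp only [if_pos hq] at h3
          exact h3
        have : dist ((q : ℚ) : ℝ) T < δ := by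
          rw [Real.dist_eq, abs_of_nonneg (by linarith)]
          linarith
        linarith [hball this]
      · exact min_le_right _ _
    rcases min_le_iff.1 this with h | h <;> linarith
  · exact h
  · exfalso
    have haT : a < T := lt_of_le_of_ne hTmem.1 fun e => by
      rw [← e] at h
      linarith
    obtain ⟨δ, hδ, hball⟩ := Metric.eventually_nhds_iff.1 (hf.continuousAt.eventually_const_lt h)
    obtain ⟨q, hq1, hq2⟩ := exists_rat_btwn (show max a (T - δ) < T from max_lt haT (by linarith))
    rw [max_lt_iff] at hq1
    have hqpos : 0 < f q := hball (by
      rw [Real.dist_eq, abs_of_nonpos (by linarith)]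
      linarith)
    have := ciInf_le hbdd ⟨q, hq1.1.le, hq2.le.trans hTmem.2⟩
    simp only [if_pos hqpos] at this
    have : T ≤ q := this
    linarith

/-- The infimum runs over countably many rationals; this is the reason for that form of the
selection. -/
lemma measurable_firstPositive {Ω : Type*} [MeasurableSpace Ω] {a b : ℝ}
    {F : Ω → ℝ → ℝ} (hF : ∀ g, Measurable fun ω => F ω g) :
    Measurable fun ω => firstPositive a b (F ω) := by
  unfold firstPositive
  refine Measurable.iInf fun q => ?_
  exact Measurable.ite (measurableSet_lt measurable_const (hF _)) measurable_const measurable_const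

/-- Diagonal selection: if `p n m → 1` for every `m`, then `p n (m n) → 1` for some `m n → ∞`. -/
lemma exists_tendsto_diagonal {p : ℕ → ℕ → ℝ} (hp1 : ∀ n m, p n m ≤ 1)
    (hp : ∀ m, Tendsto (fun n => p n m) atTop (nhds 1)) :
    ∃ m : ℕ → ℕ, Tendsto m atTop atTop ∧ Tendsto (fun n => p n (m n)) atTop (nhds 1) := by
  set Q : ℕ → ℕ → Prop := fun n m => 1 - 1 / ((m : ℝ) + 1) ≤ p n m with hQ
  have hQev : ∀ m, ∀ᶠ n in atTop, Q n m := fun m =>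
    ((hp m).eventually_const_lt (show 1 - 1 / ((m : ℝ) + 1) < 1 by
      have : (0 : ℝ) < 1 / ((m : ℝ) + 1) := by positivity
      linarith)).mono fun n hn => hn.le
  classical
  refine ⟨fun n => Nat.findGreatest (Q n) n, ?_, ?_⟩
  · refine tendsto_atTop.2 fun M => ?_
    filter_upwards [hQev M, eventually_ge_atTop M] with n hn hM
    exact Nat.le_findGreatest hM hn
  · have hm : Tendsto (fun n => Nat.findGreatest (Q n) n) atTop atTop := by
      refine tendsto_atTop.2 fun M => ?_
      filter_upwards [hQev M, eventually_ge_atTop M] with n hn hM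
      exact Nat.le_findGreatest hM hn
    have hlow : Tendsto (fun n => 1 - 1 / (((Nat.findGreatest (Q n) n : ℕ) : ℝ) + 1)) atTop
        (nhds 1) := by
      simpa using ((tendsto_natCast_add_one_atTop.const_div_atTop 1).comp hm).const_sub 1
    refine tendsto_of_tendsto_of_tendsto_of_le_of_le' hlow tendsto_const_nhds ?_
      (Eventually.of_forall fun n => hp1 _ _)
    -- `Nat.findGreatest` returns `0` by default, so the property must also hold at `m = 0`, where
    -- it reads `0 ≤ p n 0`.
    filter_upwards [hQev 0] with n hn
    exact Nat.findGreatest_spec (P := Q n) (Nat.zero_le n) hn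

section

variable {Ω : ℕ → Type*} [∀ n, MeasurableSpace (Ω n)] {P : ∀ n, Measure (Ω n)}
  [∀ n, IsProbabilityMeasure (P n)] {α γ : ℝ} {k : ℕ → ℕ} {Y : ∀ n, Ω n → Fin (k n - 1) → ℝ}

/-- With probability tending to one the estimating function changes sign around the parameter. -/
lemma tendsto_measureReal_sign_change (hα : 0 ≤ α) (hk : Tendsto k atTop atTop)
    (hY : ∀ n, Measurable (Y n)) (hERM : ERMApproximation P γ k Y) {ε : ℝ} (hε : 0 < ε)
    (h : 2 * (α * max (-γ) 0) + (2 * α + 3) * ε < 1 ∨ 0 < α ∧ γ < 0) :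
    Tendsto (fun n => (P n).real {ω | estimatingFunction α (k n) (Y n ω) (γ - ε) < 0 ∧
      0 < estimatingFunction α (k n) (Y n ω) (γ + ε)}) atTop (nhds 1) := by
  have key : ∀ σ g : ℝ, |σ| = 1 → 0 < σ * (g - γ) → |g - γ| = ε →
      Tendsto (fun n => (P n).real {ω | σ * estimatingFunction α (k n) (Y n ω) g ≤ 0}) atTop
        (nhds 0) := fun σ g hσ hg hgε =>
    hERM.tendsto_real (A := fun n => {y | σ * estimatingFunction α (k n) y g ≤ 0})
      (fun n => measurableSet_le ((measurable_estimatingFunction α (k n) g).const_mul σ)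
        measurable_const)
      ((tendsto_ermLaw_mul_estimatingFunction_nonpos hα hσ hg (by rwa [hgε])).comp hk)
  have h1 := key 1 (γ + ε) (by simp) (by simpa) (by simpa using hε.le)
  have h2 := key (-1) (γ - ε) (by simp) (by simpa) (by simpa using hε.le)
  have hlow := (h1.add h2).const_sub 1
  rw [add_zero, sub_zero] at hlow
  refine tendsto_of_tendsto_of_tendsto_of_le_of_le hlow tendsto_const_nhds (fun n => ?_)
    fun n => measureReal_le_one
  have hm : ∀ g, Measurable fun ω => estimatingFunction α (k n) (Y n ω) g := fun g =>
    (measurable_estimatingFunction α (k n) g).comp (hY n)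
  have hset : MeasurableSet {ω | estimatingFunction α (k n) (Y n ω) (γ - ε) < 0 ∧
      0 < estimatingFunction α (k n) (Y n ω) (γ + ε)} :=
    (measurableSet_lt (hm _) measurable_const).inter (measurableSet_lt measurable_const (hm _))
  have hc := probReal_compl_eq_one_sub (μ := P n) hset
  have hle : (P n).real {ω | estimatingFunction α (k n) (Y n ω) (γ - ε) < 0 ∧
      0 < estimatingFunction α (k n) (Y n ω) (γ + ε)}ᶜ ≤
      (P n).real {ω | 1 * estimatingFunction α (k n) (Y n ω) (γ + ε) ≤ 0} +
      (P n).real {ω | -1 * estimatingFunction α (k n) (Y n ω) (γ - ε) ≤ 0} := by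
    refine le_trans (measureReal_mono fun ω hω => ?_) (measureReal_union_le _ _)
    by_contra hcon
    simp only [mem_union, mem_ofPred_eq, not_or, not_le] at hcon
    exact hω ⟨by linarith [hcon.2], by linarith [hcon.1]⟩
  linarith

lemma tendsto_measure_of_tendsto_real_one {A : ∀ n, Set (Ω n)}
    (h : Tendsto (fun n => (P n).real (A n)) atTop (nhds 1)) :
    Tendsto (fun n => P n (A n)) atTop (nhds 1) := by
  have := ENNReal.tendsto_ofReal h
  rw [ENNReal.ofReal_one] at this
  exact this.congr fun n => ofReal_measureReal

theorem exists_isConsistentRootSequence (hα : 0 ≤ α) (hk : Tendsto k atTop atTop)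
    (hY : ∀ n, Measurable (Y n)) (hERM : ERMApproximation P γ k Y) :
    ∃ g : ∀ n, Ω n → ℝ, IsConsistentRootSequence P α γ k Y g := by
  -- Unless `α > 0` and `γ < 0`, the product `α * max (-γ) 0` vanishes and a small `ε` makes the
  -- singularity integrable; the choice below gives the exponent at most `1/2`.
  obtain ⟨ε₀, hε₀, hcond⟩ : ∃ ε₀ : ℝ, 0 < ε₀ ∧ ∀ ε, ε ≤ ε₀ →
      (2 * (α * max (-γ) 0) + (2 * α + 3) * ε < 1 ∨ 0 < α ∧ γ < 0) := by
    by_cases h : 0 < α ∧ γ < 0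
    · exact ⟨1, one_pos, fun _ _ => Or.inr h⟩
    · have hq : α * max (-γ) 0 = 0 := by
        rcases hα.eq_or_lt with h' | h'
        · rw [← h', zero_mul]
        · have : 0 ≤ γ := not_lt.1 fun h'' => h ⟨h', h''⟩
          rw [max_eq_right (by linarith), mul_zero]
      refine ⟨1 / (2 * (2 * α + 3)), by positivity, fun ε hε => Or.inl ?_⟩
      rw [hq]
      calc 2 * 0 + (2 * α + 3) * ε ≤ 2 * 0 + (2 * α + 3) * (1 / (2 * (2 * α + 3))) := by gcongr
        _ = 1 / 2 := by field_simp; ring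
        _ < 1 := by norm_num
  set ε : ℕ → ℝ := fun m => ε₀ / ((m : ℝ) + 1) with hε
  have hεpos : ∀ m, 0 < ε m := fun m => by positivity
  have hεle : ∀ m, ε m ≤ ε₀ := fun m => div_le_self hε₀.le (by simp)
  have hεlim : Tendsto ε atTop (nhds 0) := tendsto_natCast_add_one_atTop.const_div_atTop _
  obtain ⟨m, hm, hp⟩ := exists_tendsto_diagonal (fun n j => measureReal_le_one (μ := P n)) fun j =>
    tendsto_measureReal_sign_change hα hk hY hERM (hεpos j) (hcond _ (hεle j))
  have hlt : ∀ n, γ - ε (m n) < γ + ε (m n) := fun n => by linarith [hεpos (m n)]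
  refine ⟨fun n ω => firstPositive (γ - ε (m n)) (γ + ε (m n))
    (estimatingFunction α (k n) (Y n ω)), fun n => ?_, ?_, fun δ hδ => ?_⟩
  · exact measurable_firstPositive fun g =>
      (measurable_estimatingFunction α (k n) g).comp (hY n)
  · refine tendsto_of_tendsto_of_tendsto_of_le_of_le (tendsto_measure_of_tendsto_real_one hp)
      tendsto_const_nhds (fun n => measure_mono fun ω hω => ?_) fun n => prob_le_one
    exact firstPositive_root (hlt n) (continuous_estimatingFunction α (k n) (Y n ω)) hω.1 hω.2
  · refine tendsto_const_nhds.congr' ?_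
    filter_upwards [(hεlim.comp hm).eventually_lt_const hδ] with n hn
    have hn' : ε (m n) < δ := hn
    have : {ω | δ ≤ |firstPositive (γ - ε (m n)) (γ + ε (m n))
        (estimatingFunction α (k n) (Y n ω)) - γ|} = ∅ := by
      refine eq_empty_of_forall_notMem fun ω hω => ?_
      have hmem := firstPositive_mem (hlt n) (estimatingFunction α (k n) (Y n ω))
      have hω' : δ ≤ _ := hω
      have : |firstPositive (γ - ε (m n)) (γ + ε (m n))
          (estimatingFunction α (k n) (Y n ω)) - γ| ≤ ε (m n) :=
        abs_le.2 ⟨by linarith [hmem.1], by linarith [hmem.2]⟩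
      linarith
    rw [this, measure_empty]

end

/-! ### The asymptotic constants -/

section Constants

variable {u : ℝ}

/-- The common form of the integrands of `a_γ` (`β = α`) and `σ_γ²` (`β = 2 α`). -/
def infoDensity (β γ u : ℝ) : ℝ :=
  rateRatio 1 (-Real.log u) γ ^ 2 * rateMoment 0 (-Real.log u) γ ^ β

lemma infoDensity_zero (hu : u ∈ Ioo (0 : ℝ) 1) (β : ℝ) :
    (-Real.log u) ^ (β + 2) = 4 * infoDensity β 0 u := by
  have hl := neg_log_pos hu
  rw [infoDensity, rateRatio, rateMoment_one_zero, rateMoment_zero_zero, Real.rpow_add hl,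
    Real.rpow_two]
  field_simp
  norm_num

lemma infoDensity_of_ne_zero (hu : u ∈ Ioo (0 : ℝ) 1) (β : ℝ) {γ : ℝ} (hγ : γ ≠ 0) :
    (1 - u ^ γ + γ * u ^ γ * Real.log u) ^ 2 * |1 - u ^ γ| ^ (β - 2) =
      |γ| ^ (β + 2) * infoDensity β γ u := by
  have hl := neg_log_pos hu
  have h0 := rateMoment_zero_pos hl γ
  have e0 : |1 - u ^ γ| = |γ| * rateMoment 0 (-Real.log u) γ := by
    rw [← abs_of_pos h0, ← abs_mul, rateMoment_zero_eq hγ, rpow_eq_exp_neg hu]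
    congr 1
    field_simp
  have e1 : (1 - u ^ γ + γ * u ^ γ * Real.log u) ^ 2 =
      |γ| ^ 4 * rateMoment 1 (-Real.log u) γ ^ 2 := by
    rw [show |γ| ^ 4 = (γ ^ 2) ^ 2 by rw [← sq_abs γ]; ring, rateMoment_one_eq hγ,
      rpow_eq_exp_neg hu]
    field_simp
    ring
  have hγ' := abs_pos.2 hγ
  rw [e0, e1, infoDensity, rateRatio, Real.mul_rpow hγ'.le h0.le, Real.rpow_sub h0,
    Real.rpow_sub hγ', Real.rpow_add hγ', Real.rpow_two, Real.rpow_two]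
  field_simp

lemma aIntegrand_eq (hu : u ∈ Ioo (0 : ℝ) 1) (α γ : ℝ) :
    aIntegrand α γ u = (if γ = 0 then 4 else |γ| ^ (α + 2)) * infoDensity α γ u := by
  unfold aIntegrand
  split_ifs with h
  · subst h
    exact infoDensity_zero hu α
  · exact infoDensity_of_ne_zero hu α h

lemma sigmaSqIntegrand_eq (hu : u ∈ Ioo (0 : ℝ) 1) (α γ : ℝ) :
    sigmaSqIntegrand α γ u =
      (if γ = 0 then 4 else |γ| ^ (2 * α + 2)) * infoDensity (2 * α) γ u := by
  unfold sigmaSqIntegrand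
  split_ifs with h
  · subst h
    exact infoDensity_zero hu (2 * α)
  · exact infoDensity_of_ne_zero hu (2 * α) h

/-- The prefactors cancel against those of the integrand, which leaves one formula for all `γ`;
`sigmaSq_eq` is its counterpart. -/
lemma aConst_eq (α γ : ℝ) :
    aConst α γ = (1 + α ^ 2) / (1 + α) ^ 3 * ∫ u in Ioo (0 : ℝ) 1, infoDensity α γ u := by
  have h : ∫ u in Ioo (0 : ℝ) 1, aIntegrand α γ u =
      (if γ = 0 then 4 else |γ| ^ (α + 2)) * ∫ u in Ioo (0 : ℝ) 1, infoDensity α γ u := by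
    rw [← integral_const_mul]
    exact setIntegral_congr_fun measurableSet_Ioo fun u hu => aIntegrand_eq hu α γ
  unfold aConst
  rw [h]
  split_ifs with h
  · rw [div_mul_eq_div_div]
    ring
  · have : |γ| ^ (α + 2) ≠ 0 := (Real.rpow_pos_of_pos (abs_pos.2 h) _).ne'
    rw [div_mul_eq_div_div]
    field_simp

lemma sigmaSq_eq {α : ℝ} (hα : 0 ≤ α) (γ : ℝ) :
    sigmaSq α γ =
      (∫ x, stdScore α x ^ 2 ∂stdExp) * ∫ u in Ioo (0 : ℝ) 1, infoDensity (2 * α) γ u := by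
  have h : ∫ u in Ioo (0 : ℝ) 1, sigmaSqIntegrand α γ u =
      (if γ = 0 then 4 else |γ| ^ (2 * α + 2)) *
        ∫ u in Ioo (0 : ℝ) 1, infoDensity (2 * α) γ u := by
    rw [← integral_const_mul]
    exact setIntegral_congr_fun measurableSet_Ioo fun u hu => sigmaSqIntegrand_eq hu α γ
  unfold sigmaSq
  rw [h, integral_stdScore_sq hα]
  split_ifs with h
  · ring
  · have : |γ| ^ (2 * α + 2) ≠ 0 := (Real.rpow_pos_of_pos (abs_pos.2 h) _).ne'
    field_simp

lemma continuousOn_infoDensity (β γ : ℝ) : ContinuousOn (infoDensity β γ) (Ioo 0 1) :=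
  ((continuousOn_rateRatio 1 γ).pow 2).mul (continuousOn_rateMoment_rpow β γ)

lemma infoDensity_pos (hu : u ∈ Ioo (0 : ℝ) 1) (β γ : ℝ) : 0 < infoDensity β γ u :=
  mul_pos (sq_pos_of_neg (rateRatio_one_neg (neg_log_pos hu) γ))
    (Real.rpow_pos_of_pos (rateMoment_zero_pos (neg_log_pos hu) γ) _)

/-- Integrability of the integrand of `σ_γ²` limits the size of a negative parameter. -/
lemma two_mul_max_lt_one {α γ : ℝ} (hα : 0 ≤ α) (h : AsymptoticVarianceExists α γ) :
    2 * (α * max (-γ) 0) < 1 := by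
  rcases le_or_gt 0 γ with hγ | hγ
  · rw [max_eq_right (by linarith)]
    simp
  rw [max_eq_left (by linarith)]
  have hint := h.2
  set c : ℝ := |γ| ^ (2 * α + 2) * (1 / (-2 * γ)) ^ (2 * α) with hc
  have hγ' : 0 < -γ := neg_pos.2 hγ
  have hc0 : 0 < c := mul_pos (Real.rpow_pos_of_pos (abs_pos.2 hγ.ne) _)
    (Real.rpow_pos_of_pos (by rw [one_div_pos]; linarith) _)
  -- Near `0` the rate is at least `u ^ γ / (-2γ)` and the squared ratio `D₁ / D₀` at least `1`.
  -- Integrability then forces `2 α γ > -1`.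
  have hev : ∀ᶠ u in nhdsWithin 0 (Ioi 0), c * u ^ (2 * α * γ) ≤ sigmaSqIntegrand α γ u := by
    have hlarge : ∀ᶠ ℓ : ℝ in atTop, 2 ≤ Real.exp (-γ * ℓ) :=
      (Real.tendsto_exp_atTop.comp (tendsto_id.const_mul_atTop hγ')).eventually_ge_atTop 2
    filter_upwards [tendsto_neg_log_nhdsGT_zero.eventually hlarge,
      tendsto_neg_log_nhdsGT_zero.eventually (eventually_ge_atTop (1 + 1 / (-γ))),
      Ioo_mem_nhdsGT one_pos] with u h1 h2 hu
    have hl := neg_log_pos hu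
    have h0 := rateMoment_zero_pos hl γ
    rw [exp_mul_neg_log hu, neg_neg] at h1
    have hX : 0 < u ^ γ := Real.rpow_pos_of_pos hu.1 _
    have hD0 : rateMoment 0 (-Real.log u) γ = (u ^ γ - 1) / (-γ) := by
      rw [rateMoment_zero_eq hγ.ne, rpow_eq_exp_neg hu, div_neg, ← neg_div]
      ring
    have hlow : 1 / (-2 * γ) * u ^ γ ≤ rateMoment 0 (-Real.log u) γ := by
      rw [hD0, le_div_iff₀ hγ']
      have : 1 / (-2 * γ) * u ^ γ * -γ = u ^ γ / 2 := by
        have := hγ.ne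
        field_simp
      rw [this]
      linarith
    -- The condition `-log u ≥ 1 + 1 / (-γ)` is exactly what makes the coefficient of `u ^ γ` on the
    -- right dominate.
    have hD1 : rateMoment 0 (-Real.log u) γ ≤ -rateMoment 1 (-Real.log u) γ := by
      rw [hD0, rateMoment_one_eq hγ.ne, ← rpow_eq_exp_neg hu, div_le_iff₀ hγ']
      have h3 : (1 + 1 / -γ) * -γ ≤ -Real.log u * -γ := by gcongr
      have h4 : (1 + 1 / -γ) * -γ = -γ + 1 := by
        rw [add_mul, div_mul_cancel₀ _ hγ'.ne']
        ring
      rw [h4] at h3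
      have h5 : -((u ^ γ - 1 + γ * u ^ γ * -Real.log u) / γ ^ 2) * -γ =
          (1 + u ^ γ * (-Real.log u * -γ - 1)) / (-γ) := by
        field_simp
        ring
      rw [h5, le_div_iff₀ hγ']
      nlinarith [mul_le_mul_of_nonneg_left h3 hX.le]
    have hr : 1 ≤ rateRatio 1 (-Real.log u) γ ^ 2 := by
      have : 1 ≤ -rateRatio 1 (-Real.log u) γ := by
        rw [rateRatio, ← neg_div, le_div_iff₀ h0, one_mul]
        exact hD1
      nlinarith
    rw [sigmaSqIntegrand_eq hu, if_neg hγ.ne, hc, mul_assoc]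
    refine mul_le_mul_of_nonneg_left ?_ (Real.rpow_nonneg (abs_nonneg _) _)
    calc (1 / (-2 * γ)) ^ (2 * α) * u ^ (2 * α * γ)
        = (1 / (-2 * γ) * u ^ γ) ^ (2 * α) := by
          rw [Real.mul_rpow (by rw [one_div_nonneg]; linarith) hX.le, ← Real.rpow_mul hu.1.le]
          ring_nf
      _ ≤ 1 * rateMoment 0 (-Real.log u) γ ^ (2 * α) := by
          rw [one_mul]
          refine Real.rpow_le_rpow ?_ hlow (by positivity)
          exact mul_nonneg (by rw [one_div_nonneg]; linarith) hX.le
      _ ≤ _ := by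
          unfold infoDensity
          gcongr
  obtain ⟨u₀, hu₀, hsub⟩ := mem_nhdsGT_iff_exists_Ioo_subset.1 hev
  set u₁ := min u₀ 1 with hu₁
  have hu₁0 : 0 < u₁ := lt_min hu₀ one_pos
  have hI : IntegrableOn (fun u : ℝ => u ^ (2 * α * γ)) (Ioo 0 u₁) := by
    have h1 : IntegrableOn (sigmaSqIntegrand α γ) (Ioo 0 u₁) :=
      hint.mono_set (Ioo_subset_Ioo_right (min_le_right _ _))
    refine Integrable.mono' (h1.const_mul (1 / c)) ?_ ?_
    · exact (by fun_prop : Measurable fun u : ℝ => u ^ (2 * α * γ)).aestronglyMeasurable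
    · filter_upwards [ae_restrict_mem measurableSet_Ioo] with u hu
      have h2 : c * u ^ (2 * α * γ) ≤ sigmaSqIntegrand α γ u :=
        hsub ⟨hu.1, hu.2.trans_le (min_le_left _ _)⟩
      rw [Real.norm_of_nonneg (Real.rpow_nonneg hu.1.le _), one_div, ← div_eq_inv_mul,
        le_div_iff₀ hc0]
      linarith
  have := (intervalIntegral.integrableOn_Ioo_rpow_iff hu₁0).1 hI
  nlinarith

end Constants

/-! ### Second-order expansion of the estimating function -/

/-- The mean value inequality is applied to `f'` and then to `f x - f' a * x`; the factor `1/2` of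
Taylor's formula is not needed. -/
lemma abs_sub_sub_mul_le_of_abs_deriv_two_le {f f' f'' : ℝ → ℝ} {a d M : ℝ}
    (hf : ∀ x, HasDerivAt f (f' x) x) (hf' : ∀ x, HasDerivAt f' (f'' x) x)
    (hM : ∀ x, |x - a| ≤ |d| → |f'' x| ≤ M) :
    |f (a + d) - f a - f' a * d| ≤ M * d ^ 2 := by
  set s := Icc (a - |d|) (a + |d|) with hs
  have hmem : ∀ x, x ∈ s ↔ |x - a| ≤ |d| := fun x => by
    rw [hs, abs_le]
    constructor
    · exact fun h => ⟨by linarith [h.1], by linarith [h.2]⟩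
    · exact fun h => ⟨by linarith [h.1], by linarith [h.2]⟩
  have ha : a ∈ s := (hmem a).2 (by simp)
  have had : a + d ∈ s := (hmem _).2 (by simp)
  have hM0 : 0 ≤ M := (abs_nonneg _).trans (hM a (by simp))
  have h1 : ∀ x ∈ s, ‖f' x - f' a‖ ≤ M * |d| := fun x hx => by
    have := (convex_Icc (a - |d|) (a + |d|)).norm_image_sub_le_of_norm_hasDerivWithin_le
      (fun y _ => (hf' y).hasDerivWithinAt) (fun y hy => hM y ((hmem y).1 hy)) ha hx
    refine this.trans ?_
    gcongr
    exact (hmem x).1 hx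
  have h2 := (convex_Icc (a - |d|) (a + |d|)).norm_image_sub_le_of_norm_hasDerivWithin_le
    (f := fun x => f x - f' a * x) (f' := fun x => f' x - f' a)
    (fun y _ => by
      have := ((hf y).sub ((hasDerivAt_id y).const_mul (f' a))).hasDerivWithinAt (s := s)
      rw [mul_one] at this
      exact this) h1 ha had
  calc |f (a + d) - f a - f' a * d| = ‖f (a + d) - f' a * (a + d) - (f a - f' a * a)‖ := by
        rw [Real.norm_eq_abs]
        ring_nf
    _ ≤ M * |d| * ‖a + d - a‖ := h2
    _ = M * |d| ^ 2 := by
        rw [add_sub_cancel_left, Real.norm_eq_abs]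
        ring
    _ = _ := by rw [sq_abs]

/-- A bound for the second derivative of the contributions near the true parameter. -/
lemma exists_abs_termDerivTwo_le {α : ℝ} (hα : 0 ≤ α) (γ : ℝ) {δ ε : ℝ} (hδ : 0 < δ) :
    ∃ C : ℝ, 0 < C ∧ ∀ u ∈ Ioo (0 : ℝ) 1, ∀ y, 0 ≤ y → ∀ g, |g - γ| ≤ ε →
      |termDerivTwo α (-Real.log u) y g| ≤
        C * u ^ (-(α * max (-γ) 0 + δ + (α + 3) * ε)) *
          (1 + |y * rateMoment 0 (-Real.log u) γ|) ^ 3 := by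
  obtain ⟨C, hC, h⟩ := exists_rateMoment_rpow_mul_le hα γ 3 hδ
  refine ⟨C * (21 * (1 + α) ^ 2), by positivity, fun u hu y hy g hg => ?_⟩
  have hl := neg_log_pos hu
  have h0 := rateMoment_zero_pos hl γ
  have hg0 := rateMoment_zero_pos hl g
  have hε : 0 ≤ ε := (abs_nonneg _).trans hg
  have hx : 0 ≤ y * rateMoment 0 (-Real.log u) γ := by positivity
  rw [abs_of_nonneg hx]
  have hpow : ∀ {c : ℝ}, 0 ≤ c → u ^ (-(c * |g - γ|)) ≤ u ^ (-(c * ε)) := fun {c} hc => by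
    refine Real.rpow_le_rpow_of_exponent_ge hu.1 hu.2.le ?_
    have := mul_le_mul_of_nonneg_left hg hc
    linarith
  have h1 : rateMoment 0 (-Real.log u) g ^ α ≤
      u ^ (-(α * ε)) * rateMoment 0 (-Real.log u) γ ^ α :=
    (rateMoment_zero_rpow_le hα hu g γ).trans (by gcongr ?_ * _; exact hpow hα)
  have hr : rateMoment 0 (-Real.log u) g ≤ u ^ (-ε) * rateMoment 0 (-Real.log u) γ := by
    refine (rateMoment_zero_le_rpow_mul hu g γ).trans ?_
    gcongr ?_ * _
    simpa using hpow zero_le_one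
  have hu1 : 0 < u ^ (-ε) := Real.rpow_pos_of_pos hu.1 _
  have h2 : 1 + y * rateMoment 0 (-Real.log u) g ≤
      u ^ (-ε) * (1 + y * rateMoment 0 (-Real.log u) γ) := by
    have := one_le_rpow_neg hu hε
    have := mul_le_mul_of_nonneg_left hr hy
    linarith
  have e3 : (u ^ (-ε)) ^ 3 = u ^ (-(3 * ε)) := by
    rw [← Real.rpow_natCast, ← Real.rpow_mul hu.1.le]
    congr 1
    push_cast
    ring
  have hxs : ∀ s : ℝ, 0 ≤ u ^ s := fun s => Real.rpow_nonneg hu.1.le _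
  have hnn : 0 ≤ u ^ (-(α * ε)) * rateMoment 0 (-Real.log u) γ ^ α * (-Real.log u) ^ 3 *
      (21 * (1 + α) ^ 2) := by
    have := hxs (-(α * ε))
    positivity
  refine (abs_termDerivTwo_le hα hl hy g).trans ?_
  calc _ ≤ u ^ (-(α * ε)) * rateMoment 0 (-Real.log u) γ ^ α * (-Real.log u) ^ 3 *
        (21 * (1 + α) ^ 2) * (u ^ (-ε) * (1 + y * rateMoment 0 (-Real.log u) γ)) ^ 3 := by
        gcongr
    _ = (rateMoment 0 (-Real.log u) γ ^ α * (-Real.log u) ^ 3) *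
        (u ^ (-(α * ε)) * (21 * (1 + α) ^ 2) * u ^ (-(3 * ε)) *
          (1 + y * rateMoment 0 (-Real.log u) γ) ^ 3) := by
        rw [mul_pow, e3]
        ring
    _ ≤ (C * u ^ (-(α * max (-γ) 0 + δ))) *
        (u ^ (-(α * ε)) * (21 * (1 + α) ^ 2) * u ^ (-(3 * ε)) *
          (1 + y * rateMoment 0 (-Real.log u) γ) ^ 3) := by
        refine mul_le_mul_of_nonneg_right (h u hu) ?_
        have := hxs (-(α * ε))
        have := hxs (-(3 * ε))
        positivity
    _ = C * (21 * (1 + α) ^ 2) *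
        (u ^ (-(α * max (-γ) 0 + δ)) * u ^ (-(α * ε)) * u ^ (-(3 * ε))) *
          (1 + y * rateMoment 0 (-Real.log u) γ) ^ 3 := by ring
    _ = _ := by
        rw [← Real.rpow_add hu.1, ← Real.rpow_add hu.1]
        ring_nf

/-! ### Limit theorems in the exponential regression model -/

section Model

variable {α γ : ℝ}

lemma tendsto_inv_natCast_add_one_mul (C : ℝ) :
    Tendsto (fun k : ℕ => C / ((k : ℝ) + 1)) atTop (nhds 0) :=
  tendsto_natCast_add_one_atTop.const_div_atTop C

lemma rateQuot_self {u : ℝ} (hu : u ∈ Ioo (0 : ℝ) 1) (γ : ℝ) : rateQuot γ γ u = 1 :=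
  div_self (rateMoment_zero_pos (neg_log_pos hu) γ).ne'

lemma coeff_sq {u : ℝ} (hu : u ∈ Ioo (0 : ℝ) 1) (α γ : ℝ) :
    coeff α γ u ^ 2 = infoDensity (2 * α) γ u := by
  have h0 := rateMoment_zero_pos (neg_log_pos hu) γ
  rw [coeff, infoDensity, mul_pow, ← Real.rpow_natCast, ← Real.rpow_mul h0.le, mul_comm]
  push_cast
  ring_nf

/-- The derivative of the estimating function at the parameter `γ`. -/
def slope (α γ : ℝ) (k : ℕ) (y : Fin (k - 1) → ℝ) : ℝ :=
  ∑ i : Fin (k - 1), termDeriv α (-Real.log (designPoint k i)) (y i) γ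

lemma measurable_slope (α γ : ℝ) (k : ℕ) : Measurable (slope α γ k) :=
  Finset.measurable_sum _ fun i _ => (measurable_termDeriv α _ γ).comp (measurable_pi_apply i)

lemma exists_abs_coeff_le (hα : 0 ≤ α) (γ : ℝ) {δ : ℝ} (hδ : 0 < δ) :
    ∃ C : ℝ, 0 < C ∧ ∀ u ∈ Ioo (0 : ℝ) 1,
      |coeff α γ u| ≤ C * u ^ (-(α * max (-γ) 0 + δ)) := by
  obtain ⟨C, hC, h⟩ := exists_rateMoment_rpow_mul_le hα γ 1 hδ
  refine ⟨C, hC, fun u hu => le_trans ?_ (h u hu)⟩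
  have hl := neg_log_pos hu
  have h0 := Real.rpow_nonneg (rateMoment_zero_pos hl γ).le α
  rw [coeff, abs_mul, abs_of_nonneg h0]
  gcongr
  exact abs_rateRatio_le 1 hl γ

lemma exists_infoDensity_le (hα : 0 ≤ α) (γ : ℝ) {δ : ℝ} (hδ : 0 < δ) :
    ∃ C : ℝ, 0 < C ∧ ∀ u ∈ Ioo (0 : ℝ) 1,
      |infoDensity α γ u| ≤ C * u ^ (-(α * max (-γ) 0 + δ)) := by
  obtain ⟨C, hC, h⟩ := exists_rateMoment_rpow_mul_le hα γ 2 hδ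
  refine ⟨C, hC, fun u hu => le_trans ?_ (h u hu)⟩
  have hl := neg_log_pos hu
  have h0 := Real.rpow_nonneg (rateMoment_zero_pos hl γ).le α
  rw [infoDensity, abs_mul, abs_of_nonneg h0, mul_comm, abs_pow]
  gcongr
  simpa using abs_rateRatio_le 1 hl γ

lemma integral_infoDensity_pos (hα : 0 ≤ α) (hq : 2 * (α * max (-γ) 0) < 1) :
    0 < ∫ u in Ioo (0 : ℝ) 1, infoDensity α γ u := by
  obtain ⟨C, hC, h⟩ := exists_infoDensity_le hα γ (show (0 : ℝ) < 1 / 4 by norm_num)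
  rw [setIntegral_pos_iff_support_of_nonneg_ae]
  · exact lt_of_lt_of_le (b := volume (Ioo (0 : ℝ) 1)) (by simp)
      (measure_mono fun u hu => ⟨(infoDensity_pos hu α γ).ne', hu⟩)
  · filter_upwards [ae_restrict_mem measurableSet_Ioo] with u hu
    exact (infoDensity_pos hu α γ).le
  · exact integrableOn_Ioo_of_le (continuousOn_infoDensity α γ) (by linarith) h

lemma aConst_pos (hα : 0 ≤ α) (hq : 2 * (α * max (-γ) 0) < 1) : 0 < aConst α γ := by
  rw [aConst_eq]
  have := integral_infoDensity_pos hα hq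
  positivity

/-- Law of large numbers for the slope of the estimating function. -/
lemma tendsto_ermLaw_slope (hα : 0 ≤ α) (hq : 2 * (α * max (-γ) 0) < 1) {η : ℝ} (hη : 0 < η) :
    Tendsto (fun k : ℕ => (ermLaw γ k).real
      {y | η ≤ |slope α γ k y / ((k : ℝ) + 1) - aConst α γ|}) atTop (nhds 0) := by
  set q := α * max (-γ) 0 with hqdef
  have hq0 : 0 ≤ q := by positivity
  -- Chosen so that `2 (q + δ) = (1 + 2 q) / 2 < 1`: the variances of the slope terms have an
  -- integrable singularity.
  set δ := (1 - 2 * q) / 4 with hδ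
  have hδ0 : 0 < δ := by
    rw [hδ]
    linarith
  obtain ⟨C, hC, hCb⟩ := exists_rateMoment_rpow_mul_le hα γ 2 hδ0
  obtain ⟨C', hC', hCb'⟩ := exists_infoDensity_le hα γ hδ0
  have hmean : Tendsto (fun k : ℕ => (∑ i : Fin (k - 1),
      (1 + α ^ 2) / (1 + α) ^ 3 * infoDensity α γ (designPoint k i)) / ((k : ℝ) + 1)) atTop
      (nhds (aConst α γ)) := by
    rw [aConst_eq]
    refine ((tendsto_riemannSum (continuousOn_infoDensity α γ) (by positivity)
      (by rw [hδ]; linarith) hCb').const_mul _).congr fun k => ?_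
    rw [← Finset.mul_sum, mul_div_assoc]
  set f : ∀ k, Fin (k - 1) → ℝ → ℝ := fun k i x =>
    termDeriv α (-Real.log (designPoint k i)) (x / rate γ k i) γ with hf
  have hcancel : ∀ k (i : Fin (k - 1)) x,
      x / rate γ k i * rateMoment 0 (-Real.log (designPoint k i)) γ = x := fun k i x =>
    div_mul_cancel₀ _ (rate_pos γ k i).ne'
  have hfm : ∀ k i, Measurable (f k i) := fun k i =>
    (measurable_termDeriv α _ γ).comp (measurable_id.div_const _)
  set D : ℝ → ℝ := fun u => rateMoment 0 (-Real.log u) γ ^ α * (-Real.log u) ^ 2 * (5 * (1 + α))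
    with hD
  have hfb : ∀ k i x, 0 < x → |f k i x| ≤ D (designPoint k i) * (1 + x) ^ 2 := fun k i x hx => by
    have := abs_termDeriv_le hα (neg_log_pos (designPoint_mem k i))
      (div_pos hx (rate_pos γ k i)).le γ
    rwa [hcancel] at this
  have hfL : ∀ k i, MemLp (f k i) 2 stdExp := fun k i =>
    memLp_two_stdExp_of_le (hfm k i) 2 (hfb k i)
  -- At the true parameter the score is centred, so every term of the derivative that contains it
  -- drops out of the mean.
  have hfmean : ∀ k i, ∫ x, f k i x ∂stdExp =
      (1 + α ^ 2) / (1 + α) ^ 3 * infoDensity α γ (designPoint k i) := fun k i => by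
    have i1 : Integrable (stdScore α) stdExp := by
      simpa using integrable_stdScore_mul hα zero_le_one
    obtain ⟨i2, h2⟩ := integral_stdScoreDeriv hα
    have e : f k i = fun x => rateMoment 0 (-Real.log (designPoint k i)) γ ^ α *
        ((rateRatio 2 (-Real.log (designPoint k i)) γ +
          rateRatio 1 (-Real.log (designPoint k i)) γ ^ 2 * (α - 1)) * stdScore α x +
        rateRatio 1 (-Real.log (designPoint k i)) γ ^ 2 * stdScoreDeriv α x) := by
      ext x
      simp only [hf, termDeriv, hcancel]
      ring
    rw [e, integral_const_mul, integral_add (i1.const_mul _) (i2.const_mul _),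
      integral_const_mul, integral_const_mul, h2, integral_stdScore hα, infoDensity]
    ring
  set μ₄ := ∫ x, (1 + x) ^ 4 ∂stdExp with hμ
  have hfvar : ∀ k i, Var[f k i; stdExp] ≤ D (designPoint k i) ^ 2 * μ₄ := fun k i => by
    refine (variance_le_expectation_sq (hfL k i).1).trans ?_
    rw [hμ, ← integral_const_mul]
    refine integral_mono_of_nonneg (Eventually.of_forall fun x => sq_nonneg _)
      ((integrable_one_add_pow_stdExp 4).const_mul _) ?_
    filter_upwards [ae_stdExp_pos] with x hx
    have := pow_le_pow_left₀ (abs_nonneg _) (hfb k i x hx) 2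
    rw [sq_abs] at this
    refine this.trans_eq ?_
    ring
  have hμ0 : 0 ≤ μ₄ := integral_nonneg fun x => by positivity
  obtain ⟨B, hB, hBs⟩ := exists_sum_rpow_designPoint_le (s := 2 * (q + δ)) (by positivity)
    (by rw [hδ]; linarith)
  set K := (C * (5 * (1 + α))) ^ 2 * μ₄ * B with hK
  have hK0 : 0 ≤ K := by positivity
  have hvarsum : ∀ k : ℕ, ∑ i, Var[f k i; stdExp] ≤ K * ((k : ℝ) + 1) := fun k => by
    have h1 : ∀ i, Var[f k i; stdExp] ≤
        (C * (5 * (1 + α))) ^ 2 * μ₄ * designPoint k i ^ (-(2 * (q + δ))) := fun i => by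
      have hu := designPoint_mem k i
      have hl := neg_log_pos hu
      have h0 := Real.rpow_nonneg (rateMoment_zero_pos hl γ).le α
      refine (hfvar k i).trans ?_
      have h2 : D (designPoint k i) ≤ C * designPoint k i ^ (-(q + δ)) * (5 * (1 + α)) := by
        simp only [hD]
        exact mul_le_mul_of_nonneg_right (hCb _ hu) (by positivity)
      have h3 : 0 ≤ D (designPoint k i) := by
        simp only [hD]
        positivity
      calc D (designPoint k i) ^ 2 * μ₄
          ≤ (C * designPoint k i ^ (-(q + δ)) * (5 * (1 + α))) ^ 2 * μ₄ := by gcongr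
        _ = (C * (5 * (1 + α))) ^ 2 * μ₄ *
            (designPoint k i ^ (-(q + δ)) * designPoint k i ^ (-(q + δ))) := by ring
        _ = _ := by
            rw [← Real.rpow_add hu.1]
            ring_nf
    calc _ ≤ ∑ i, (C * (5 * (1 + α))) ^ 2 * μ₄ * designPoint k i ^ (-(2 * (q + δ))) :=
          Finset.sum_le_sum fun i _ => h1 i
      _ = (C * (5 * (1 + α))) ^ 2 * μ₄ * ∑ i, designPoint k i ^ (-(2 * (q + δ))) := by
          rw [Finset.mul_sum]
      _ ≤ (C * (5 * (1 + α))) ^ 2 * μ₄ * (B * ((k : ℝ) + 1)) := by gcongr; exact hBs k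
      _ = _ := by ring
  refine squeeze_zero' (Eventually.of_forall fun k => measureReal_nonneg) ?_
    (tendsto_inv_natCast_add_one_mul (K / (η / 2) ^ 2))
  filter_upwards [(Metric.tendsto_nhds.1 hmean) (η / 2) (half_pos hη)] with k hk
  have hk0 : (0 : ℝ) < (k : ℝ) + 1 := by positivity
  rw [ermLaw_real_apply γ k (measurableSet_le measurable_const
    (((measurable_slope α γ k).div_const _).sub_const _).abs)]
  have hcheb := measureReal_pi_abs_sum_sub_ge_le (hfL k)
    (show 0 < η / 2 * ((k : ℝ) + 1) by positivity)
  simp only [hfmean] at hcheb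
  refine (le_trans (measureReal_mono fun e he => ?_) hcheb).trans ?_
  · have he' : η ≤ |slope α γ k (fun i => e i / rate γ k i) / ((k : ℝ) + 1) - aConst α γ| := he
    have hs : slope α γ k (fun i => e i / rate γ k i) = ∑ i, f k i (e i) := rfl
    rw [hs] at he'
    change _ ≤ |∑ i, f k i (e i) - ∑ i : Fin (k - 1), (1 + α ^ 2) / (1 + α) ^ 3 *
      infoDensity α γ (designPoint k i)|
    generalize ∑ i, f k i (e i) = S at *
    generalize ∑ i : Fin (k - 1), (1 + α ^ 2) / (1 + α) ^ 3 *
      infoDensity α γ (designPoint k i) = m at *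
    rw [Real.dist_eq] at hk
    have h1 : η ≤ |S / ((k : ℝ) + 1) - m / ((k : ℝ) + 1)| + |m / ((k : ℝ) + 1) - aConst α γ| :=
      he'.trans (abs_sub_le _ _ _)
    have h2 : |S / ((k : ℝ) + 1) - m / ((k : ℝ) + 1)| = |S - m| / ((k : ℝ) + 1) := by
      rw [← sub_div, abs_div, abs_of_pos hk0]
    rw [← le_div_iff₀ hk0, ← h2]
    linarith
  · calc _ ≤ K * ((k : ℝ) + 1) / (η / 2 * ((k : ℝ) + 1)) ^ 2 := by
          gcongr
          exact hvarsum k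
      _ = _ := by field_simp

/-- The leading term in the expansion of the standardized estimator. -/
def leadingTerm (α γ : ℝ) (k : ℕ) (y : Fin (k - 1) → ℝ) : ℝ :=
  -(Real.sqrt ((k : ℝ) - 1) / (aConst α γ * ((k : ℝ) + 1))) * estimatingFunction α k y γ

/-- The coefficients of the standardized scores in `leadingTerm`. -/
def leadingCoeff (α γ : ℝ) (k : ℕ) (i : Fin (k - 1)) : ℝ :=
  -(Real.sqrt ((k : ℝ) - 1) / (aConst α γ * ((k : ℝ) + 1))) * coeff α γ (designPoint k i)

lemma measurable_leadingTerm (α γ : ℝ) (k : ℕ) : Measurable (leadingTerm α γ k) :=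
  (measurable_estimatingFunction α k γ).const_mul _

lemma leadingTerm_div_rate (α γ : ℝ) (k : ℕ) (e : Fin (k - 1) → ℝ) :
    leadingTerm α γ k (fun i => e i / rate γ k i) =
      ∑ i, leadingCoeff α γ k i * stdScore α (e i) := by
  rw [leadingTerm, estimatingFunction_eq, Finset.mul_sum]
  refine Finset.sum_congr rfl fun i _ => ?_
  rw [rate, term_div_eq, rateQuot_self (designPoint_mem k i), one_mul, leadingCoeff]
  ring

lemma tendsto_sum_leadingCoeff_sq (hα : 0 ≤ α) (hq : 2 * (α * max (-γ) 0) < 1) :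
    Tendsto (fun k => ∑ i, leadingCoeff α γ k i ^ 2) atTop
      (nhds ((∫ u in Ioo (0 : ℝ) 1, infoDensity (2 * α) γ u) / aConst α γ ^ 2)) := by
  have ha := aConst_pos hα hq
  set δ := (1 - 2 * (α * max (-γ) 0)) / 2 with hδ
  have hδ0 : 0 < δ := by
    rw [hδ]
    linarith
  obtain ⟨C, hC, hCb⟩ := exists_infoDensity_le (α := 2 * α) (by positivity) γ hδ0
  have h1 := tendsto_riemannSum (continuousOn_infoDensity (2 * α) γ) (by positivity)
    (by rw [hδ]; linarith) hCb
  -- The correction `(k - 1) / (k + 1)` between the norming by `k - 1` and the mesh of the Riemann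
  -- sum.
  have h2 : Tendsto (fun k : ℕ => 1 - 2 / ((k : ℝ) + 1)) atTop (nhds 1) := by
    simpa using (tendsto_inv_natCast_add_one_mul 2).const_sub 1
  have h3 := (h2.mul h1).div_const (aConst α γ ^ 2)
  rw [one_mul] at h3
  refine h3.congr' ?_
  filter_upwards [eventually_ge_atTop 1] with k hk
  have hk' : (0 : ℝ) ≤ (k : ℝ) - 1 := by
    have : (1 : ℝ) ≤ k := by exact_mod_cast hk
    linarith
  have hk0 : (0 : ℝ) < (k : ℝ) + 1 := by positivity
  simp only [leadingCoeff, mul_pow, neg_sq, div_pow, Real.sq_sqrt hk']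
  rw [← Finset.mul_sum, Finset.sum_congr rfl fun i _ => coeff_sq (designPoint_mem k i) α γ]
  field_simp
  ring

/-- Design points are at least `1 / (k + 1)`, so the coefficient is `O((k+1)^s)`; the condition on
`γ` allows `s < 1/2`, which the norming of order `k ^ (-1/2)` beats. -/
lemma eventually_abs_leadingCoeff_le (hα : 0 ≤ α) (hq : 2 * (α * max (-γ) 0) < 1) {ε : ℝ}
    (hε : 0 < ε) : ∀ᶠ k in atTop, ∀ i, |leadingCoeff α γ k i| ≤ ε := by
  have ha := aConst_pos hα hq
  set δ := (1 - 2 * (α * max (-γ) 0)) / 4 with hδ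
  have hδ0 : 0 < δ := by
    rw [hδ]
    linarith
  obtain ⟨C, hC, hCb⟩ := exists_abs_coeff_le hα γ hδ0
  set s := α * max (-γ) 0 + δ with hs
  have hs0 : 0 ≤ s := by positivity
  have hs2 : 0 < 1 / 2 - s := by
    rw [hs, hδ]
    linarith
  have hlim : Tendsto (fun k : ℕ => C / aConst α γ * ((k : ℝ) + 1) ^ (-(1 / 2 - s))) atTop
      (nhds 0) := by
    have := ((tendsto_rpow_neg_atTop hs2).comp tendsto_natCast_add_one_atTop).const_mul
      (C / aConst α γ)
    rwa [mul_zero] at this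
  filter_upwards [hlim.eventually_lt_const hε] with k hk i
  refine le_trans ?_ hk.le
  have hk0 : (0 : ℝ) < (k : ℝ) + 1 := by positivity
  have hu := designPoint_mem k i
  have h1 : |coeff α γ (designPoint k i)| ≤ C * ((k : ℝ) + 1) ^ s := by
    refine (hCb _ hu).trans ?_
    gcongr C * ?_
    calc designPoint k i ^ (-s) ≤ (1 / ((k : ℝ) + 1)) ^ (-s) :=
          Real.rpow_le_rpow_of_nonpos (by positivity) (one_div_le_designPoint k i) (by linarith)
      _ = _ := by rw [one_div, Real.inv_rpow hk0.le, Real.rpow_neg hk0.le, inv_inv]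
  have h2 : Real.sqrt ((k : ℝ) - 1) ≤ ((k : ℝ) + 1) ^ (1 / 2 : ℝ) := by
    rw [← Real.sqrt_eq_rpow]
    exact Real.sqrt_le_sqrt (by linarith)
  rw [leadingCoeff, abs_mul, abs_neg, abs_of_nonneg (by positivity)]
  calc _ ≤ ((k : ℝ) + 1) ^ (1 / 2 : ℝ) / (aConst α γ * ((k : ℝ) + 1)) *
        (C * ((k : ℝ) + 1) ^ s) := by gcongr
    _ = C / aConst α γ *
        (((k : ℝ) + 1) ^ (1 / 2 : ℝ) * ((k : ℝ) + 1) ^ s * ((k : ℝ) + 1) ^ (-1 : ℝ)) := by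
        rw [Real.rpow_neg_one]
        field_simp
    _ = _ := by
        rw [← Real.rpow_add hk0, ← Real.rpow_add hk0]
        ring_nf

lemma tendstoInDistribution_leadingTerm (hα : 0 ≤ α) (hq : 2 * (α * max (-γ) 0) < 1)
    {k : ℕ → ℕ} (hk : Tendsto k atTop atTop) :
    TendstoInDistribution (fun n => leadingTerm α γ (k n)) atTop (id : ℝ → ℝ)
      (fun n => ermLaw γ (k n))
      (gaussianReal 0 (sigmaSq α γ / aConst α γ ^ 2).toNNReal) := by
  have hL : MemLp (stdScore α) 2 stdExp := by
    simpa using memLp_stdScore_mul hα zero_le_one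
  have h := tendstoInDistribution_weightedSum (continuous_stdScore α).measurable hL
    (integral_stdScore hα) (fun n => leadingCoeff α γ (k n))
    ((tendsto_sum_leadingCoeff_sq hα hq).comp hk)
    fun ε hε => hk.eventually (eventually_abs_leadingCoeff_le hα hq hε)
  rw [← mul_div_assoc, ← sigmaSq_eq hα] at h
  refine ⟨fun n => (measurable_leadingTerm α γ (k n)).aemeasurable, by fun_prop, ?_⟩
  refine (tendsto_congr fun n => Subtype.ext ?_).2 h.tendsto
  change (ermLaw γ (k n)).map (leadingTerm α γ (k n)) = _
  rw [ermLaw_eq, Measure.map_map (measurable_leadingTerm α γ (k n)) (measurable_div_rate γ (k n))]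
  congr 1
  ext e
  exact leadingTerm_div_rate α γ (k n) e

/-- Tightness of the leading term, by Chebyshev with a constant that depends neither on `k` nor on
`L`. -/
lemma exists_ermLaw_leadingTerm_le (hα : 0 ≤ α) (hq : 2 * (α * max (-γ) 0) < 1) :
    ∃ B : ℝ, ∀ᶠ k in atTop, ∀ L : ℝ, 0 < L →
      (ermLaw γ k).real {y | L ≤ |leadingTerm α γ k y|} ≤ B / L ^ 2 := by
  have hL : MemLp (stdScore α) 2 stdExp := by
    simpa using memLp_stdScore_mul hα zero_le_one
  set V := (∫ u in Ioo (0 : ℝ) 1, infoDensity (2 * α) γ u) / aConst α γ ^ 2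
  refine ⟨(V + 1) * Var[stdScore α; stdExp], ?_⟩
  filter_upwards [(tendsto_sum_leadingCoeff_sq hα hq).eventually_lt_const (lt_add_one V)]
    with k hk L hL0
  rw [ermLaw_real_apply γ k (measurableSet_le measurable_const (measurable_leadingTerm α γ k).abs)]
  have hcheb := measureReal_pi_abs_sum_sub_ge_le
    (f := fun i x => leadingCoeff α γ k i * stdScore α x) (fun i => hL.const_mul _) hL0
  simp only [variance_const_mul, integral_const_mul, integral_stdScore hα, mul_zero,
    Finset.sum_const_zero, sub_zero] at hcheb
  refine (le_trans (measureReal_mono fun e he => ?_) hcheb).trans ?_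
  · have he' : L ≤ |leadingTerm α γ k (fun i => e i / rate γ k i)| := he
    rwa [leadingTerm_div_rate] at he'
  · rw [← Finset.sum_mul]
    have := variance_nonneg (stdScore α) stdExp
    gcongr

/-- The remainder bound requires nonnegative observations. The data need not be nonnegative, but by
transfer they are so with probability tending to one. -/
lemma ermLaw_exists_neg (γ : ℝ) (k : ℕ) : (ermLaw γ k).real {y | ∃ i, y i < 0} = 0 := by
  have hm : MeasurableSet {y : Fin (k - 1) → ℝ | ∃ i, y i < 0} := by
    have : {y : Fin (k - 1) → ℝ | ∃ i, y i < 0} = ⋃ i, {y | y i < 0} := by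
      ext y
      simp
    rw [this]
    exact MeasurableSet.iUnion fun i => measurableSet_lt (measurable_pi_apply i) measurable_const
  rw [ermLaw_real_apply γ k hm]
  have h : ∀ᵐ e ∂stdLaw k, ∀ i, 0 < e i := ae_all_iff.2 fun i =>
    (measurePreserving_eval (fun _ : Fin (k - 1) => stdExp) i).quasiMeasurePreserving.ae
      ae_stdExp_pos
  rw [measureReal_def, ENNReal.toReal_eq_zero_iff]
  left
  refine measure_mono_null (fun e he => ?_) (ae_iff.1 h)
  obtain ⟨i, hi⟩ := he
  intro hall
  have h1 : e i / rate γ k i < 0 := hi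
  linarith [div_pos (hall i) (rate_pos γ k i)]

/-- Quadratic remainder in the expansion of the estimating function. -/
lemma exists_remainder_bound (hα : 0 ≤ α) (hq : 2 * (α * max (-γ) 0) < 1) :
    ∃ (ε : ℝ) (R : ∀ k, (Fin (k - 1) → ℝ) → ℝ) (B : ℝ), 0 < ε ∧ (∀ k, Measurable (R k)) ∧
      (∀ k y d, (∀ i, 0 ≤ y i) → |d| ≤ ε →
        |estimatingFunction α k y (γ + d) - estimatingFunction α k y γ - slope α γ k y * d| ≤
          R k y * d ^ 2) ∧
      ∀ (k : ℕ) (K : ℝ), 0 < K → (ermLaw γ k).real {y | K * ((k : ℝ) + 1) ≤ R k y} ≤ B / K := by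
  set q := α * max (-γ) 0 with hqdef
  have hq0 : 0 ≤ q := by positivity
  set δ := (1 - 2 * q) / 4 with hδ
  have hδ0 : 0 < δ := by
    rw [hδ]
    linarith
  -- With this radius the exponent of the second derivative is `s = (1 + q) / 2 < 1`.
  set ε := 1 / (4 * (α + 3)) with hε
  have hε0 : 0 < ε := by positivity
  have hεα : (α + 3) * ε = 1 / 4 := by
    rw [hε]
    field_simp
  obtain ⟨C, hC, hCb⟩ := exists_abs_termDerivTwo_le hα γ (ε := ε) hδ0
  set s := q + δ + (α + 3) * ε with hs
  have hs1 : s < 1 := by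
    rw [hs, hεα, hδ]
    linarith
  obtain ⟨B, hB, hBs⟩ := exists_sum_rpow_designPoint_le (s := s) (by positivity) hs1
  set R : ∀ k, (Fin (k - 1) → ℝ) → ℝ := fun k y =>
    ∑ i, C * designPoint k i ^ (-s) * (1 + |y i * rate γ k i|) ^ 3 with hR
  have hRm : ∀ k, Measurable (R k) := fun k => by
    simp only [hR]
    fun_prop
  set μ₃ := ∫ x, (1 + |x|) ^ 3 ∂stdExp with hμ
  have hμi : Integrable (fun x : ℝ => (1 + |x|) ^ 3) stdExp := by
    refine (integrable_one_add_pow_stdExp 3).congr ?_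
    filter_upwards [ae_stdExp_pos] with x hx
    rw [abs_of_pos hx]
  refine ⟨ε, R, C * B * μ₃, hε0, hRm, fun k y d hy hd => ?_, fun k K hK => ?_⟩
  · have h1 : ∀ i, |term α (-Real.log (designPoint k i)) (y i) (γ + d) -
        term α (-Real.log (designPoint k i)) (y i) γ -
        termDeriv α (-Real.log (designPoint k i)) (y i) γ * d| ≤
        C * designPoint k i ^ (-s) * (1 + |y i * rate γ k i|) ^ 3 * d ^ 2 := fun i => by
      have hl := neg_log_pos (designPoint_mem k i)
      refine abs_sub_sub_mul_le_of_abs_deriv_two_le (hasDerivAt_term α hl (y i))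
        (hasDerivAt_termDeriv α hl (y i)) fun x hx => ?_
      exact hCb _ (designPoint_mem k i) _ (hy i) x (hx.trans hd)
    rw [estimatingFunction_eq, estimatingFunction_eq, slope, Finset.sum_mul,
      ← Finset.sum_sub_distrib, ← Finset.sum_sub_distrib]
    refine (Finset.abs_sum_le_sum_abs _ _).trans ?_
    simp only [hR, Finset.sum_mul]
    exact Finset.sum_le_sum fun i _ => h1 i
  · have hk0 : (0 : ℝ) < (k : ℝ) + 1 := by positivity
    rw [ermLaw_real_apply γ k (measurableSet_le measurable_const (hRm k))]
    have hRe : ∀ e : Fin (k - 1) → ℝ, R k (fun i => e i / rate γ k i) =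
        ∑ i, C * designPoint k i ^ (-s) * (1 + |e i|) ^ 3 := fun e => by
      simp only [hR]
      refine Finset.sum_congr rfl fun i _ => ?_
      rw [div_mul_cancel₀ _ (rate_pos γ k i).ne']
    have hint : ∀ i : Fin (k - 1), Integrable (fun e : Fin (k - 1) → ℝ =>
        C * designPoint k i ^ (-s) * (1 + |e i|) ^ 3) (stdLaw k) := fun i =>
      (integrable_comp_eval (μ := fun _ : Fin (k - 1) => stdExp) (i := i) hμi).const_mul _
    have hpos : ∀ i : Fin (k - 1), 0 ≤ designPoint k i ^ (-s) := fun i =>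
      Real.rpow_nonneg (designPoint_mem k i).1.le _
    have hmarkov := mul_meas_ge_le_integral_of_nonneg (μ := stdLaw k)
      (f := fun e => ∑ i, C * designPoint k i ^ (-s) * (1 + |e i|) ^ 3)
      (Eventually.of_forall fun e => Finset.sum_nonneg fun i _ =>
        mul_nonneg (mul_nonneg hC.le (hpos i)) (by positivity))
      (integrable_finsetSum _ fun i _ => hint i) (K * ((k : ℝ) + 1))
    rw [integral_finsetSum _ fun i _ => hint i] at hmarkov
    have hterm : ∀ i : Fin (k - 1), ∫ e, C * designPoint k i ^ (-s) * (1 + |e i|) ^ 3 ∂stdLaw k =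
        C * designPoint k i ^ (-s) * μ₃ := fun i => by
      rw [integral_const_mul]
      congr 1
      exact integral_comp_eval (μ := fun _ : Fin (k - 1) => stdExp) (i := i)
        (f := fun x : ℝ => (1 + |x|) ^ 3) hμi.aestronglyMeasurable
    simp only [hterm] at hmarkov
    rw [← Finset.sum_mul, ← Finset.mul_sum] at hmarkov
    have hμ0 : 0 ≤ μ₃ := integral_nonneg fun x => by positivity
    have hfin : C * (∑ i, designPoint k i ^ (-s)) * μ₃ ≤ C * (B * ((k : ℝ) + 1)) * μ₃ := by
      gcongr
      exact hBs k
    have hset : {e : Fin (k - 1) → ℝ | (fun i => e i / rate γ k i) ∈ {y | K * ((k : ℝ) + 1) ≤ R k y}} =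
        {e : Fin (k - 1) → ℝ | K * ((k : ℝ) + 1) ≤ ∑ i, C * designPoint k i ^ (-s) * (1 + |e i|) ^ 3} := by
      ext e
      change K * ((k : ℝ) + 1) ≤ R k _ ↔ _
      rw [hRe]
      rfl
    rw [hset, le_div_iff₀ hK]
    refine le_of_mul_le_mul_right ?_ hk0
    calc _ = K * ((k : ℝ) + 1) * (stdLaw k).real {e | K * ((k : ℝ) + 1) ≤
          ∑ i, C * designPoint k i ^ (-s) * (1 + |e i|) ^ 3} := by
          ring
      _ ≤ _ := hmarkov.trans hfin
      _ = _ := by ring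

end Model

/-! ### Asymptotic normality of consistent roots -/

section Normality

variable {Ω : ℕ → Type*} [∀ n, MeasurableSpace (Ω n)] {P : ∀ n, Measure (Ω n)}
  [∀ n, IsProbabilityMeasure (P n)] {α γ : ℝ} {k : ℕ → ℕ} {Y : ∀ n, Ω n → Fin (k n - 1) → ℝ}

/-- Deterministic comparison of the standardized root with the leading term. -/
lemma abs_sub_leadingTerm_le {m : ℕ} {y : Fin (m - 1) → ℝ} {d R η L : ℝ} (ha : 0 < aConst α γ)
    (hroot : estimatingFunction α m y (γ + d) = 0)
    (hR : |estimatingFunction α m y (γ + d) - estimatingFunction α m y γ - slope α γ m y * d| ≤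
      R * d ^ 2)
    (hslope : |slope α γ m y / ((m : ℝ) + 1) - aConst α γ| < η)
    (hd : R * |d| ≤ η * ((m : ℝ) + 1)) (hη : 4 * η ≤ aConst α γ)
    (hL : |leadingTerm α γ m y| < L) :
    |Real.sqrt ((m : ℝ) - 1) * d - leadingTerm α γ m y| ≤ 4 * η * L / aConst α γ := by
  set a := aConst α γ with haa
  set Z := leadingTerm α γ m y with hZ
  set S := slope α γ m y with hS
  set Ψ := estimatingFunction α m y γ with hΨ
  set w := Real.sqrt ((m : ℝ) - 1) with hw
  have hw0 : 0 ≤ w := Real.sqrt_nonneg _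
  have hm : (0 : ℝ) < (m : ℝ) + 1 := by positivity
  have hη0 : 0 < η := (abs_nonneg _).trans_lt hslope
  have hZeq : a * Z = -(w * Ψ / ((m : ℝ) + 1)) := by
    rw [hZ, leadingTerm, ← haa, ← hw, ← hΨ]
    field_simp
  rw [hroot] at hR
  have hR' : |Ψ + S * d| ≤ η * ((m : ℝ) + 1) * |d| := by
    calc |Ψ + S * d| = |0 - Ψ - S * d| := by rw [← abs_neg]; ring_nf
      _ ≤ R * d ^ 2 := hR
      _ = R * |d| * |d| := by rw [mul_assoc, ← sq, sq_abs]
      _ ≤ _ := by gcongr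
  -- The error splits into the Taylor remainder and the fluctuation of the slope, each at most `η |w
  -- d|`.
  have h1 : a * (w * d - Z) = w * (Ψ + S * d) / ((m : ℝ) + 1) -
      w * d * (S / ((m : ℝ) + 1) - a) := by
    rw [mul_sub, hZeq]
    field_simp
    ring
  have h2 : a * |w * d - Z| ≤ 2 * η * |w * d| := by
    rw [← abs_of_pos ha, ← abs_mul, h1]
    refine (abs_sub _ _).trans ?_
    rw [abs_div, abs_mul, abs_of_nonneg hw0, abs_of_pos hm, abs_mul (w * d)]
    have h3 : w * |Ψ + S * d| / ((m : ℝ) + 1) ≤ w * (η * ((m : ℝ) + 1) * |d|) / ((m : ℝ) + 1) := by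
      gcongr
    have h4 : w * (η * ((m : ℝ) + 1) * |d|) / ((m : ℝ) + 1) = η * |w * d| := by
      rw [abs_mul, abs_of_nonneg hw0]
      field_simp
    have h5 : |w * d| * |S / ((m : ℝ) + 1) - a| ≤ |w * d| * η := by gcongr
    linarith
  have h3 : |w * d| ≤ |w * d - Z| + |Z| := by
    simpa using abs_add_le (w * d - Z) Z
  have h4 : 4 * η * |w * d - Z| ≤ a * |w * d - Z| := by gcongr
  -- Since `4 η ≤ a`, the error on the right can be absorbed on the left. Hence `|w d| ≤ 2 |Z|`, and
  -- the unknown `d` disappears from the bound.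
  have h5 : |w * d - Z| ≤ |Z| := by
    have : 4 * η * |w * d - Z| ≤ 2 * η * (|w * d - Z| + |Z|) :=
      h4.trans (h2.trans (by gcongr))
    nlinarith
  rw [le_div_iff₀ ha]
  calc |w * d - Z| * a = a * |w * d - Z| := mul_comm _ _
    _ ≤ 2 * η * |w * d| := h2
    _ ≤ 2 * η * (|Z| + |Z|) := by gcongr; linarith
    _ = 4 * η * |Z| := by ring
    _ ≤ _ := by gcongr

theorem IsConsistentRootSequence.tendstoInDistribution (hα : 0 ≤ α)
    (hq : 2 * (α * max (-γ) 0) < 1) (hk : Tendsto k atTop atTop) (hY : ∀ n, Measurable (Y n))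
    (hERM : ERMApproximation P γ k Y) {g : ∀ n, Ω n → ℝ}
    (hg : IsConsistentRootSequence P α γ k Y g) :
    TendstoInDistribution (fun n ω => Real.sqrt ((k n : ℝ) - 1) * (g n ω - γ)) atTop
      (id : ℝ → ℝ) P (gaussianReal 0 (sigmaSq α γ / aConst α γ ^ 2).toNNReal) := by
  have ha := aConst_pos hα hq
  refine tendstoInDistribution_of_sub_tendsto_zero
    (fun n => ((hg.measurable n).sub_const γ).const_mul _)
    (fun n => (measurable_leadingTerm α γ (k n)).comp (hY n))
    (hERM.tendstoInDistribution hY (fun n => measurable_leadingTerm α γ (k n))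
      (tendstoInDistribution_leadingTerm hα hq hk)) fun ε hε => ?_
  obtain ⟨ε₁, R, B, hε₁, hRm, hRb, hRt⟩ := exists_remainder_bound hα hq
  obtain ⟨B', hB'⟩ := exists_ermLaw_leadingTerm_le hα hq
  rw [Metric.tendsto_nhds]
  intro τ hτ
  -- The exceptional events cost `t + 2t + 2t + 2t + t`, and failure to be a root costs at most
  -- another `t`: in total `9t < τ`.
  set t := τ / 10 with ht
  have ht0 : 0 < t := by positivity
  obtain ⟨L, hL0, hLB⟩ : ∃ L : ℝ, 0 < L ∧ B' / L ^ 2 ≤ t := by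
    have : Tendsto (fun L : ℝ => B' / L ^ 2) atTop (nhds 0) :=
      (tendsto_pow_atTop two_ne_zero).const_div_atTop B'
    obtain ⟨L, h1, h2⟩ := ((this.eventually_lt_const ht0).and (eventually_gt_atTop 0)).exists
    exact ⟨L, h2, h1.le⟩
  obtain ⟨K, hK0, hKB⟩ : ∃ K : ℝ, 0 < K ∧ B / K ≤ t := by
    have : Tendsto (fun K : ℝ => B / K) atTop (nhds 0) := tendsto_id.const_div_atTop B
    obtain ⟨K, h1, h2⟩ := ((this.eventually_lt_const ht0).and (eventually_gt_atTop 0)).exists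
    exact ⟨K, h2, h1.le⟩
  set η := min (aConst α γ / 4) (aConst α γ * ε / (8 * L)) with hη
  have hη0 : 0 < η := lt_min (by positivity) (by positivity)
  have hη1 : 4 * η ≤ aConst α γ := by
    have := min_le_left (aConst α γ / 4) (aConst α γ * ε / (8 * L))
    linarith
  have hη2 : 4 * η * L / aConst α γ < ε := by
    rw [div_lt_iff₀ ha]
    calc 4 * η * L ≤ 4 * (aConst α γ * ε / (8 * L)) * L := by gcongr; exact min_le_right _ _
      _ = aConst α γ * ε / 2 := by field_simp; ring
      _ < ε * aConst α γ := by nlinarith [mul_pos ha hε]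
  -- The second bound turns `R < K (k + 1)` into `R |d| ≤ η (k + 1)`.
  set ε₂ := min ε₁ (η / K) with hε₂
  have hε₂0 : 0 < ε₂ := lt_min hε₁ (by positivity)
  have hmneg : ∀ m, MeasurableSet {y : Fin (m - 1) → ℝ | ∃ i, y i < 0} := fun m => by
    rw [show {y : Fin (m - 1) → ℝ | ∃ i, y i < 0} = ⋃ i, {y | y i < 0} by ext; simp]
    exact MeasurableSet.iUnion fun i => measurableSet_lt (measurable_pi_apply i) measurable_const
  have e1 := hERM.eventually_le (fun n => hmneg (k n)) (c := 0)
    (Eventually.of_forall fun n => (ermLaw_exists_neg γ (k n)).le) ht0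
  have e2 := hERM.eventually_le
    (A := fun n => {y | η ≤ |slope α γ (k n) y / ((k n : ℝ) + 1) - aConst α γ|})
    (fun n => measurableSet_le measurable_const
      (((measurable_slope α γ (k n)).div_const _).sub_const _).abs) (c := t)
    ((hk.eventually ((tendsto_ermLaw_slope hα hq hη0).eventually_lt_const ht0)).mono
      fun n hn => hn.le) ht0
  have e3 := hERM.eventually_le (A := fun n => {y | L ≤ |leadingTerm α γ (k n) y|})
    (fun n => measurableSet_le measurable_const (measurable_leadingTerm α γ (k n)).abs) (c := t)
    ((hk.eventually hB').mono fun n hn => (hn L hL0).trans hLB) ht0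
  have e4 := hERM.eventually_le (A := fun n => {y | K * ((k n : ℝ) + 1) ≤ R (k n) y})
    (fun n => measurableSet_le measurable_const (hRm (k n))) (c := t)
    (Eventually.of_forall fun n => (hRt (k n) K hK0).trans hKB) ht0
  have e5 : ∀ᶠ n in atTop, (P n).real {ω | ε₂ ≤ |g n ω - γ|} < t := by
    have := (ENNReal.tendsto_toReal ENNReal.zero_ne_top).comp (hg.consistent ε₂ hε₂0)
    rw [ENNReal.toReal_zero] at this
    exact this.eventually_lt_const ht0
  have e6 : ∀ᶠ n in atTop,
      1 - t < (P n).real {ω | estimatingFunction α (k n) (Y n ω) (g n ω) = 0} := by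
    have := (ENNReal.tendsto_toReal ENNReal.one_ne_top).comp hg.root
    rw [ENNReal.toReal_one] at this
    exact this.eventually_const_lt (by linarith)
  filter_upwards [e1, e2, e3, e4, e5, e6] with n h1 h2 h3 h4 h5 h6
  rw [Real.dist_0_eq_abs, abs_of_nonneg measureReal_nonneg]
  set root := {ω | estimatingFunction α (k n) (Y n ω) (g n ω) = 0} with hroot
  set bad := {ω | ε ≤ |Real.sqrt ((k n : ℝ) - 1) * (g n ω - γ) - leadingTerm α γ (k n) (Y n ω)|}
    with hbad
  have hbm : MeasurableSet bad := measurableSet_le measurable_const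
    ((((hg.measurable n).sub_const γ).const_mul _).sub
      ((measurable_leadingTerm α γ (k n)).comp (hY n))).abs
  -- Inclusion and exclusion needs measurability of `bad` only, so none has to be shown for the
  -- event of being a root.
  have hunion := measureReal_union_add_inter (μ := P n) (s := root) hbm
  have hone : (P n).real (root ∪ bad) ≤ 1 := measureReal_le_one
  have hsub : root ∩ bad ⊆ ((((Y n ⁻¹' {y | ∃ i, y i < 0}) ∪
      (Y n ⁻¹' {y | η ≤ |slope α γ (k n) y / ((k n : ℝ) + 1) - aConst α γ|})) ∪
      (Y n ⁻¹' {y | L ≤ |leadingTerm α γ (k n) y|})) ∪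
      (Y n ⁻¹' {y | K * ((k n : ℝ) + 1) ≤ R (k n) y})) ∪ {ω | ε₂ ≤ |g n ω - γ|} := by
    rintro ω ⟨hω, hωb⟩
    by_contra hcon
    simp only [mem_union, mem_preimage, mem_ofPred_eq, not_or, not_exists, not_lt, not_le] at hcon
    obtain ⟨⟨⟨⟨c1, c2⟩, c3⟩, c4⟩, c5⟩ := hcon
    have hω' : estimatingFunction α (k n) (Y n ω) (γ + (g n ω - γ)) = 0 := by
      rw [add_sub_cancel]
      exact hω
    have hR := hRb (k n) (Y n ω) (g n ω - γ) c1 (c5.le.trans (min_le_left _ _))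
    have hm : (0 : ℝ) < (k n : ℝ) + 1 := by positivity
    have hd : R (k n) (Y n ω) * |g n ω - γ| ≤ η * ((k n : ℝ) + 1) := by
      calc R (k n) (Y n ω) * |g n ω - γ| ≤ K * ((k n : ℝ) + 1) * (η / K) :=
            mul_le_mul c4.le (c5.le.trans (min_le_right _ _)) (abs_nonneg _) (by positivity)
        _ = _ := by field_simp
    have := abs_sub_leadingTerm_le ha hω' hR c2 hd hη1 c3
    have hωb' : ε ≤ |Real.sqrt ((k n : ℝ) - 1) * (g n ω - γ) -
      leadingTerm α γ (k n) (Y n ω)| := hωb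
    linarith
  have hle := (measureReal_mono (μ := P n) hsub).trans ((measureReal_union_le _ _).trans
    (add_le_add_left ((measureReal_union_le _ _).trans (add_le_add_left
      ((measureReal_union_le _ _).trans (add_le_add_left (measureReal_union_le _ _) _)) _)) _))
  change (P n).real bad < τ
  linarith

end Normality

end TailIndex

end

/-- Existence holds without any moment condition; finiteness of the variance enters normality only
through `2 α max(-γ,0) < 1`. -/
theorem theorem1
    {Ω : ℕ → Type*} [∀ n, MeasurableSpace (Ω n)]
    (P : ∀ n, Measure (Ω n)) [∀ n, IsProbabilityMeasure (P n)]
    (α : ℝ) (hα : 0 ≤ α) (γ : ℝ)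
    (k : ℕ → ℕ) (hk : Tendsto k atTop atTop)
    (Y : ∀ n, Ω n → Fin (k n - 1) → ℝ) (hY : ∀ n, Measurable (Y n))
    (hERM : TailIndex.ERMApproximation P γ k Y) :
    (∃ g : ∀ n, Ω n → ℝ, TailIndex.IsConsistentRootSequence P α γ k Y g) ∧
    (TailIndex.AsymptoticVarianceExists α γ →
      ∀ g : ∀ n, Ω n → ℝ, TailIndex.IsConsistentRootSequence P α γ k Y g →
        TendstoInDistribution (fun n ω => Real.sqrt ((k n : ℝ) - 1) * (g n ω - γ)) atTop
          (id : ℝ → ℝ) P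
          (gaussianReal 0 (TailIndex.sigmaSq α γ / TailIndex.aConst α γ ^ 2).toNNReal)) :=
  ⟨TailIndex.exists_isConsistentRootSequence hα hk hY hERM, fun hv _ hg =>
    hg.tendstoInDistribution hα (TailIndex.two_mul_max_lt_one hα hv) hk hY hERM⟩
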